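/- Let $\mathbb{K}$ be a first-order structure expanding an ordered field, with the order topology on $\mathbb K$ and the product topology on each $\mathbb{K}^n$. "Definable" means definable in $\mathbb{K}$ with parameters. Assume that $\mathbb{K}$ is definably complete, i.e. every definable subset of $\mathbb{K}$ has a supremum in $\mathbb{K}\cup\{\pm\infty\}$. The open core of $\mathbb{K}$ is the reduct of $\mathbb{K}$ generated by all definable open subsets of $\mathbb{K}^n$, $n\in\mathbb{N}$. A structure expanding the ordered field $\mathbb K$ is locally o-minimal if for every function $f:\mathbb{K}\to\mathbb{K}$ definable in it and every $x\in\mathbb{K}$ there is $y>x$ such that $f>0$ on $(x,y)$, or $f=0$ on $(x,y)$, or $f<0$ on $(x,y)$; it is o-minimal if every subset of $\mathbb{K}$ definable in it is a finite union of points and open intervals with endpoints in $\mathbb{K}\cup\{\pm\infty\}$. We say that $\mathbb{K}$ is a-minimal if its open core is locally o-minimal, and that $\mathbb{K}$ has o-minimal open core if its open core is o-minimal. A subset of $\mathbb{K}^n$ is pseudo-finite if it is definable, closed, bounded and discrete. For $X\subseteq\mathbb{K}^{m+n}$ and $y\in\mathbb{K}^m$ let $X_y:=\{z\in\mathbb{K}^n:(y,z)\in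 X\}$, and let $\mathrm{Fin}_m(X):=\{y\in\mathbb{K}^m: X_y\text{ is finite}\}$. "Being finite" is a definable property for $\mathbb{K}$ if for all $m,n\in\mathbb N$ and all definable $A\subseteq\mathbb{K}^m$ and $X\subseteq\mathbb{K}^{m+n}$ the set $\{y\in A: X_y\text{ is finite}\}$ is definable. The following are equivalent: 1. $\mathbb{K}$ is a-minimal, and every pseudo-finite subset of $\mathbb{K}$ is finite; 2. $\mathbb{K}$ is a-minimal, and every pseudo-finite subset of $\mathbb{K}^n$ is finite, for every $n\in\mathbb{N}$; 3. $\mathbb{K}$ is a-minimal, and for every definable $X\subseteq\mathbb{K}^2$ the set $\mathrm{Fin}_1(X)$ is definable; 4. $\mathbb{K}$ is a-minimal, and "being finite" is a definable property for $\mathbb{K}$; 5. $\mathbb{K}$ has o-minimal open core; 6. every definable closed discrete subset of $\mathbb{K}$ is finite; 7. every definable closed discrete subset of $\mathbb{K}^n$ is finite, for every $n\in\mathbb{N}$; 8. every definable discrete subset of $\mathbb{K}$ is finite; 9. every definable discrete subset of $\mathbb{K}^n$ is finite, for every $n\in\mathbb{N}$. -/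

import Mathlib

/-! Throughout, `K` carries a first-order structure in a language `L`, a subset of `K ^ n` is a term
of `Set (Fin n → K)`, and "definable" means "definable with parameters from `K`", that is,
`(Set.univ : Set K).Definable L X`.  For subsets of `K` itself and for the graph of a function
`K → K` we use `Set.Definable₁` and `Set.Definable₂`. -/

universe u v w

namespace Tame

section Definability

variable (L : FirstOrder.Language.{u, v}) {K : Type w} [L.Structure K]

/-- A subset of `K ^ n` which is definable with parameters. -/
def Def {n : ℕ} (X : Set (Fin n → K)) : Prop :=
  (Set.univ : Set K).Definable L X

/-- A subset of `K` which is definable with parameters. -/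
def Def₁ (X : Set K) : Prop :=
  (Set.univ : Set K).Definable₁ L X

/-- A function `K → K` is definable (with parameters) if its graph is. -/
def DefFun (f : K → K) : Prop :=
  (Set.univ : Set K).Definable₂ L {p : K × K | p.2 = f p.1}

/-- The fiber `X_c = {y ∈ K ^ n | (c, y) ∈ X}` of a set `X ⊆ K ^ (m + n)` over `c ∈ K ^ m`. -/
def fiber {m n : ℕ} (X : Set (Fin (m + n) → K)) (c : Fin m → K) : Set (Fin n → K) :=
  {y | Fin.append c y ∈ X}

/-- `Fin_m(X)`: the set of those `c ∈ K ^ m` for which the fiber `X_c` is finite. -/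
def finSet (m : ℕ) {n : ℕ} (X : Set (Fin (m + n) → K)) : Set (Fin m → K) :=
  {c | (fiber X c).Finite}

/-- A property `P` of subsets of the powers of `K` is definable if, for every definable family
`(X_y)_{y ∈ A}`, the set of the indices `y ∈ A` such that `P (X_y)` holds is definable. -/
def IsDefinableProperty (P : ∀ n : ℕ, Set (Fin n → K) → Prop) : Prop :=
  ∀ (m n : ℕ) (A : Set (Fin m → K)) (X : Set (Fin (m + n) → K)),
    Def L A → Def L X → Def L {y : Fin m → K | y ∈ A ∧ P n (fiber X y)}

end Definability

section Order

variable (L : FirstOrder.Language.{u, v}) (K : Type w) [L.Structure K]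

/-- Definable completeness: every definable subset of `K` has a supremum in `K ∪ {-∞, +∞}`;
that is, every nonempty definable subset of `K` that is bounded above has a supremum in `K`. -/
def IsDefinablyComplete [LinearOrder K] : Prop :=
  ∀ X : Set K, Def₁ L X → X.Nonempty → BddAbove X → ∃ s : K, IsLUB X s

/-- The `L`-structure `K` expands the given ordered field `K`: order, addition and multiplication
are definable in it. -/
structure ExpandsOrderedField [Field K] [LinearOrder K] : Prop where
  lt_def : Def L {v : Fin 2 → K | v 0 < v 1}
  add_def : Def L {v : Fin 3 → K | v 0 + v 1 = v 2}
  mul_def : Def L {v : Fin 3 → K | v 0 * v 1 = v 2}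

/-- Local o-minimality: the sign of every definable function `K → K` is constant immediately to the
right of every point. -/
def IsLocallyOMinimal [Field K] [LinearOrder K] : Prop :=
  ∀ f : K → K, DefFun L f → ∀ x : K, ∃ y : K, x < y ∧
    ((∀ z ∈ Set.Ioo x y, 0 < f z) ∨ (∀ z ∈ Set.Ioo x y, f z = 0) ∨ (∀ z ∈ Set.Ioo x y, f z < 0))

/-- `S` is a singleton or an open interval with endpoints in `K ∪ {-∞, +∞}`. -/
def IsPointOrInterval {K : Type w} [LinearOrder K] (S : Set K) : Prop :=
  (∃ a, S = {a}) ∨ (∃ a b, S = Set.Ioo a b) ∨ (∃ a, S = Set.Ioi a) ∨ (∃ b, S = Set.Iio b) ∨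
    S = Set.univ

/-- O-minimality: every definable subset of `K` is a finite union of points and open intervals. -/
def IsOMinimal [LinearOrder K] : Prop :=
  ∀ X : Set K, Def₁ L X →
    ∃ F : Set (Set K), F.Finite ∧ (∀ S ∈ F, IsPointOrInterval S) ∧ X = ⋃₀ F

end Order

section PseudoFinite

variable (L : FirstOrder.Language.{u, v}) {K : Type w} [L.Structure K]
  [Field K] [LinearOrder K] [TopologicalSpace K]

/-- A subset of `K ^ n` is pseudo-finite if it is definable, closed, bounded and discrete. -/
structure IsPseudoFinite {n : ℕ} (X : Set (Fin n → K)) : Prop where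
  definable : Def L X
  closed : IsClosed X
  bounded : ∃ r : K, ∀ x ∈ X, ∀ i, |x i| ≤ r
  discrete : IsDiscrete X

/-- A subset of `K` is pseudo-finite if it is definable, closed, bounded and discrete. -/
structure IsPseudoFinite₁ (X : Set K) : Prop where
  definable : Def₁ L X
  closed : IsClosed X
  bounded : ∃ r : K, ∀ x ∈ X, |x| ≤ r
  discrete : IsDiscrete X

end PseudoFinite

section OpenCore

variable (L : FirstOrder.Language.{u, v}) (K : Type w) [L.Structure K] [TopologicalSpace K]

/-- The language of the open core of `K`: one `n`-ary relation symbol for each definable open subset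
of `K ^ n`, for every `n`. -/
def openCore : FirstOrder.Language.{0, w} where
  Functions := fun _ => Empty
  Relations := fun n => {U : Set (Fin n → K) // Def L U ∧ IsOpen U}

/-- The open core of `K`: the structure on `K` in which each relation symbol is interpreted by the
definable open set that it names. -/
instance openCoreStructure : (openCore L K).Structure K where
  funMap := fun f => Empty.elim f
  RelMap := fun U x => x ∈ U.1

/-- `K` is a-minimal if its open core is locally o-minimal. -/
def IsAMinimal [Field K] [LinearOrder K] : Prop :=
  IsLocallyOMinimal (openCore L K) K

/-- `K` has o-minimal open core. -/
def HasOMinimalOpenCore [LinearOrder K] : Prop :=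
  IsOMinimal (openCore L K) K

end OpenCore

end Tame

/-!
All nine conditions turn out to be equivalent to the finiteness of the closed discrete definable
subsets of `K` (`ClosedDiscreteFinite`). The difficult implication is that this finiteness forces
the open core to be o-minimal.

The sets to work with are the `D_Σ` sets: the unions of increasing definable families, indexed by
`K`, of definably compact sets (`DComp`, `IsDSigma`). Definable open and closed sets are `D_Σ`, and
`D_Σ` sets are stable under finite unions and intersections and under images and preimages by
continuous definable maps. In `K` itself, a `D_Σ` set has finite boundary
(`IsDSigma.finite_frontier`), so it is a finite union of points and intervals. It therefore remains
to prove that complements of `D_Σ` sets are `D_Σ` (`IsDSigma.compl`); then every set definable in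
the open core is `D_Σ`, by induction on formulas (`IsDSigma.of_boundedFormula`).

The theorem of the complement is proved by induction on the dimension, together with the uniform
finiteness of `D_Σ` families of finite sets (`sigmaCompl_and_uniformFiniteness`). The induction
rests on a category argument. Increasing definable families of definably compact sets satisfy the
Baire property and a Kuratowski–Ulam property (`sigmaBaire_pi`, `SigmaBaire.interior_nonempty`), and
`D_Σ` sets without interior are nowhere dense (`sigmaNowhereDense_pi`). It follows that a `D_Σ` set
without interior is a finite union of `D_Σ` sets that are finite-to-one over a coordinate projection
(`IsDSigma.exists_finite_to_one`).

* From uniform finiteness over `K ^ n` to complements in `K ^ (n + 1)`: up to the interior, the set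
  is finite-to-one over `K ^ n`, and a point is outside of a fiber of size `k` if it differs from
  `k` elements of the fiber (`SigmaCompl.compl_of_finite_fibers`, `SigmaCompl.succ`).
* From complements in `K ^ (n + 1)` to uniform finiteness over `K ^ (n + 1)`: away from a closed set
  without interior, which is a finite union of sets finite-to-one over `K ^ n`, the sizes of the
  fibers are locally constant (`SigmaNowhereDense.interior_compl_matchedSet`). They are then
  constant along the segments parallel to the last axis that are contained in this open set, and
  they only have to be bounded at the midpoints of these segments
  (`UniformFiniteness.exists_bound_of_isOpen`), which again form a family of finite sets over
  `K ^ n`.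

The other implications are shorter. A discrete definable set is an increasing union of uniformly
separated, hence closed, sets (`ClosedDiscreteFinite.finite`), and finiteness then means
discreteness, which is definable. An o-minimal structure is locally o-minimal. In an a-minimal
structure a closed discrete definable set is bounded (`IsAMinimal.exists_upper_bound`). Finally, if
the finiteness of initial segments is definable, then pseudo-finite subsets of `K` are finite by
definable induction (`IsPseudoFinite₁.finite_of_isDef`).
-/

set_option linter.unusedSectionVars false

namespace Tame

open Set Topology Filter

/-- A space with a fixed homeomorphism onto a finite power of `K`.  It makes it possible to speak
of definable subsets of iterated products of powers of `K`. -/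
class DSpace (K : Type*) [TopologicalSpace K] (E : Type*) [TopologicalSpace E] where
  /-- The index set of the coordinates. -/
  ι : Type
  [finite : Finite ι]
  /-- The coordinates. -/
  chart : E ≃ₜ (ι → K)

attribute [instance] DSpace.finite

noncomputable instance (K : Type*) [TopologicalSpace K] (E : Type*) [TopologicalSpace E]
    [DSpace K E] : Fintype (DSpace.ι K E) := Fintype.ofFinite _

/-! ### Definable sets and maps between iterated products of powers of `K` -/

section Framework

variable (L : FirstOrder.Language.{u, v}) (K : Type w) [L.Structure K] [TopologicalSpace K]

/-- `K` itself has one coordinate. -/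
noncomputable instance instDSpaceSelf : DSpace K K where
  ι := Fin 1
  chart := (Homeomorph.funUnique (Fin 1) K).symm

/-- The coordinates of `K ^ n` are the obvious ones. -/
instance instDSpacePi (n : ℕ) : DSpace K (Fin n → K) where
  ι := Fin n
  chart := Homeomorph.refl _

/-- The coordinates of a product are those of the two factors. -/
instance instDSpaceProd (E F : Type*) [TopologicalSpace E] [TopologicalSpace F]
    [DSpace K E] [DSpace K F] : DSpace K (E × F) where
  ι := DSpace.ι K E ⊕ DSpace.ι K F
  chart := ((DSpace.chart (K := K) (E := E)).prodCongr (DSpace.chart (K := K) (E := F))).trans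
    Homeomorph.sumArrowHomeomorphProdArrow.symm

variable {E F G H : Type*} [TopologicalSpace E] [TopologicalSpace F] [TopologicalSpace G]
  [TopologicalSpace H] [DSpace K E] [DSpace K F] [DSpace K G] [DSpace K H]

/-- A subset of a space with coordinates in `K` is definable (with parameters) if the set of its
coordinate vectors is. -/
def IsDef (X : Set E) : Prop :=
  (Set.univ : Set K).Definable L {v | (DSpace.chart (K := K) (E := E)).symm v ∈ X}

/-- A map is definable if its graph is. -/
@[fun_prop]
def DefMap (f : E → F) : Prop := IsDef L K {p : E × F | f p.1 = p.2}

variable {L K}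

lemma isDef_iff_def {n : ℕ} {X : Set (Fin n → K)} : IsDef L K X ↔ Def L X := Iff.rfl

lemma isDef_iff_def₁ {X : Set K} : IsDef L K X ↔ Def₁ L X := Iff.rfl

namespace IsDef

lemma compl {X : Set E} (h : IsDef L K X) : IsDef L K Xᶜ := Set.Definable.compl h
lemma inter {X Y : Set E} (h : IsDef L K X) (h' : IsDef L K Y) : IsDef L K (X ∩ Y) :=
  Set.Definable.inter h h'
lemma union {X Y : Set E} (h : IsDef L K X) (h' : IsDef L K Y) : IsDef L K (X ∪ Y) :=
  Set.Definable.union h h'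
lemma diff {X Y : Set E} (h : IsDef L K X) (h' : IsDef L K Y) : IsDef L K (X \ Y) :=
  h.inter h'.compl
lemma univ : IsDef L K (Set.univ : Set E) := Set.definable_univ
lemma empty : IsDef L K (∅ : Set E) := Set.definable_empty

lemma and {p q : E → Prop} (h : IsDef L K {x | p x}) (h' : IsDef L K {x | q x}) :
    IsDef L K {x | p x ∧ q x} := h.inter h'
lemma or {p q : E → Prop} (h : IsDef L K {x | p x}) (h' : IsDef L K {x | q x}) :
    IsDef L K {x | p x ∨ q x} := h.union h'
lemma not {p : E → Prop} (h : IsDef L K {x | p x}) : IsDef L K {x | ¬ p x} := h.compl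
lemma imp {p q : E → Prop} (h : IsDef L K {x | p x}) (h' : IsDef L K {x | q x}) :
    IsDef L K {x | p x → q x} := by
  simpa only [imp_iff_not_or] using h.not.or h'
lemma const (p : Prop) : IsDef L K {_x : E | p} := by
  by_cases h : p <;> simp [h, univ, empty]

lemma iInter_finite {ι : Type*} [Finite ι] {X : ι → Set E} (h : ∀ i, IsDef L K (X i)) :
    IsDef L K (⋂ i, X i) := by
  have := Set.definable_iInter_of_finite (fun i => h i)
  unfold IsDef
  convert! this using 1
  ext v; simp

lemma all_finite {ι : Type*} [Finite ι] {p : ι → E → Prop} (h : ∀ i, IsDef L K {x | p i x}) :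
    IsDef L K {x | ∀ i, p i x} := by
  have := iInter_finite h
  convert! this using 1
  ext v; simp

end IsDef

/-- In coordinates, `f` only permutes, repeats and drops coordinates. -/
def IsReindex (K : Type w) [TopologicalSpace K] {E F : Type*} [TopologicalSpace E]
    [TopologicalSpace F] [DSpace K E] [DSpace K F] (f : E → F) : Prop :=
  ∃ σ : DSpace.ι K F → DSpace.ι K E, ∀ x i,
    DSpace.chart (K := K) (f x) i = DSpace.chart (K := K) x (σ i)

namespace IsReindex

lemma id : IsReindex K (fun x : E => x) := ⟨_root_.id, fun _ _ => rfl⟩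

lemma fst {f : E → F × G} (h : IsReindex K f) : IsReindex K (fun x => (f x).1) := by
  obtain ⟨σ, hσ⟩ := h
  exact ⟨fun i => σ (Sum.inl i), fun x i => (hσ x (Sum.inl i))⟩

lemma snd {f : E → F × G} (h : IsReindex K f) : IsReindex K (fun x => (f x).2) := by
  obtain ⟨σ, hσ⟩ := h
  exact ⟨fun i => σ (Sum.inr i), fun x i => (hσ x (Sum.inr i))⟩

lemma prodMk {f : E → F} {g : E → G} (h : IsReindex K f) (h' : IsReindex K g) :
    IsReindex K (fun x => (f x, g x)) := by
  obtain ⟨σ, hσ⟩ := h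
  obtain ⟨τ, hτ⟩ := h'
  refine ⟨Sum.elim σ τ, fun x i => ?_⟩
  cases i with
  | inl i => exact hσ x i
  | inr i => exact hτ x i

lemma apply {n : ℕ} (i : Fin n) : IsReindex K (fun x : Fin n → K => x i) :=
  ⟨fun _ => i, fun _ _ => rfl⟩

end IsReindex

namespace IsDef

/-- Preimages under permutations, repetitions and projections of coordinates: this reduces to
`Set.Definable.preimage_comp`. -/
lemma preimage_reindex {X : Set F} (h : IsDef L K X) {f : E → F} (hf : IsReindex K f) :
    IsDef L K (f ⁻¹' X) := by
  obtain ⟨σ, hσ⟩ := hf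
  have := Set.Definable.preimage_comp σ h
  unfold IsDef
  convert! this using 1
  ext v
  simp only [mem_preimage, mem_ofPred_eq]
  have : f ((DSpace.chart (K := K)).symm v) = (DSpace.chart (K := K)).symm (v ∘ σ) := by
    rw [Homeomorph.eq_symm_apply]
    ext i
    simp [hσ]
  rw [this]

lemma ex {p : E → F → Prop} (h : IsDef L K {z : E × F | p z.1 z.2}) :
    IsDef L K {x | ∃ y, p x y} := by
  have := Set.Definable.exists_of_finite h
  unfold IsDef
  convert! this using 1
  ext v
  constructor
  · rintro ⟨y, hy⟩
    refine ⟨DSpace.chart (K := K) y, ?_⟩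
    show p ((DSpace.chart (K := K)).symm v)
      ((DSpace.chart (K := K)).symm (DSpace.chart (K := K) y))
    simpa using hy
  · rintro ⟨u, hu⟩
    exact ⟨(DSpace.chart (K := K)).symm u, hu⟩

lemma all {p : E → F → Prop} (h : IsDef L K {z : E × F | p z.1 z.2}) :
    IsDef L K {x | ∀ y, p x y} := by
  have := (ex (L := L) (p := fun x y => ¬ p x y) h.not).not
  simpa using this

lemma diag : IsDef L K {p : E × E | p.1 = p.2} := by
  have h : ∀ i, IsDef L K
      {p : E × E | DSpace.chart (K := K) p.1 i = DSpace.chart (K := K) p.2 i} := by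
    intro i
    have := (Set.Definable.diagonal L (Set.univ : Set K)).preimage_comp
      (![Sum.inl i, Sum.inr i] : Fin 2 → DSpace.ι K E ⊕ DSpace.ι K E)
    unfold IsDef
    convert! this using 1
    ext v
    simp only [mem_ofPred_eq, mem_preimage, mem_diagonal_iff]
    show (DSpace.chart (K := K)) ((DSpace.chart (K := K)).symm (fun j => v (Sum.inl j))) i
      = (DSpace.chart (K := K)) ((DSpace.chart (K := K)).symm (fun j => v (Sum.inr j))) i ↔ _
    simp
  have := all_finite h
  convert! this using 1
  ext p
  simp only [mem_ofPred_eq]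
  rw [← funext_iff]
  simp

lemma singleton (a : E) : IsDef L K {x | a = x} := by
  have h : ∀ i, IsDef L K {x : E | DSpace.chart (K := K) x i = DSpace.chart (K := K) a i} := by
    intro i
    have := (Set.Definable.singleton_of_mem L
      (Set.mem_univ (DSpace.chart (K := K) a i))).preimage_comp (fun _ : Fin 1 => i)
    unfold IsDef
    convert! this using 1
    ext v
    simp
  have := all_finite h
  convert! this using 1
  ext p
  simp only [mem_ofPred_eq]
  rw [← funext_iff]
  simp [eq_comm]

end IsDef

lemma IsReindex.defMap {f : E → F} (h : IsReindex K f) : DefMap L K f := by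
  have h2 : IsReindex K (fun p : E × F => f p.1) := by
    obtain ⟨σ, hσ⟩ := h
    exact ⟨fun i => Sum.inl (σ i), fun x i => hσ x.1 i⟩
  exact IsDef.diag.preimage_reindex (h2.prodMk IsReindex.id.snd)

namespace DefMap

@[fun_prop]
lemma id : DefMap L K (fun x : E => x) := IsReindex.id.defMap

@[fun_prop]
lemma const (a : F) : DefMap L K (fun _ : E => a) :=
  (IsDef.singleton a).preimage_reindex IsReindex.id.snd

@[fun_prop]
lemma comp {g : F → G} {f : E → F} (hg : DefMap L K g) (hf : DefMap L K f) :
    DefMap L K (fun x => g (f x)) := by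
  have : IsDef L K {p : E × G | ∃ y : F, f p.1 = y ∧ g y = p.2} := by
    refine .ex (.and ?_ ?_)
    · exact hf.preimage_reindex (f := fun z : (E × G) × F => (z.1.1, z.2))
        (IsReindex.id.fst.fst.prodMk IsReindex.id.snd)
    · exact hg.preimage_reindex (f := fun z : (E × G) × F => (z.2, z.1.2))
        (IsReindex.id.snd.prodMk IsReindex.id.fst.snd)
  simpa [DefMap] using this

@[fun_prop]
lemma prodMk {f : E → F} {g : E → G} (hf : DefMap L K f) (hg : DefMap L K g) :
    DefMap L K (fun x => (f x, g x)) := by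
  have : IsDef L K {p : E × F × G | f p.1 = p.2.1 ∧ g p.1 = p.2.2} := by
    refine .and ?_ ?_
    · exact hf.preimage_reindex (f := fun z : E × F × G => (z.1, z.2.1))
        (IsReindex.id.fst.prodMk IsReindex.id.snd.fst)
    · exact hg.preimage_reindex (f := fun z : E × F × G => (z.1, z.2.2))
        (IsReindex.id.fst.prodMk IsReindex.id.snd.snd)
  simpa [DefMap, Prod.ext_iff] using this

@[fun_prop]
lemma fst : DefMap L K (Prod.fst : E × F → E) := IsReindex.id.fst.defMap

@[fun_prop]
lemma snd : DefMap L K (Prod.snd : E × F → F) := IsReindex.id.snd.defMap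

@[fun_prop]
lemma apply {n : ℕ} (i : Fin n) : DefMap L K (fun x : Fin n → K => x i) :=
  (IsReindex.apply i).defMap

lemma coord (i : DSpace.ι K E) : DefMap L K (fun x : E => DSpace.chart (K := K) x i) :=
  IsReindex.defMap ⟨fun _ => i, fun _ _ => rfl⟩

@[fun_prop]
lemma pi {n : ℕ} {f : E → Fin n → K} (hf : ∀ i, DefMap L K (fun x => f x i)) :
    DefMap L K f := by
  have : IsDef L K {p : E × (Fin n → K) | ∀ i, f p.1 i = p.2 i} := by
    refine .all_finite fun i => ?_
    refine (hf i).preimage_reindex (f := fun z : E × (Fin n → K) => (z.1, z.2 i))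
      (IsReindex.id.fst.prodMk ?_)
    exact ⟨fun _ => Sum.inr i, fun _ _ => rfl⟩
  simpa [DefMap, funext_iff] using this

end DefMap

namespace IsDef

lemma mem {X : Set F} (h : IsDef L K X) {f : E → F} (hf : DefMap L K f) :
    IsDef L K {x | f x ∈ X} := by
  have : IsDef L K {x : E | ∃ y : F, f x = y ∧ y ∈ X} :=
    .ex (.and hf (h.preimage_reindex IsReindex.id.snd))
  simpa using this

lemma eq {f g : E → F} (hf : DefMap L K f) (hg : DefMap L K g) :
    IsDef L K {x | f x = g x} :=
  IsDef.diag.mem (f := fun x => (f x, g x)) (by fun_prop)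

lemma image {X : Set E} (h : IsDef L K X) {f : E → F} (hf : DefMap L K f) :
    IsDef L K (f '' X) := by
  refine .ex (.and (h.mem ?_) (.eq ?_ ?_)) <;> fun_prop

lemma prod {X : Set E} {Y : Set F} (h : IsDef L K X) (h' : IsDef L K Y) :
    IsDef L K (X ×ˢ Y) := by
  refine .and (h.mem ?_) (h'.mem ?_) <;> fun_prop

end IsDef

/-! ### Definability of the ordered field operations -/

section Field

variable [Field K] [LinearOrder K] [hE : Fact (ExpandsOrderedField L K)]

lemma IsDef.lt {f g : E → K} (hf : DefMap L K f) (hg : DefMap L K g) :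
    IsDef L K {x | f x < g x} :=
  IsDef.mem (X := {v : Fin 2 → K | v 0 < v 1}) (isDef_iff_def.2 hE.out.lt_def)
    (f := fun x => ![f x, g x])
    (.pi fun i => by fin_cases i <;> simpa)

lemma IsDef.le {f g : E → K} (hf : DefMap L K f) (hg : DefMap L K g) :
    IsDef L K {x | f x ≤ g x} := by
  simpa using (IsDef.lt hg hf).not

namespace DefMap

@[fun_prop]
lemma add {f g : E → K} (hf : DefMap L K f) (hg : DefMap L K g) :
    DefMap L K (fun x => f x + g x) :=
  IsDef.mem (X := {v : Fin 3 → K | v 0 + v 1 = v 2}) (isDef_iff_def.2 hE.out.add_def)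
    (f := fun p : E × K => ![f p.1, g p.1, p.2]) <|
    .pi fun i => by fin_cases i <;> simp <;> fun_prop

@[fun_prop]
lemma mul {f g : E → K} (hf : DefMap L K f) (hg : DefMap L K g) :
    DefMap L K (fun x => f x * g x) :=
  IsDef.mem (X := {v : Fin 3 → K | v 0 * v 1 = v 2}) (isDef_iff_def.2 hE.out.mul_def)
    (f := fun p : E × K => ![f p.1, g p.1, p.2]) <|
    .pi fun i => by fin_cases i <;> simp <;> fun_prop

@[fun_prop]
lemma neg {f : E → K} (hf : DefMap L K f) : DefMap L K (fun x => - f x) := by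
  have h : IsDef L K {p : E × K | f p.1 + p.2 = 0} := by refine .eq ?_ ?_ <;> fun_prop
  simpa [DefMap, neg_eq_iff_add_eq_zero] using h

@[fun_prop]
lemma sub {f g : E → K} (hf : DefMap L K f) (hg : DefMap L K g) :
    DefMap L K (fun x => f x - g x) := by
  simp only [sub_eq_add_neg]; fun_prop

@[fun_prop]
lemma inv {f : E → K} (hf : DefMap L K f) : DefMap L K (fun x => (f x)⁻¹) := by
  have h : IsDef L K {p : E × K | (f p.1 * p.2 = 1) ∨ (f p.1 = 0 ∧ p.2 = 0)} := by
    refine .or (.eq ?_ ?_) (.and (.eq ?_ ?_) (.eq ?_ ?_)) <;> fun_prop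
  unfold DefMap
  convert! h using 1
  ext p
  simp only [mem_ofPred_eq]
  by_cases h0 : f p.1 = 0
  · simp [h0, eq_comm]
  · simp only [h0, false_and, or_false]
    exact ⟨fun h => h ▸ mul_inv_cancel₀ h0, fun h => inv_eq_of_mul_eq_one_right h⟩

@[fun_prop]
lemma div {f g : E → K} (hf : DefMap L K f) (hg : DefMap L K g) :
    DefMap L K (fun x => f x / g x) := by
  simp only [div_eq_mul_inv]; fun_prop

@[fun_prop]
lemma abs {f : E → K} (hf : DefMap L K f) : DefMap L K (fun x => |f x|) := by
  have h : IsDef L K {p : E × K | (-f p.1 ≤ f p.1 ∧ f p.1 = p.2) ∨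
      (f p.1 ≤ -f p.1 ∧ -f p.1 = p.2)} := by
    refine .or (.and (.le ?_ ?_) (.eq ?_ ?_)) (.and (.le ?_ ?_) (.eq ?_ ?_)) <;> fun_prop
  unfold DefMap
  convert! h using 1
  ext p
  simp only [mem_ofPred_eq]
  rcases le_total (f p.1) (-f p.1) with h | h
  · have h1 : |f p.1| = -f p.1 := by rw [abs_eq_max_neg, max_eq_right h]
    rw [h1]
    constructor
    · exact fun h2 => Or.inr ⟨h, h2⟩
    · rintro (⟨h2, h3⟩ | h2)
      · rw [le_antisymm h2 h, h3]
      · exact h2.2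
  · have h1 : |f p.1| = f p.1 := by rw [abs_eq_max_neg, max_eq_left h]
    rw [h1]
    constructor
    · exact fun h2 => Or.inl ⟨h, h2⟩
    · rintro (h2 | ⟨h2, h3⟩)
      · exact h2.2
      · rw [le_antisymm h2 h, h3]

lemma sum {ι : Type*} (s : Finset ι) {f : ι → E → K} (hf : ∀ i, DefMap L K (f i)) :
    DefMap L K (fun x => ∑ i ∈ s, f i x) := by
  classical
  induction s using Finset.induction_on with
  | empty => simp; fun_prop
  | insert a s ha ih =>
    simp only [Finset.sum_insert ha]
    have := hf a
    fun_prop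

end DefMap

variable (K) in
/-- The `ℓ¹` distance of two points, computed in coordinates. -/
noncomputable def d (x y : E) : K :=
  ∑ i, |DSpace.chart (K := K) x i - DSpace.chart (K := K) y i|

@[fun_prop]
lemma DefMap.d {f g : E → F} (hf : DefMap L K f) (hg : DefMap L K g) :
    DefMap L K (fun x => d K (f x) (g x)) := by
  refine .sum _ fun i => ?_
  have h := DefMap.coord (L := L) (K := K) (E := F) i
  have h1 := h.comp hf
  have h2 := h.comp hg
  fun_prop

end Field
end Framework

/-! ### The topology in terms of the `ℓ¹` distance -/

section Distance

variable {K : Type w} [Field K] [LinearOrder K] [TopologicalSpace K]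
variable {E F G : Type*} [TopologicalSpace E] [TopologicalSpace F] [TopologicalSpace G]
  [DSpace K E] [DSpace K F] [DSpace K G]

lemma d_comm (x y : E) : d K x y = d K y x := by simp [d, abs_sub_comm]

lemma d_prod (p q : E × F) : d K p q = d K p.1 q.1 + d K p.2 q.2 := by
  have h1 := Fintype.sum_sum_type (fun i : DSpace.ι K E ⊕ DSpace.ι K F =>
    |DSpace.chart (K := K) p i - DSpace.chart (K := K) q i|)
  exact (Fintype.sum_equiv (show DSpace.ι K (E × F) ≃ DSpace.ι K E ⊕ DSpace.ι K F from Equiv.refl _)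
    _ _ fun _ => rfl).trans h1

lemma d_eq_abs (x y : K) : d K x y = |x - y| := by
  have h1 := Fin.sum_univ_one (fun i : Fin 1 =>
    |DSpace.chart (K := K) (E := K) x i - DSpace.chart (K := K) (E := K) y i|)
  exact (Fintype.sum_equiv (show DSpace.ι K K ≃ Fin 1 from Equiv.refl _) _ _ fun _ => rfl).trans h1

lemma d_pi {n : ℕ} (x y : Fin n → K) : d K x y = ∑ i, |x i - y i| := by
  unfold d
  congr!

variable [IsStrictOrderedRing K]

lemma d_self (x : E) : d K x x = 0 := by simp [d]

lemma d_nonneg (x y : E) : 0 ≤ d K x y := Finset.sum_nonneg fun _ _ => abs_nonneg _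

lemma d_triangle (x y z : E) : d K x z ≤ d K x y + d K y z := by
  unfold d
  rw [← Finset.sum_add_distrib]
  exact Finset.sum_le_sum fun i _ => abs_sub_le _ _ _

lemma abs_coord_le_d (x y : E) (i : DSpace.ι K E) :
    |DSpace.chart (K := K) x i - DSpace.chart (K := K) y i| ≤ d K x y :=
  Finset.single_le_sum (f := fun i => |DSpace.chart (K := K) x i - DSpace.chart (K := K) y i|)
    (fun _ _ => abs_nonneg _) (Finset.mem_univ i)

lemma d_eq_zero {x y : E} : d K x y = 0 ↔ x = y := by
  refine ⟨fun h => ?_, fun h => h ▸ d_self x⟩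
  apply (DSpace.chart (K := K)).injective
  ext i
  have := abs_coord_le_d (K := K) x y i
  rw [h] at this
  exact sub_eq_zero.1 (abs_nonpos_iff.1 this)

lemma d_pos {x y : E} (h : x ≠ y) : 0 < d K x y :=
  lt_of_le_of_ne (d_nonneg x y) fun h' => h (d_eq_zero.1 h'.symm)

variable [OrderTopology K]

lemma continuous_d : Continuous fun p : E × E => d K p.1 p.2 := by
  unfold d
  refine continuous_finsetSum _ fun i _ => ?_
  have h : Continuous fun x : E => DSpace.chart (K := K) x i :=
    (continuous_apply i).comp (DSpace.chart (K := K)).continuous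
  exact ((h.comp continuous_fst).sub (h.comp continuous_snd)).abs

@[fun_prop]
lemma Continuous.d {f g : F → E} (hf : Continuous f) (hg : Continuous g) :
    Continuous fun x => Tame.d K (f x) (g x) := continuous_d.comp (hf.prodMk hg)

lemma mem_nhds_iff_d {s : Set E} {x : E} :
    s ∈ 𝓝 x ↔ ∃ ε : K, 0 < ε ∧ ∀ y, d K x y < ε → y ∈ s := by
  constructor
  · intro hs
    have h1 : Tendsto id (comap (fun y => d K x y) (𝓝 0)) (𝓝 x) := by
      rw [(DSpace.chart (K := K) (E := E)).isInducing.tendsto_nhds_iff, tendsto_pi_nhds]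
      intro i
      have h2 : Tendsto (fun y => d K x y) (comap (fun y => d K x y) (𝓝 0)) (𝓝 0) :=
        tendsto_comap
      refine tendsto_of_tendsto_of_tendsto_of_le_of_le
        (g := fun y => DSpace.chart (K := K) x i - d K x y)
        (h := fun y => DSpace.chart (K := K) x i + d K x y) ?_ ?_ ?_ ?_
      · simpa using tendsto_const_nhds.sub h2
      · simpa using tendsto_const_nhds.add h2
      · intro y
        have := abs_le.1 (abs_coord_le_d (K := K) x y i)
        simp only [Function.comp_apply, id_eq]
        linarith [this.2]
      · intro y
        have := abs_le.1 (abs_coord_le_d (K := K) x y i)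
        simp only [Function.comp_apply, id_eq]
        linarith [this.1]
    obtain ⟨t, ht, hts⟩ := h1 hs
    obtain ⟨ε, hε, h⟩ := (nhds_basis_abs_sub_lt (0 : K)).mem_iff.1 ht
    refine ⟨ε, hε, fun y hy => hts (h ?_)⟩
    simpa [abs_of_nonneg (d_nonneg (K := K) x y)] using hy
  · rintro ⟨ε, hε, h⟩
    have : {y | d K x y < ε} ∈ 𝓝 x := by
      refine (isOpen_lt (by fun_prop) (by fun_prop)).mem_nhds ?_
      simpa [d_self] using hε
    exact mem_of_superset this h

lemma isOpen_iff_d {s : Set E} :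
    IsOpen s ↔ ∀ x ∈ s, ∃ ε : K, 0 < ε ∧ ∀ y, d K x y < ε → y ∈ s := by
  simp [isOpen_iff_mem_nhds, mem_nhds_iff_d (K := K)]

lemma mem_closure_iff_d {s : Set E} {x : E} :
    x ∈ closure s ↔ ∀ ε : K, 0 < ε → ∃ y ∈ s, d K x y < ε := by
  rw [mem_closure_iff_nhds]
  constructor
  · intro h ε hε
    obtain ⟨y, hy, hs⟩ := h {y | d K x y < ε} ((mem_nhds_iff_d (K := K)).2 ⟨ε, hε, fun y hy => hy⟩)
    exact ⟨y, hs, hy⟩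
  · intro h t ht
    obtain ⟨ε, hε, h1⟩ := (mem_nhds_iff_d (K := K)).1 ht
    obtain ⟨y, hy, h2⟩ := h ε hε
    exact ⟨y, h1 y h2, hy⟩

lemma mem_interior_iff_d {s : Set E} {x : E} :
    x ∈ interior s ↔ ∃ ε : K, 0 < ε ∧ ∀ y, d K x y < ε → y ∈ s := by
  rw [mem_interior_iff_mem_nhds, mem_nhds_iff_d (K := K)]

lemma isOpen_ball (x : E) (r : K) : IsOpen {y | d K x y < r} :=
  isOpen_lt (by fun_prop) (by fun_prop)

variable (K) in
lemma DSpace.t2 (E : Type*) [TopologicalSpace E] [DSpace K E] : T2Space E :=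
  (DSpace.chart (K := K) (E := E)).symm.t2Space

lemma isDiscrete_iff_d {s : Set E} :
    IsDiscrete s ↔ ∀ x ∈ s, ∃ ε : K, 0 < ε ∧ ∀ y ∈ s, d K x y < ε → y = x := by
  rw [isDiscrete_iff_nhdsWithin]
  refine forall₂_congr fun x hx => ?_
  have : 𝓝[s] x = pure x ↔ {x} ∈ 𝓝[s] x := by
    constructor
    · intro h; rw [h]; simp
    · intro h
      refine le_antisymm (by simpa using h) ?_
      exact pure_le_nhdsWithin hx
  rw [this, mem_nhdsWithin_iff_exists_mem_nhds_inter]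
  constructor
  · rintro ⟨u, hu, h⟩
    obtain ⟨ε, hε, h1⟩ := (mem_nhds_iff_d (K := K)).1 hu
    exact ⟨ε, hε, fun y hy hd => h ⟨h1 y hd, hy⟩⟩
  · rintro ⟨ε, hε, h⟩
    exact ⟨_, (mem_nhds_iff_d (K := K)).2 ⟨ε, hε, fun y hy => hy⟩, fun y hy => h y hy.2 hy.1⟩

/-- A set whose points are uniformly separated is closed. -/
lemma isClosed_of_separated {s : Set E} {ε : K} (hε : 0 < ε)
    (h : ∀ x ∈ s, ∀ y ∈ s, x ≠ y → ε ≤ d K x y) : IsClosed s := by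
  refine isClosed_of_closure_subset fun x hx => ?_
  rw [mem_closure_iff_d (K := K)] at hx
  obtain ⟨y, hy, hxy⟩ := hx (ε / 2) (by positivity)
  by_cases hne : x = y
  · exact hne ▸ hy
  obtain ⟨z, hz, hxz⟩ := hx (min (ε / 2) (d K x y)) (lt_min (by positivity) (d_pos hne))
  have h1 := lt_min_iff.1 hxz
  have h2 : y ≠ z := by rintro rfl; exact lt_irrefl _ h1.2
  have h3 := h y hy z hz h2
  have h4 := d_triangle (K := K) y x z
  rw [d_comm y x] at h4
  linarith [h1.1]

end Distance

/-! ### Definable compactness -/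

section Topology

variable {L : FirstOrder.Language.{u, v}} {K : Type w} [L.Structure K]
  [Field K] [LinearOrder K] [TopologicalSpace K] [IsStrictOrderedRing K] [OrderTopology K]
  [hE : Fact (ExpandsOrderedField L K)]
variable {E F G : Type*} [TopologicalSpace E] [TopologicalSpace F] [TopologicalSpace G]
  [DSpace K E] [DSpace K F] [DSpace K G]

lemma IsDef.closure {X : Set E} (h : IsDef L K X) : IsDef L K (closure X) := by
  have : IsDef L K {x : E | ∀ ε : K, 0 < ε → ∃ y, y ∈ X ∧ d K x y < ε} := by
    refine .all (.imp (.lt ?_ ?_) (.ex (.and (h.mem ?_) (.lt ?_ ?_)))) <;> fun_prop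
  convert! this using 1
  ext x
  exact mem_closure_iff_d

lemma IsDef.interior {X : Set E} (h : IsDef L K X) : IsDef L K (interior X) := by
  rw [← compl_compl X, interior_compl]
  exact h.compl.closure.compl

/-- A family of subsets of `E` indexed by `K` is definable if its total space is. -/
def DefFam (L : FirstOrder.Language.{u, v}) (K : Type w) [L.Structure K] [TopologicalSpace K]
    {E : Type*} [TopologicalSpace E] [DSpace K E] (Y : K → Set E) : Prop :=
  IsDef L K {p : K × E | p.2 ∈ Y p.1}

lemma DefFam.mem {Y : K → Set E} (h : DefFam L K Y) {f : F → E} {g : F → K}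
    (hf : DefMap L K f) (hg : DefMap L K g) : IsDef L K {x | f x ∈ Y (g x)} :=
  IsDef.mem (f := fun x => (g x, f x)) h (by fun_prop)

lemma DefFam.apply {Y : K → Set E} (h : DefFam L K Y) (r : K) : IsDef L K (Y r) :=
  h.mem (f := fun x => x) (g := fun _ => r) (by fun_prop) (by fun_prop)

lemma DefFam.iUnion {Y : K → Set E} (h : DefFam L K Y) : IsDef L K (⋃ r, Y r) := by
  have : IsDef L K {x : E | ∃ r, x ∈ Y r} := by
    refine .ex (h.mem ?_ ?_) <;> fun_prop
  convert! this using 1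
  ext x; simp

/-- Definable compactness of a definable set `X`: every definable family of nonempty subsets of `X`
that is indexed by the `t > 0` and decreases as `t` tends to `0` has a cluster point in `X`. -/
def DComp (L : FirstOrder.Language.{u, v}) (K : Type w) [L.Structure K] [TopologicalSpace K]
    {E : Type*} [TopologicalSpace E] [Field K] [LinearOrder K] [DSpace K E] (X : Set E) : Prop :=
  IsDef L K X ∧ ∀ Y : K → Set E, DefFam L K Y → (∀ s t, 0 < s → s ≤ t → Y s ⊆ Y t) →
    (∀ t, 0 < t → (Y t).Nonempty) → (∀ t, 0 < t → Y t ⊆ X) →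
      ∃ x ∈ X, ∀ t, 0 < t → x ∈ closure (Y t)

namespace DComp

lemma isDef {X : Set E} (h : DComp L K X) : IsDef L K X := h.1

lemma subset {X A : Set E} (h : DComp L K X) (hA : IsClosed A) (hd : IsDef L K A) (hs : A ⊆ X) :
    DComp L K A := by
  refine ⟨hd, fun Y hY hm hne hYA => ?_⟩
  obtain ⟨x, hx, h1⟩ := h.2 Y hY hm hne fun t ht => (hYA t ht).trans hs
  exact ⟨x, hA.closure_subset_iff.2 (hYA 1 one_pos) (h1 1 one_pos), h1⟩

lemma image {X : Set E} (h : DComp L K X) {f : E → F} (hf : ContinuousOn f X)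
    (hd : DefMap L K f) : DComp L K (f '' X) := by
  refine ⟨h.1.image hd, fun Y hY hm hne hYX => ?_⟩
  obtain ⟨x, hx, h1⟩ := h.2 (fun t => {x | x ∈ X ∧ f x ∈ Y t})
    (by refine IsDef.and (h.1.mem ?_) (hY.mem ?_ ?_) <;> fun_prop)
    (fun s t hs hst x hx => ⟨hx.1, hm s t hs hst hx.2⟩)
    (fun t ht => by
      obtain ⟨y, hy⟩ := hne t ht
      obtain ⟨x, hx, rfl⟩ := hYX t ht hy
      exact ⟨x, hx, hy⟩) (fun t _ x hx => hx.1)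
  refine ⟨f x, mem_image_of_mem f hx, fun t ht => ?_⟩
  have h2 : ContinuousWithinAt f {x | x ∈ X ∧ f x ∈ Y t} x := (hf x hx).mono fun x hx => hx.1
  have h3 := h2.mem_closure_image (h1 t ht)
  refine closure_mono ?_ h3
  rintro _ ⟨z, hz, rfl⟩
  exact hz.2

lemma isClosed {X : Set E} (h : DComp L K X) : IsClosed X := by
  have := DSpace.t2 K E
  refine isClosed_of_closure_subset fun x hx => ?_
  rw [mem_closure_iff_d (K := K)] at hx
  obtain ⟨z, hz, h1⟩ := h.2 (fun t => {y | y ∈ X ∧ d K x y < t})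
    (by refine IsDef.and (h.1.mem ?_) (.lt ?_ ?_) <;> fun_prop)
    (fun s t hs hst y hy => ⟨hy.1, hy.2.trans_le hst⟩)
    (fun t ht => by obtain ⟨y, hy, h⟩ := hx t ht; exact ⟨y, hy, h⟩) (fun t _ y hy => hy.1)
  by_cases hne : x = z
  · exact hne ▸ hz
  have hp := d_pos (K := K) hne
  obtain ⟨y, hy, hzy⟩ := (mem_closure_iff_d (K := K)).1 (h1 (d K x z / 2) (by positivity))
    (d K x z / 2) (by positivity)
  have := d_triangle (K := K) x y z
  rw [d_comm y z] at this
  linarith [hy.2]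

lemma prod {X : Set E} {X' : Set F} (h : DComp L K X) (h' : DComp L K X') :
    DComp L K (X ×ˢ X') := by
  refine ⟨h.1.prod h'.1, fun Y hY hm hne hYX => ?_⟩
  obtain ⟨x, hx, h1⟩ := h.2 (fun t => {x | ∃ y, (x, y) ∈ Y t})
    (by refine IsDef.ex (hY.mem ?_ ?_) <;> fun_prop)
    (fun s t hs hst x hx => hx.imp fun y hy => hm s t hs hst hy)
    (fun t ht => by obtain ⟨p, hp⟩ := hne t ht; exact ⟨p.1, p.2, hp⟩)
    (fun t ht x hx => by obtain ⟨y, hy⟩ := hx; exact (hYX t ht hy).1)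
  obtain ⟨y, hy, h2⟩ := h'.2 (fun t => {y | ∃ z, d K x z < t ∧ (z, y) ∈ Y t})
    (by refine IsDef.ex (.and (.lt ?_ ?_) (hY.mem ?_ ?_)) <;> fun_prop)
    (fun s t hs hst y hy => hy.imp fun z hz => ⟨hz.1.trans_le hst, hm s t hs hst hz.2⟩)
    (fun t ht => by
      obtain ⟨z, ⟨y, hy⟩, hz⟩ := (mem_closure_iff_d (K := K)).1 (h1 t ht) t ht
      exact ⟨y, z, hz, hy⟩)
    (fun t ht y hy => by obtain ⟨z, hz, hy⟩ := hy; exact (hYX t ht hy).2)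
  refine ⟨(x, y), ⟨hx, hy⟩, fun t ht => (mem_closure_iff_d (K := K)).2 fun ε hε => ?_⟩
  have hs : 0 < min t (ε / 2) := lt_min ht (by positivity)
  obtain ⟨y', ⟨z, hz, hy'⟩, hyy⟩ := (mem_closure_iff_d (K := K)).1 (h2 _ hs) (ε / 2) (by positivity)
  refine ⟨(z, y'), hm _ t hs (min_le_left _ _) hy', ?_⟩
  rw [d_prod]
  have := hz.trans_le (min_le_right _ _)
  simp only
  linarith

lemma union {X X' : Set E} (h : DComp L K X) (h' : DComp L K X') : DComp L K (X ∪ X') := by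
  refine ⟨h.1.union h'.1, fun Y hY hm hne hYX => ?_⟩
  by_cases hc : ∀ t, 0 < t → (Y t ∩ X).Nonempty
  · obtain ⟨x, hx, h1⟩ := h.2 (fun t => Y t ∩ X)
      (by refine IsDef.and (hY.mem ?_ ?_) (h.1.mem ?_) <;> fun_prop)
      (fun s t hs hst x hx => ⟨hm s t hs hst hx.1, hx.2⟩) hc (fun t _ x hx => hx.2)
    exact ⟨x, Or.inl hx, fun t ht => closure_mono inter_subset_left (h1 t ht)⟩
  · push Not at hc
    obtain ⟨t0, ht0, hc⟩ := hc
    have hmin : ∀ t, 0 < t → 0 < min t t0 := fun t ht => lt_min ht ht0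
    obtain ⟨x, hx, h1⟩ := h'.2 (fun t => {x | ∃ s, s ≤ t ∧ s ≤ t0 ∧ 0 < s ∧ x ∈ Y s})
      (by
        refine IsDef.ex (.and (.le ?_ ?_) (.and (.le ?_ ?_) (.and (.lt ?_ ?_) (hY.mem ?_ ?_))))
          <;> fun_prop)
      (fun s t hs hst x ⟨a, ha, hx⟩ => ⟨a, ha.trans hst, hx⟩)
      (fun t ht => by
        obtain ⟨x, hx⟩ := hne _ (hmin t ht)
        exact ⟨x, _, min_le_left _ _, min_le_right _ _, hmin t ht, hx⟩)
      (fun t ht x ⟨a, ha, h1, h2, hx⟩ => by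
        rcases hYX _ h2 hx with h3 | h3
        · have : x ∈ Y t0 ∩ X := ⟨hm a t0 h2 h1 hx, h3⟩
          simp [hc] at this
        · exact h3)
    refine ⟨x, Or.inr hx, fun t ht => closure_mono ?_ (h1 t ht)⟩
    rintro x ⟨a, ha, -, h2, hx⟩
    exact hm a t h2 ha hx

lemma inter {X X' : Set E} (h : DComp L K X) (h' : DComp L K X') : DComp L K (X ∩ X') :=
  h.subset (h.isClosed.inter h'.isClosed) (h.1.inter h'.1) inter_subset_left

/-- The projection of a closed set along a definably compact set is closed. -/
lemma isClosed_proj {X : Set F} (h : DComp L K X) {A : Set (E × F)} (hA : IsClosed A)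
    (hd : IsDef L K A) : IsClosed {x | ∃ y ∈ X, (x, y) ∈ A} := by
  refine isClosed_of_closure_subset fun x hx => ?_
  rw [mem_closure_iff_d (K := K)] at hx
  obtain ⟨y, hy, h1⟩ := h.2 (fun t => {y | y ∈ X ∧ ∃ z, d K x z < t ∧ (z, y) ∈ A})
    (by refine IsDef.and (h.1.mem ?_) (.ex (.and (.lt ?_ ?_) (hd.mem ?_))) <;> fun_prop)
    (fun s t hs hst y hy => ⟨hy.1, hy.2.imp fun z hz => ⟨hz.1.trans_le hst, hz.2⟩⟩)
    (fun t ht => by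
      obtain ⟨z, ⟨y, hy, hz⟩, h1⟩ := hx t ht
      exact ⟨y, hy, z, h1, hz⟩) (fun t _ y hy => hy.1)
  refine ⟨y, hy, ?_⟩
  rw [← hA.closure_eq, mem_closure_iff_d (K := K)]
  intro ε hε
  obtain ⟨y', ⟨-, z, hz, hy'⟩, hyy⟩ := (mem_closure_iff_d (K := K)).1
    (h1 (ε / 2) (by positivity)) (ε / 2) (by positivity)
  refine ⟨(z, y'), hy', ?_⟩
  rw [d_prod]
  simp only
  linarith

/-- Dually, universal quantification over a definably compact set preserves openness. -/
lemma isOpen_forall {X : Set F} (h : DComp L K X) {A : Set (E × F)} (hA : IsOpen A)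
    (hd : IsDef L K A) : IsOpen {x | ∀ y ∈ X, (x, y) ∈ A} := by
  rw [← isClosed_compl_iff]
  convert! h.isClosed_proj hA.isClosed_compl hd.compl using 1
  ext x; simp

lemma singleton (a : E) : DComp L K {a} := by
  refine ⟨by simpa [eq_comm] using IsDef.singleton a, fun Y hY hm hne hYX => ?_⟩
  refine ⟨a, rfl, fun t ht => subset_closure ?_⟩
  obtain ⟨x, hx⟩ := hne t ht
  have := hYX t ht hx
  rw [mem_singleton_iff] at this
  exact this ▸ hx

section Complete

variable [hC : Fact (IsDefinablyComplete L K)]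

/-- Closed bounded intervals are definably compact: a cluster point of a decreasing family is the
supremum of the points that are eventually lower bounds of its members. -/
lemma Icc (a b : K) : DComp L K (Set.Icc a b) := by
  refine ⟨by refine IsDef.and (.le ?_ ?_) (.le ?_ ?_) <;> fun_prop, fun Y hY hm hne hYX => ?_⟩
  have hab : a ≤ b := by
    obtain ⟨x, hx⟩ := hne 1 one_pos
    exact (hYX 1 one_pos hx).1.trans (hYX 1 one_pos hx).2
  let S : Set K := {x | (a ≤ x ∧ x ≤ b) ∧ ∃ t, 0 < t ∧ ∀ y, y ∈ Y t → x ≤ y}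
  have hSd : IsDef L K S := by
    refine IsDef.and (.and (.le ?_ ?_) (.le ?_ ?_))
      (.ex (.and (.lt ?_ ?_) (.all (.imp (hY.mem ?_ ?_) (.le ?_ ?_))))) <;> fun_prop
  have haS : a ∈ S := ⟨⟨le_rfl, hab⟩, 1, one_pos, fun y hy => (hYX 1 one_pos hy).1⟩
  obtain ⟨x, hx⟩ := hC.out S (isDef_iff_def₁.1 hSd) ⟨a, haS⟩ ⟨b, fun x hx => hx.1.2⟩
  have hax : a ≤ x := hx.1 haS
  have hxb : x ≤ b := hx.2 fun x hx => hx.1.2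
  refine ⟨x, ⟨hax, hxb⟩, fun t ht => (mem_closure_iff_d (K := K)).2 fun ε hε => ?_⟩
  by_contra! hcon
  obtain ⟨s, hs, hsx⟩ := (lt_isLUB_iff hx).1 (sub_lt_self x hε)
  obtain ⟨hsab, t', ht', hst⟩ := hs
  have hm' : 0 < min t t' := lt_min ht ht'
  have key : ∀ y ∈ Y (min t t'), x + ε ≤ y := by
    intro y hy
    have h1 := hcon y (hm _ _ hm' (min_le_left _ _) hy)
    have h2 := hst y (hm _ _ hm' (min_le_right _ _) hy)
    rw [d_eq_abs, le_abs] at h1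
    rcases h1 with h1 | h1 <;> linarith
  obtain ⟨y, hy⟩ := hne _ hm'
  have hyb := (hYX _ hm' hy).2
  have : x + ε ∈ S := ⟨⟨by linarith, by linarith [key y hy]⟩, _, hm', key⟩
  linarith [hx.1 this]

/-- By induction on `n`, a closed box is the image of the product of a box and an interval. -/
lemma piBox (n : ℕ) (r : K) : DComp L K {x : Fin n → K | ∀ i, |x i| ≤ r} := by
  induction n with
  | zero =>
    convert! DComp.singleton (L := L) (K := K) (fun i : Fin 0 => (0 : K)) using 1
    ext x
    simp [eq_iff_true_of_subsingleton]
  | succ n ih =>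
    have h := (ih.prod (DComp.Icc (L := L) (-r) r)).image (F := Fin (n + 1) → K)
      (f := fun p : (Fin n → K) × K => Fin.snoc p.1 p.2) (by fun_prop) (by
        refine .pi fun i => ?_
        refine Fin.lastCases ?_ (fun i => ?_) i
        · simp only [Fin.snoc_last]; fun_prop
        · simp only [Fin.snoc_castSucc]; fun_prop)
    convert! h using 1
    ext x
    simp only [mem_ofPred_eq, Set.mem_image, Set.mem_prod, Set.mem_Icc, Prod.exists, ← abs_le]
    constructor
    · exact fun h => ⟨Fin.init x, x (Fin.last n), ⟨fun i => h _, h _⟩, Fin.snoc_init_self x⟩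
    · rintro ⟨a, b, ⟨h1, h2⟩, rfl⟩ i
      refine Fin.lastCases ?_ (fun i => ?_) i
      · simpa using h2
      · simpa using h1 i

variable (K) in
/-- The closed `ℓ¹` ball of radius `r` about the point with coordinates `0`. -/
def _root_.Tame.cball (E : Type*) [TopologicalSpace E] [DSpace K E] (r : K) : Set E :=
  {x | d K ((DSpace.chart (K := K)).symm 0) x ≤ r}

omit hE hC in
lemma _root_.Tame.cball_mono {r s : K} (h : r ≤ s) : cball K E r ⊆ cball K E s :=
  fun _ hx => le_trans hx h

lemma _root_.Tame.defFam_cball : DefFam L K (cball K E) := by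
  refine IsDef.le ?_ ?_ <;> fun_prop

lemma cball (r : K) : DComp L K (cball K E r) := by
  let e := Fintype.equivFin (DSpace.ι K E)
  let f : (Fin (Fintype.card (DSpace.ι K E)) → K) → E :=
    fun v => (DSpace.chart (K := K)).symm fun i => v (e i)
  have hf : Continuous f := (DSpace.chart (K := K)).symm.continuous.comp (by fun_prop)
  have hd : DefMap L K f := IsReindex.defMap ⟨e, fun v i => by simp [f]; rfl⟩
  refine ((piBox _ r).image hf.continuousOn hd).subset ?_ (defFam_cball.apply r) ?_
  · exact isClosed_le (by fun_prop) (by fun_prop)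
  · intro x hx
    refine ⟨fun i => DSpace.chart (K := K) x (e.symm i), fun i => ?_, by simp [f]⟩
    have h1 := abs_coord_le_d (K := K) ((DSpace.chart (K := K)).symm 0) x (e.symm i)
    simp at h1
    exact h1.trans hx

end Complete

end DComp

end Topology

/-! ### `D_Σ` sets, and finiteness of discrete sets -/

section Sigma

variable {L : FirstOrder.Language.{u, v}} {K : Type w} [L.Structure K]
  [Field K] [LinearOrder K] [TopologicalSpace K] [IsStrictOrderedRing K] [OrderTopology K]
  [hE : Fact (ExpandsOrderedField L K)] [hC : Fact (IsDefinablyComplete L K)]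
variable {E F G : Type*} [TopologicalSpace E] [TopologicalSpace F] [TopologicalSpace G]
  [DSpace K E] [DSpace K F] [DSpace K G]

lemma exists_isLUB {X : Set K} (h : IsDef L K X) (hne : X.Nonempty) (hb : BddAbove X) :
    ∃ s, IsLUB X s := hC.out X (isDef_iff_def₁.1 h) hne hb

lemma exists_isGLB {X : Set K} (h : IsDef L K X) (hne : X.Nonempty) (hb : BddBelow X) :
    ∃ s, IsGLB X s := by
  have hd : IsDef L K {x : K | -x ∈ X} := by refine h.mem ?_; fun_prop
  obtain ⟨s, hs⟩ := exists_isLUB (L := L) (X := {x | -x ∈ X}) hd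
    (by obtain ⟨x, hx⟩ := hne; exact ⟨-x, by simpa⟩)
    (by obtain ⟨b, hb⟩ := hb; exact ⟨-b, fun x hx => by linarith [hb hx]⟩)
  refine ⟨-s, fun x hx => ?_, fun b hb => ?_⟩
  · have := hs.1 (show -x ∈ {x | -x ∈ X} by simpa)
    linarith
  · have := hs.2 (show -b ∈ upperBounds _ from fun x hx => by linarith [hb hx])
    linarith

/-- `X` is the union of an increasing definable family, indexed by `K`, of definably compact
sets. -/
def IsDSigma (L : FirstOrder.Language.{u, v}) (K : Type w) [L.Structure K] [TopologicalSpace K]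
    {E : Type*} [TopologicalSpace E] [Field K] [LinearOrder K] [DSpace K E] (X : Set E) : Prop :=
  ∃ Y : K → Set E, DefFam L K Y ∧ (∀ r, DComp L K (Y r)) ∧ Monotone Y ∧ X = ⋃ r, Y r

namespace IsDSigma

lemma isDef {X : Set E} (h : IsDSigma L K X) : IsDef L K X := by
  obtain ⟨Y, hY, -, -, rfl⟩ := h
  exact hY.iUnion

lemma union {X X' : Set E} (h : IsDSigma L K X) (h' : IsDSigma L K X') :
    IsDSigma L K (X ∪ X') := by
  obtain ⟨Y, hY, hc, hm, rfl⟩ := h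
  obtain ⟨Y', hY', hc', hm', rfl⟩ := h'
  exact ⟨fun r => Y r ∪ Y' r, hY.union hY', fun r => (hc r).union (hc' r),
    fun r s hrs => union_subset_union (hm hrs) (hm' hrs), (iUnion_union_distrib _ _).symm⟩

lemma inter {X X' : Set E} (h : IsDSigma L K X) (h' : IsDSigma L K X') :
    IsDSigma L K (X ∩ X') := by
  obtain ⟨Y, hY, hc, hm, rfl⟩ := h
  obtain ⟨Y', hY', hc', hm', rfl⟩ := h'
  exact ⟨fun r => Y r ∩ Y' r, hY.inter hY', fun r => (hc r).inter (hc' r),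
    fun r s hrs => inter_subset_inter (hm hrs) (hm' hrs), (iUnion_inter_of_monotone hm hm').symm⟩

lemma image {X : Set E} (h : IsDSigma L K X) {f : E → F} (hf : Continuous f)
    (hd : DefMap L K f) : IsDSigma L K (f '' X) := by
  obtain ⟨Y, hY, hc, hm, rfl⟩ := h
  refine ⟨fun r => f '' Y r, ?_, fun r => (hc r).image hf.continuousOn hd,
    fun r s hrs => image_mono (hm hrs), image_iUnion⟩
  refine IsDef.ex (.and (hY.mem ?_ ?_) (.eq ?_ ?_)) <;> fun_prop

/-- A closed set is exhausted by its intersections with the closed balls. -/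
lemma of_isClosed {X : Set E} (hd : IsDef L K X) (h : IsClosed X) : IsDSigma L K X := by
  refine ⟨fun r => X ∩ cball K E r, ?_, fun r => ?_, fun r s hrs => ?_, ?_⟩
  · refine IsDef.and (hd.mem ?_) (defFam_cball.mem ?_ ?_) <;> fun_prop
  · exact (DComp.cball r).subset (h.inter (DComp.cball (L := L) r).isClosed)
      (hd.inter (defFam_cball.apply r)) inter_subset_right
  · exact inter_subset_inter_right _ (cball_mono hrs)
  · ext x
    simp only [mem_iUnion, mem_inter_iff, exists_and_left, iff_self_and]
    exact fun _ => ⟨_, le_rfl⟩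

lemma preimage {X : Set F} (h : IsDSigma L K X) {f : E → F} (hf : Continuous f)
    (hd : DefMap L K f) : IsDSigma L K (f ⁻¹' X) := by
  obtain ⟨Y, hY, hc, hm, rfl⟩ := h
  refine ⟨fun r => f ⁻¹' (Y r) ∩ cball K E r, ?_, fun r => ?_, fun r s hrs => ?_, ?_⟩
  · refine IsDef.and (hY.mem ?_ ?_) (defFam_cball.mem ?_ ?_) <;> fun_prop
  · exact (DComp.cball r).subset
      (((hc r).isClosed.preimage hf).inter (DComp.cball (L := L) r).isClosed)
      (((hc r).isDef.mem hd).inter (defFam_cball.apply r)) inter_subset_right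
  · exact inter_subset_inter (preimage_mono (hm hrs)) (cball_mono hrs)
  · ext x
    simp only [mem_iUnion, mem_inter_iff, mem_preimage]
    constructor
    · rintro ⟨r, hr⟩
      exact ⟨max r (d K ((DSpace.chart (K := K)).symm 0) x), hm (le_max_left _ _) hr,
        le_max_right _ _⟩
    · rintro ⟨r, hr, -⟩
      exact ⟨r, hr⟩

/-- An open set is exhausted by the bounded sets of points at distance at least `1 / r` from its
complement. -/
lemma of_isOpen {X : Set E} (hd : IsDef L K X) (h : IsOpen X) : IsDSigma L K X := by
  have hcl : ∀ r : K, IsClosed {x : E | ∀ y, y ∉ X → 1 ≤ r * d K x y} := by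
    intro r
    have : {x : E | ∀ y, y ∉ X → 1 ≤ r * d K x y} = ⋂ y ∈ Xᶜ, {x | 1 ≤ r * d K x y} := by
      ext x; simp
    rw [this]
    exact isClosed_biInter fun y _ => isClosed_le (by fun_prop) (by fun_prop)
  have hfam : DefFam L K fun r : K => {x : E | ∀ y, y ∉ X → 1 ≤ r * d K x y} := by
    refine IsDef.all (.imp (.not (hd.mem ?_)) (.le ?_ ?_)) <;> fun_prop
  refine ⟨fun r => {x : E | ∀ y, y ∉ X → 1 ≤ r * d K x y} ∩ cball K E r, ?_, fun r => ?_,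
    fun r s hrs => ?_, ?_⟩
  · exact IsDef.inter hfam defFam_cball
  · exact (DComp.cball r).subset
      ((hcl r).inter (DComp.cball (L := L) r).isClosed)
      ((hfam.apply r).inter (defFam_cball.apply r)) inter_subset_right
  · refine inter_subset_inter (fun x hx y hy => (hx y hy).trans ?_) (cball_mono hrs)
    exact mul_le_mul_of_nonneg_right hrs (d_nonneg _ _)
  · ext x
    simp only [mem_iUnion, mem_inter_iff]
    constructor
    · intro hx
      obtain ⟨ε, hε, hb⟩ := (isOpen_iff_d (K := K)).1 h x hx
      refine ⟨max ε⁻¹ (d K ((DSpace.chart (K := K)).symm 0) x), fun y hy => ?_, le_max_right _ _⟩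
      have h1 : ε ≤ d K x y := by
        by_contra! h2
        exact hy (hb y h2)
      calc (1 : K) = ε⁻¹ * ε := (inv_mul_cancel₀ hε.ne').symm
        _ ≤ _ := mul_le_mul (le_max_left _ _) h1 hε.le
          ((inv_pos.2 hε).le.trans (le_max_left _ _))
    · rintro ⟨r, hr, -⟩
      by_contra hx
      have := hr x hx
      rw [d_self] at this
      linarith

lemma empty : IsDSigma L K (∅ : Set E) := of_isClosed .empty isClosed_empty
lemma univ : IsDSigma L K (Set.univ : Set E) := of_isClosed .univ isClosed_univ

lemma and {p q : E → Prop} (h : IsDSigma L K {x | p x}) (h' : IsDSigma L K {x | q x}) :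
    IsDSigma L K {x | p x ∧ q x} := h.inter h'
lemma ex {p : E → F → Prop} (h : IsDSigma L K {z : E × F | p z.1 z.2}) :
    IsDSigma L K {x | ∃ y, p x y} := by
  convert! h.image continuous_fst DefMap.fst using 1
  ext x; simp
lemma mem {X : Set F} (h : IsDSigma L K X) {f : E → F} (hf : Continuous f)
    (hd : DefMap L K f) : IsDSigma L K {x | f x ∈ X} := h.preimage hf hd

lemma iInter_finite {ι : Type*} [Finite ι] {X : ι → Set E} (h : ∀ i, IsDSigma L K (X i)) :
    IsDSigma L K (⋂ i, X i) := by
  cases nonempty_fintype ι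
  have : ∀ s : Finset ι, IsDSigma L K (⋂ i ∈ s, X i) := by
    classical
    intro s
    induction s using Finset.induction_on with
    | empty => simpa using univ
    | insert a s ha ih => simpa using (h a).inter ih
  simpa using this Finset.univ

lemma iUnion_finite {ι : Type*} [Finite ι] {X : ι → Set E} (h : ∀ i, IsDSigma L K (X i)) :
    IsDSigma L K (⋃ i, X i) := by
  cases nonempty_fintype ι
  have : ∀ s : Finset ι, IsDSigma L K (⋃ i ∈ s, X i) := by
    classical
    intro s
    induction s using Finset.induction_on with
    | empty => simpa using empty
    | insert a s ha ih => simpa using (h a).union ih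
  simpa using this Finset.univ

lemma all_finite {ι : Type*} [Finite ι] {p : ι → E → Prop}
    (h : ∀ i, IsDSigma L K {x | p i x}) : IsDSigma L K {x | ∀ i, p i x} := by
  convert! iInter_finite h using 1
  ext x; simp

end IsDSigma

variable (L K) in
/-- Every definable closed discrete subset of `K` is finite. -/
def ClosedDiscreteFinite : Prop :=
  ∀ X : Set K, IsDef L K X → IsClosed X → IsDiscrete X → X.Finite

section

omit hE hC

/-- A set whose initial segments are all finite is closed and discrete. -/
lemma isClosed_and_isDiscrete_of_finite_Iic {S : Set K} (h : ∀ b, (S ∩ Iic b).Finite) :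
    IsClosed S ∧ IsDiscrete S := by
  constructor
  · refine isClosed_of_closure_subset fun x hx => ?_
    have h1 : x ∈ closure (S ∩ Iic (x + 1)) := by
      rw [mem_closure_iff_nhds] at hx ⊢
      intro t ht
      obtain ⟨y, hy, hyS⟩ := hx (t ∩ Iio (x + 1)) (inter_mem ht (Iio_mem_nhds (by linarith)))
      exact ⟨y, hy.1, hyS, le_of_lt hy.2⟩
    rw [(h (x + 1)).isClosed.closure_eq] at h1
    exact h1.1
  · rw [isDiscrete_iff_forall_mem_exists_isOpen]
    intro x hx
    refine ⟨((S ∩ Iic (x + 1)) \ {x})ᶜ ∩ Iio (x + 1),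
      ((h (x + 1)).subset sdiff_subset).isClosed.isOpen_compl.inter isOpen_Iio, ?_⟩
    ext y
    simp only [mem_inter_iff, mem_compl_iff, Set.mem_sdiff, mem_singleton_iff, mem_Iio]
    constructor
    · rintro ⟨⟨h1, h2⟩, h3⟩
      by_contra hne
      exact h1 ⟨⟨h3, h2.le⟩, hne⟩
    · rintro rfl
      exact ⟨⟨fun h => h.2 rfl, by linarith⟩, hx⟩

end

/-- The union of an increasing definable family of finite sets is finite: the parameters at which
a new point appears form a closed discrete set. -/
lemma finite_iUnion_of_monotone (h : ClosedDiscreteFinite L K) {Y : K → Set E}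
    (hY : DefFam L K Y) (hm : Monotone Y) (hf : ∀ r, (Y r).Finite) : (⋃ r, Y r).Finite := by
  -- `P s x` says that `s` is the infimum of the parameters `r ≥ 0` with `x ∈ Y r`.
  let P : K → E → Prop := fun s x =>
    (∀ r, 0 ≤ r → x ∈ Y r → s ≤ r) ∧ ∀ ε, 0 < ε → ∃ r, 0 ≤ r ∧ r < s + ε ∧ x ∈ Y r
  let S : Set K := {s | ∃ x, P s x}
  have hSd : IsDef L K S := by
    refine IsDef.ex (.and (.all (.imp (.le ?_ ?_) (.imp (hY.mem ?_ ?_) (.le ?_ ?_))))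
      (.all (.imp (.lt ?_ ?_) (.ex (.and (.le ?_ ?_) (.and (.lt ?_ ?_) (hY.mem ?_ ?_)))))))
      <;> fun_prop
  have huniq : ∀ s s' x, P s x → P s' x → s ≤ s' := by
    intro s s' x hs hs'
    by_contra! hlt
    obtain ⟨r, hr0, hr, hx⟩ := hs'.2 (s - s') (sub_pos.2 hlt)
    have := hs.1 r hr0 hx
    linarith
  have hSf : ∀ b, (S ∩ Iic b).Finite := by
    intro b
    choose g hg using fun s : S => s.2
    have hfin : {s : S | (s : K) ≤ b}.Finite := by
      refine Set.Finite.of_injOn (f := g) (t := Y (b + 1)) ?_ ?_ (hf _)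
      · intro s hs
        obtain ⟨r, hr0, hr, hx⟩ := (hg s).2 1 one_pos
        exact hm (by simp only [mem_ofPred_eq] at hs; linarith) hx
      · intro s _ s' _ heq
        have h1 := hg s
        have h2 := hg s'
        rw [← heq] at h2
        exact Subtype.ext (le_antisymm (huniq _ _ _ h1 h2) (huniq _ _ _ h2 h1))
    exact (hfin.image Subtype.val).subset fun s hs => ⟨⟨s, hs.1⟩, hs.2, rfl⟩
  have hfin := h S hSd (isClosed_and_isDiscrete_of_finite_Iic hSf).1
    (isClosed_and_isDiscrete_of_finite_Iic hSf).2
  obtain ⟨B, hB⟩ := hfin.bddAbove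
  refine (hf (B + 1)).subset (iUnion_subset fun r x hx => ?_)
  have hd : IsDef L K {r : K | 0 ≤ r ∧ x ∈ Y r} := by
    refine .and (.le ?_ ?_) (hY.mem ?_ ?_) <;> fun_prop
  obtain ⟨s, hs⟩ := exists_isGLB hd ⟨max r 0, le_max_right _ _, hm (le_max_left _ _) hx⟩
    ⟨0, fun r hr => hr.1⟩
  have hP : P s x := by
    refine ⟨fun r hr hx => hs.1 ⟨hr, hx⟩, fun ε hε => ?_⟩
    obtain ⟨r, ⟨hr0, hrx⟩, hr⟩ := (isGLB_lt_iff hs).1 (lt_add_of_pos_right s hε)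
    exact ⟨r, hr0, hr, hrx⟩
  obtain ⟨r', hr0, hr', hx'⟩ := hP.2 1 one_pos
  have := hB (show s ∈ S from ⟨x, hP⟩)
  exact hm (by linarith) hx'

/-- Closed discrete definable sets in all dimensions are finite: a bounded part is definably
compact, hence so are all its images, and therefore its coordinate projections are discrete. -/
lemma ClosedDiscreteFinite.finite_of_isClosed (h : ClosedDiscreteFinite L K) {X : Set E}
    (hd : IsDef L K X) (hcl : IsClosed X) (hdisc : IsDiscrete X) : X.Finite := by
  have key : ∀ r : K, (X ∩ cball K E r).Finite := by
    intro r
    have hsub : ∀ B : Set E, IsDef L K B → B ⊆ X ∩ cball K E r → DComp L K B := fun B hB hBX =>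
      (DComp.cball r).subset
        (isClosed_of_subset_discrete_closed (hBX.trans inter_subset_left) hdisc hcl) hB
        (hBX.trans inter_subset_right)
    have hproj : ∀ i, ((fun x : E => DSpace.chart (K := K) x i) '' (X ∩ cball K E r)).Finite := by
      intro i
      have hc : Continuous (fun x : E => DSpace.chart (K := K) x i) :=
        (continuous_apply i).comp (DSpace.chart (K := K)).continuous
      have hdm := DefMap.coord (L := L) (K := K) (E := E) i
      have hXr := hd.inter (defFam_cball.apply (L := L) (K := K) (E := E) r)
      refine h _ (hXr.image hdm) ((hsub _ hXr subset_rfl).image hc.continuousOn hdm).isClosed ?_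
      rw [isDiscrete_iff_forall_mem_exists_isOpen]
      intro y hy
      have hS : IsDef L K ({x | DSpace.chart (K := K) x i ≠ y} : Set E) :=
        .not (.eq hdm (.const y))
      have hB := (hsub _ (hXr.inter hS) inter_subset_left).image hc.continuousOn hdm
      refine ⟨_, hB.isClosed.isOpen_compl, ?_⟩
      ext z
      simp only [mem_inter_iff, mem_compl_iff, mem_singleton_iff]
      constructor
      · rintro ⟨h1, ⟨x, hx, rfl⟩⟩
        by_contra hne
        exact h1 ⟨x, ⟨hx, hne⟩, rfl⟩
      · rintro rfl
        refine ⟨?_, hy⟩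
        rintro ⟨x, ⟨-, hx⟩, hx'⟩
        exact hx hx'
    refine ((Set.Finite.pi' hproj).preimage
      (DSpace.chart (K := K) (E := E)).injective.injOn).subset ?_
    intro x hx i
    exact ⟨x, hx, rfl⟩
  have := finite_iUnion_of_monotone h (Y := fun r => X ∩ cball K E r)
    (by refine IsDef.and (hd.mem ?_) (defFam_cball.mem ?_ ?_) <;> fun_prop)
    (fun r s hrs => inter_subset_inter_right _ (cball_mono hrs)) key
  refine this.subset fun x hx => mem_iUnion.2 ⟨_, hx, le_rfl⟩

/-- Discrete definable sets are finite: such a set is an increasing union of uniformly separated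
sets, which are closed. -/
lemma ClosedDiscreteFinite.finite (h : ClosedDiscreteFinite L K) {X : Set E}
    (hd : IsDef L K X) (hdisc : IsDiscrete X) : X.Finite := by
  -- The points of `X` with no other point of `X` at distance less than `1 / r`.
  let Y : K → Set E := fun r => {x | x ∈ X ∧ ∀ y, y ∈ X → x ≠ y → 1 ≤ r * d K x y}
  have hY : DefFam L K Y := by
    refine IsDef.and (hd.mem ?_) (.all (.imp (hd.mem ?_) (.imp (.not (.eq ?_ ?_)) (.le ?_ ?_))))
      <;> fun_prop
  have hsep : ∀ r, ∀ x ∈ Y r, ∀ y ∈ Y r, x ≠ y → (max r 1)⁻¹ ≤ d K x y := by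
    intro r x hx y hy hxy
    have h1 := hx.2 y hy.1 hxy
    have h2 : (0 : K) < max r 1 := lt_max_of_lt_right one_pos
    rw [inv_le_iff_one_le_mul₀ h2, mul_comm]
    exact h1.trans (mul_le_mul_of_nonneg_right (le_max_left _ _) (d_nonneg _ _))
  have hpos : ∀ r : K, (0 : K) < (max r 1)⁻¹ := fun r => inv_pos.2 (lt_max_of_lt_right one_pos)
  have hfin : ∀ r, (Y r).Finite := by
    intro r
    refine h.finite_of_isClosed (hY.apply r) (isClosed_of_separated (hpos r) (hsep r)) ?_
    rw [isDiscrete_iff_d (K := K)]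
    refine fun x hx => ⟨_, hpos r, fun y hy hxy => ?_⟩
    by_contra hne
    exact absurd hxy (not_lt.2 (hsep r x hx y hy (Ne.symm hne)))
  have := finite_iUnion_of_monotone h hY (fun r s hrs x hx => ⟨hx.1, fun y hy hxy =>
    (hx.2 y hy hxy).trans (mul_le_mul_of_nonneg_right hrs (d_nonneg _ _))⟩) hfin
  refine this.subset fun x hx => ?_
  obtain ⟨ε, hε, h1⟩ := (isDiscrete_iff_d (K := K)).1 hdisc x hx
  refine mem_iUnion.2 ⟨ε⁻¹, hx, fun y hy hxy => ?_⟩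
  have : ε ≤ d K x y := by
    by_contra! hlt
    exact hxy (h1 y hy hlt).symm
  calc (1 : K) = ε⁻¹ * ε := (inv_mul_cancel₀ hε.ne').symm
    _ ≤ _ := mul_le_mul_of_nonneg_left this (inv_pos.2 hε).le

/-- A definable set has a boundary point in every interval that meets the set and its
complement. -/
lemma exists_mem_frontier {X : Set K} (hX : IsDef L K X) {x y : K} (hx : x ∈ X) (hy : y ∉ X) :
    ∃ z ∈ uIcc x y, z ∈ frontier X := by
  have key : ∀ X : Set K, IsDef L K X → ∀ x y : K, x ∈ X → y ∉ X → x ≤ y →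
      ∃ z ∈ Icc x y, z ∈ frontier X := by
    intro X hX x y hx hy hxy
    have hd : IsDef L K (X ∩ Iic y) := by refine hX.inter (.le ?_ ?_) <;> fun_prop
    obtain ⟨s, hs⟩ := exists_isLUB hd ⟨x, hx, hxy⟩ ⟨y, fun z hz => hz.2⟩
    have hxs : x ≤ s := hs.1 ⟨hx, hxy⟩
    have hsy : s ≤ y := hs.2 fun z hz => hz.2
    refine ⟨s, ⟨hxs, hsy⟩, ?_⟩
    rw [frontier_eq_closure_inter_closure]
    refine ⟨closure_mono inter_subset_left (hs.mem_closure ⟨x, hx, hxy⟩), ?_⟩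
    rcases hsy.eq_or_lt with rfl | hlt
    · exact subset_closure hy
    · have h1 : Ioo s y ⊆ Xᶜ := fun z hz hzX => absurd (hs.1 ⟨hzX, hz.2.le⟩) (not_le.2 hz.1)
      refine closure_mono h1 ?_
      rw [closure_Ioo hlt.ne]
      exact left_mem_Icc.2 hsy
  rcases le_total x y with hxy | hxy
  · rw [uIcc_of_le hxy]
    exact key X hX x y hx hy hxy
  · rw [uIcc_of_ge hxy]
    obtain ⟨z, hz, h⟩ := key Xᶜ hX.compl y x hy (by simpa) hxy
    exact ⟨z, hz, by rwa [frontier_compl] at h⟩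

/-- A closed definable subset of `K` without interior is finite: the midpoints of its complementary
intervals form a discrete set, and there is one of them between any two points of the set. -/
lemma ClosedDiscreteFinite.finite_of_interior_eq_empty (h : ClosedDiscreteFinite L K) {C : Set K}
    (hd : IsDef L K C) (hcl : IsClosed C) (hint : interior C = ∅) : C.Finite := by
  -- The midpoints of the bounded complementary intervals of `C`.
  let M : Set K := {m | ∃ ρ, 0 < ρ ∧ m - ρ ∈ C ∧ m + ρ ∈ C ∧ ∀ z, m - ρ < z → z < m + ρ → z ∉ C}
  have hM : IsDef L K M := by
    refine IsDef.ex (.and (.lt ?_ ?_) (.and (hd.mem ?_) (.and (hd.mem ?_)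
      (.all (.imp (.lt ?_ ?_) (.imp (.lt ?_ ?_) (.not (hd.mem ?_)))))))) <;> fun_prop
  have hMfin : M.Finite := by
    refine h.finite hM ((isDiscrete_iff_d (K := K)).2 ?_)
    rintro m ⟨ρ, hρ, h1, h2, h3⟩
    refine ⟨ρ, hρ, ?_⟩
    rintro m' ⟨ρ', hρ', h1', h2', h3'⟩ hlt
    rw [d_eq_abs, abs_lt] at hlt
    have a1 : m' - ρ' ≤ m - ρ := by
      by_contra! hcon
      exact h3 _ hcon (by linarith) h1'
    have a2 : m + ρ ≤ m' + ρ' := by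
      by_contra! hcon
      exact h3 _ (by linarith) hcon h2'
    have a3 : m - ρ ≤ m' - ρ' := by
      by_contra! hcon
      exact h3' _ hcon (by linarith) h1
    have a4 : m' + ρ' ≤ m + ρ := by
      by_contra! hcon
      exact h3' _ (by linarith) hcon h2
    linarith
  have hbetween : ∀ a ∈ C, ∀ b ∈ C, a < b → ∃ m ∈ M, a < m ∧ m < b := by
    intro a ha b hb hab
    obtain ⟨c, hc, hcC⟩ : ∃ c ∈ Ioo a b, c ∉ C := by
      by_contra! hcon
      have : Ioo a b ⊆ interior C := interior_maximal hcon isOpen_Ioo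
      rw [hint] at this
      obtain ⟨c, hc⟩ := exists_between hab
      exact this hc
    have hd1 : IsDef L K (C ∩ Iic c) := by refine hd.inter (.le ?_ ?_) <;> fun_prop
    have hd2 : IsDef L K (C ∩ Ici c) := by refine hd.inter (.le ?_ ?_) <;> fun_prop
    obtain ⟨p, hp⟩ := exists_isLUB hd1 ⟨a, ha, hc.1.le⟩ ⟨c, fun z hz => hz.2⟩
    obtain ⟨q, hq⟩ := exists_isGLB hd2 ⟨b, hb, hc.2.le⟩ ⟨c, fun z hz => hz.2⟩
    have hpC := (hcl.inter isClosed_Iic).closure_subset (hp.mem_closure ⟨a, ha, hc.1.le⟩)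
    have hqC := (hcl.inter isClosed_Ici).closure_subset (hq.mem_closure ⟨b, hb, hc.2.le⟩)
    have hpc : p < c := lt_of_le_of_ne hpC.2 (by rintro rfl; exact hcC hpC.1)
    have hqc : c < q := lt_of_le_of_ne hqC.2 (by rintro rfl; exact hcC hqC.1)
    have hap := hp.1 ⟨ha, hc.1.le⟩
    have hqb := hq.1 ⟨hb, hc.2.le⟩
    have e1 : (p + q) / 2 - (q - p) / 2 = p := by ring
    have e2 : (p + q) / 2 + (q - p) / 2 = q := by ring
    refine ⟨(p + q) / 2, ⟨(q - p) / 2, by linarith, ?_, ?_, ?_⟩, by linarith, by linarith⟩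
    · rw [e1]; exact hpC.1
    · rw [e2]; exact hqC.1
    · rw [e1, e2]
      intro z hz1 hz2 hz
      rcases le_total z c with hzc | hzc
      · linarith [hp.1 ⟨hz, hzc⟩]
      · linarith [hq.1 ⟨hz, hzc⟩]
  -- A point of `C` is determined by the set of the midpoints below it.
  refine Set.Finite.of_injOn (f := fun x => M ∩ Iio x) (t := {s | s ⊆ M})
    (fun x _ => inter_subset_left) ?_ hMfin.finite_subsets
  have hne : ∀ a ∈ C, ∀ b ∈ C, a < b → M ∩ Iio a ≠ M ∩ Iio b := by
    intro a ha b hb hab heq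
    obtain ⟨m, hm, h1, h2⟩ := hbetween a ha b hb hab
    have : m ∈ M ∩ Iio a := by rw [heq]; exact ⟨hm, h2⟩
    exact absurd this.2 (not_lt.2 h1.le)
  intro a ha b hb heq
  rcases lt_trichotomy a b with hab | hab | hab
  · exact (hne a ha b hb hab heq).elim
  · exact hab
  · exact (hne b hb a ha hab heq.symm).elim

/-- `D_Σ` subsets of `K` without interior are finite. -/
lemma IsDSigma.finite_of_interior_eq_empty (h : ClosedDiscreteFinite L K) {X : Set K}
    (hX : IsDSigma L K X) (hint : interior X = ∅) : X.Finite := by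
  obtain ⟨Y, hY, hc, hm, rfl⟩ := hX
  refine finite_iUnion_of_monotone h hY hm fun r => ?_
  refine h.finite_of_interior_eq_empty (hc r).isDef (hc r).isClosed ?_
  exact subset_empty_iff.1 (hint ▸ interior_mono (subset_iUnion Y r))

lemma interior_eq_empty_of_finite {X : Set K} (h : X.Finite) : interior X = ∅ := by
  by_contra hne
  obtain ⟨x, hx⟩ := nonempty_iff_ne_empty.2 hne
  obtain ⟨ε, hε, h1⟩ := (mem_interior_iff_d (K := K)).1 hx
  refine (Ioo_infinite (lt_add_of_pos_right x hε)) (h.subset fun y hy => h1 y ?_)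
  rw [d_eq_abs, abs_sub_lt_iff]
  constructor <;> linarith [hy.1, hy.2]

/-- `D_Σ` subsets of `K` have finite boundary, which is all that o-minimality needs. -/
lemma IsDSigma.finite_frontier (h : ClosedDiscreteFinite L K) {X : Set K}
    (hX : IsDSigma L K X) : (frontier X).Finite := by
  have h1 : (X \ interior X).Finite := by
    have hi := hX.isDef.interior
    have : IsDSigma L K (X \ interior X) :=
      hX.inter (.of_isClosed hi.compl isOpen_interior.isClosed_compl)
    refine this.finite_of_interior_eq_empty h ?_
    refine subset_empty_iff.1 fun x hx => ?_
    exact (interior_subset hx).2 (interior_mono sdiff_subset hx)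
  have h2 : (frontier (interior X)).Finite := by
    have hcl : IsClosed (frontier (interior X)) := isClosed_frontier
    refine h.finite_of_interior_eq_empty ?_ hcl ?_
    swap
    · rw [← frontier_compl]; exact interior_frontier isOpen_interior.isClosed_compl
    rw [isOpen_interior.frontier_eq]
    exact hX.isDef.interior.closure.diff hX.isDef.interior
  have h3 : frontier X ⊆ (X \ interior X) ∪ frontier (interior X) := by
    rw [isOpen_interior.frontier_eq]
    intro x hx
    have h4 : closure X ⊆ (X \ interior X) ∪ closure (interior X) := by
      have : X ⊆ (X \ interior X) ∪ interior X := by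
        intro x hx
        by_cases hxi : x ∈ interior X
        · exact Or.inr hxi
        · exact Or.inl ⟨hx, hxi⟩
      refine (closure_mono this).trans ?_
      rw [closure_union, h1.isClosed.closure_eq]
    rcases h4 hx.1 with h5 | h5
    · exact Or.inl h5
    · exact Or.inr ⟨h5, hx.2⟩
  exact (h1.union h2).subset h3

/-- A definable set with finite boundary is constant on the components of the complement of the
boundary, by `exists_mem_frontier`. -/
lemma exists_intervals_of_finite_frontier {X : Set K} (hX : IsDef L K X)
    (h : (frontier X).Finite) :
    ∃ F : Set (Set K), F.Finite ∧ (∀ S ∈ F, IsPointOrInterval S) ∧ X = ⋃₀ F := by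
  let A := frontier X
  let F : Set (Set K) := {S | S ⊆ X ∧ (S ∈ (fun a => {a}) '' A ∨
    S ∈ (fun p : K × K => Ioo p.1 p.2) '' (A ×ˢ A) ∨ S ∈ Ioi '' A ∨ S ∈ Iio '' A ∨
      S ∈ ({univ} : Set (Set K)))}
  refine ⟨F, ?_, ?_, ?_⟩
  · refine Set.Finite.subset (((h.image _).union (((h.prod h).image _).union
      ((h.image _).union ((h.image _).union (finite_singleton _)))))) fun S hS => hS.2
  · rintro S ⟨-, ⟨a, -, rfl⟩ | ⟨p, -, rfl⟩ | ⟨a, -, rfl⟩ | ⟨a, -, rfl⟩ | rfl⟩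
    · exact Or.inl ⟨a, rfl⟩
    · exact Or.inr (Or.inl ⟨p.1, p.2, rfl⟩)
    · exact Or.inr (Or.inr (Or.inl ⟨a, rfl⟩))
    · exact Or.inr (Or.inr (Or.inr (Or.inl ⟨a, rfl⟩)))
    · exact Or.inr (Or.inr (Or.inr (Or.inr rfl)))
  · refine Subset.antisymm (fun x hx => ?_) (sUnion_subset fun S hS => hS.1)
    by_cases hxA : x ∈ A
    · exact ⟨{x}, ⟨by simpa using hx, Or.inl ⟨x, hxA, rfl⟩⟩, rfl⟩
    have hconn : ∀ J : Set K, J.OrdConnected → x ∈ J → (∀ z ∈ J, z ∉ A) → J ⊆ X := by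
      intro J hJ hxJ hJA y hy
      by_contra hyX
      obtain ⟨z, hz, hzA⟩ := exists_mem_frontier hX hx hyX
      exact hJA z (hJ.uIcc_subset hxJ hy hz) hzA
    have hlow : (A ∩ Iio x).Nonempty → ∃ a ∈ A, a < x ∧ ∀ z ∈ A, a < z → x ≤ z := by
      intro hne
      obtain ⟨a, ha, hmax⟩ := Set.exists_max_image (A ∩ Iio x) id (h.subset inter_subset_left) hne
      refine ⟨a, ha.1, ha.2, fun z hz haz => ?_⟩
      by_contra! hzx
      exact absurd (hmax z ⟨hz, hzx⟩) (not_le.2 haz)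
    have hup : (A ∩ Ioi x).Nonempty → ∃ b ∈ A, x < b ∧ ∀ z ∈ A, z < b → z ≤ x := by
      intro hne
      obtain ⟨b, hb, hmin⟩ := Set.exists_min_image (A ∩ Ioi x) id (h.subset inter_subset_left) hne
      refine ⟨b, hb.1, hb.2, fun z hz hzb => ?_⟩
      by_contra! hxz
      exact absurd (hmin z ⟨hz, hxz⟩) (not_le.2 hzb)
    have hne : ∀ z ∈ A, z ≠ x := by rintro z hz rfl; exact hxA hz
    by_cases h1 : (A ∩ Iio x).Nonempty <;> by_cases h2 : (A ∩ Ioi x).Nonempty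
    · obtain ⟨a, ha, hax, ha'⟩ := hlow h1
      obtain ⟨b, hb, hbx, hb'⟩ := hup h2
      refine ⟨Ioo a b, ⟨hconn _ ordConnected_Ioo ⟨hax, hbx⟩ fun z hz hzA => hne z hzA ?_,
        Or.inr (Or.inl ⟨(a, b), ⟨ha, hb⟩, rfl⟩)⟩, hax, hbx⟩
      exact le_antisymm (hb' z hzA hz.2) (ha' z hzA hz.1)
    · obtain ⟨a, ha, hax, ha'⟩ := hlow h1
      refine ⟨Ioi a, ⟨hconn _ ordConnected_Ioi hax fun z hz hzA => h2 ⟨z, hzA, ?_⟩,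
        Or.inr (Or.inr (Or.inl ⟨a, ha, rfl⟩))⟩, hax⟩
      exact lt_of_le_of_ne (ha' z hzA hz) (hne z hzA).symm
    · obtain ⟨b, hb, hbx, hb'⟩ := hup h2
      refine ⟨Iio b, ⟨hconn _ ordConnected_Iio hbx fun z hz hzA => h1 ⟨z, hzA, ?_⟩,
        Or.inr (Or.inr (Or.inr (Or.inl ⟨b, hb, rfl⟩)))⟩, hbx⟩
      exact lt_of_le_of_ne (hb' z hzA hz) (hne z hzA)
    · refine ⟨univ, ⟨hconn _ ordConnected_univ trivial fun z _ hzA => ?_,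
        Or.inr (Or.inr (Or.inr (Or.inr rfl)))⟩, trivial⟩
      rcases lt_trichotomy z x with h3 | h3 | h3
      · exact h1 ⟨z, hzA, h3⟩
      · exact hne z hzA h3
      · exact h2 ⟨z, hzA, h3⟩

end Sigma

/-! ### The Baire property and nowhere dense `D_Σ` sets -/

section Baire

variable {L : FirstOrder.Language.{u, v}} {K : Type w} [L.Structure K]
  [Field K] [LinearOrder K] [TopologicalSpace K] [IsStrictOrderedRing K] [OrderTopology K]
  [hE : Fact (ExpandsOrderedField L K)] [hC : Fact (IsDefinablyComplete L K)]
variable {E F G : Type*} [TopologicalSpace E] [TopologicalSpace F] [TopologicalSpace G]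
  [DSpace K E] [DSpace K F] [DSpace K G]

/-- Definably compact sets are bounded. -/
lemma DComp.exists_subset_cball {X : Set E} (h : DComp L K X) : ∃ r, X ⊆ Tame.cball K E r := by
  by_contra! hcon
  obtain ⟨p, hp, h1⟩ := h.2
    (fun t => {x | x ∈ X ∧ 1 < t * d K ((DSpace.chart (K := K)).symm 0) x})
    (by refine IsDef.and (h.1.mem ?_) (.lt ?_ ?_) <;> fun_prop)
    (fun s t hs hst x hx => ⟨hx.1, hx.2.trans_le
      (mul_le_mul_of_nonneg_right hst (d_nonneg _ _))⟩)
    (fun t ht => by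
      obtain ⟨x, hx, hxr⟩ := not_subset.1 (hcon t⁻¹)
      refine ⟨x, hx, ?_⟩
      simp only [Tame.cball, mem_ofPred_eq, not_le] at hxr
      rwa [inv_lt_iff_one_lt_mul₀' ht] at hxr) (fun t _ x hx => hx.1)
  have hpos : 0 < d K ((DSpace.chart (K := K)).symm 0) p + 1 := by
    linarith [d_nonneg (K := K) ((DSpace.chart (K := K)).symm 0) p]
  obtain ⟨y, ⟨-, hy⟩, hpy⟩ := (mem_closure_iff_d (K := K)).1 (h1 _ (inv_pos.2 hpos)) 1 one_pos
  have h2 := d_triangle (K := K) ((DSpace.chart (K := K)).symm 0) p y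
  rw [lt_inv_mul_iff₀ hpos] at hy
  linarith

lemma DComp.exists_abs_le {X : Set K} (h : DComp L K X) : ∃ r, ∀ x ∈ X, |x| ≤ r := by
  obtain ⟨r, hr⟩ := h.exists_subset_cball
  refine ⟨r, fun x hx => ?_⟩
  have h1 : d K (0 : K) x ≤ r := hr hx
  rwa [d_eq_abs, zero_sub, abs_neg] at h1

variable (K) in
/-- The set of triples `(x, y, z)` such that `{x} × [y, z] ⊆ D` and `[y, z]` has length at least `1
/ r` (there are none unless `0 < r`). The segment is parametrized by `[0, 1]`, so that the set is
visibly closed if `D` is. -/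
def segments (D : Set (E × K)) (r : K) : Set (E × K × K) :=
  {p | p.2.1 ≤ p.2.2 ∧ 1 ≤ r * (p.2.2 - p.2.1) ∧
    ∀ t ∈ Icc (0 : K) 1, (p.1, p.2.1 + t * (p.2.2 - p.2.1)) ∈ D}

lemma segments_mem {D : Set (E × K)} {r : K} {x : E} {y z w : K} (h : (x, y, z) ∈ segments K D r)
    (hw : w ∈ Icc y z) : (x, w) ∈ D := by
  obtain ⟨h1, h2, h3⟩ := h
  simp only at h1 h2 h3
  have hyz : 0 < z - y := by
    refine lt_of_le_of_ne (sub_nonneg.2 h1) fun h => ?_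
    rw [← h] at h2
    linarith
  have := h3 ((w - y) / (z - y)) ⟨div_nonneg (by linarith [hw.1]) hyz.le,
    (div_le_one hyz).2 (by linarith [hw.2])⟩
  rwa [div_mul_cancel₀ _ hyz.ne', add_sub_cancel] at this

lemma segments_lt {D : Set (E × K)} {r : K} {x : E} {y z : K} (h : (x, y, z) ∈ segments K D r) :
    0 < r ∧ r⁻¹ ≤ z - y := by
  obtain ⟨h1, h2, -⟩ := h
  simp only at h1 h2
  have hr : 0 < r := by
    by_contra! hr
    have := mul_nonpos_of_nonpos_of_nonneg hr (sub_nonneg.2 h1)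
    linarith
  exact ⟨hr, (inv_le_iff_one_le_mul₀' hr).2 h2⟩

lemma mem_segments {D : Set (E × K)} {r : K} {x : E} {y z : K} (hyz : y ≤ z)
    (hr : 1 ≤ r * (z - y)) (h : ∀ w ∈ Icc y z, (x, w) ∈ D) : (x, y, z) ∈ segments K D r := by
  refine ⟨hyz, hr, fun t ht => h _ ⟨?_, ?_⟩⟩
  · simp only [le_add_iff_nonneg_right]
    exact mul_nonneg ht.1 (sub_nonneg.2 hyz)
  · have := mul_le_mul_of_nonneg_right ht.2 (sub_nonneg.2 hyz)
    simp only
    linarith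

lemma DComp.segments {D : Set (E × K)} (h : DComp L K D) (r : K) :
    DComp L K (segments K D r) := by
  have h1 := h.image continuous_fst.continuousOn DefMap.fst
  have h2 := h.image continuous_snd.continuousOn DefMap.snd
  refine (h1.prod (h2.prod h2)).subset ?_ ?_ ?_
  · have : Tame.segments K D r = {p | p.2.1 ≤ p.2.2} ∩ ({p | 1 ≤ r * (p.2.2 - p.2.1)} ∩
        ⋂ t ∈ Set.Icc (0 : K) 1,
          (fun p : E × K × K => (p.1, p.2.1 + t * (p.2.2 - p.2.1))) ⁻¹' D) := by
      ext p; simp [Tame.segments]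
    rw [this]
    refine (isClosed_le (by fun_prop) (by fun_prop)).inter
      ((isClosed_le (by fun_prop) (by fun_prop)).inter (isClosed_biInter fun t _ => ?_))
    exact h.isClosed.preimage (by fun_prop)
  · refine .and (.le ?_ ?_) (.and (.le ?_ ?_)
      (.all (.imp (.and (.le ?_ ?_) (.le ?_ ?_)) (h.isDef.mem ?_)))) <;> fun_prop
  · rintro ⟨x, y, z⟩ hp
    have ha := segments_mem hp (left_mem_Icc.2 hp.1)
    have hb := segments_mem hp (right_mem_Icc.2 hp.1)
    exact ⟨⟨_, ha, rfl⟩, ⟨_, ha, rfl⟩, ⟨_, hb, rfl⟩⟩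

lemma segments_mono {Y : K → Set (E × K)} (hm : Monotone Y) :
    Monotone fun r => segments K (Y r) r := fun _ _ hrs _ hp =>
  ⟨hp.1, hp.2.1.trans (mul_le_mul_of_nonneg_right hrs (sub_nonneg.2 hp.1)),
    fun t ht => hm hrs (hp.2.2 t ht)⟩

lemma DefFam.segments {Y : K → Set (E × K)} (hY : DefFam L K Y) :
    DefFam L K fun r => segments K (Y r) r := by
  refine IsDef.and (.le ?_ ?_) (.and (.le ?_ ?_)
    (.all (.imp (.and (.le ?_ ?_) (.le ?_ ?_)) (hY.mem ?_ ?_)))) <;> fun_prop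

variable (K) in
/-- The set of the points over which the fiber of `X` has an interior point. -/
def intFib (X : Set (E × K)) : Set E := {x | (interior {y | (x, y) ∈ X}).Nonempty}

lemma IsDSigma.fiber {X : Set (E × F)} (hX : IsDSigma L K X) (x : E) :
    IsDSigma L K {y | (x, y) ∈ X} := hX.mem (by fun_prop) (by fun_prop)

lemma IsDef.fiber {X : Set (E × F)} (hX : IsDef L K X) (x : E) :
    IsDef L K {y | (x, y) ∈ X} := hX.mem (by fun_prop)

lemma IsDSigma.finite_fiber (h : ClosedDiscreteFinite L K) {X : Set (E × K)}
    (hX : IsDSigma L K X) {x : E} (hx : x ∉ intFib K X) : {y | (x, y) ∈ X}.Finite :=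
  (hX.fiber x).finite_of_interior_eq_empty h (not_nonempty_iff_eq_empty.1 hx)

lemma exists_Icc_subset {U : Set K} {x : K} (hx : x ∈ interior U) :
    ∃ y, x < y ∧ Icc x y ⊆ U := by
  obtain ⟨ε, hε, h⟩ := (mem_interior_iff_d (K := K)).1 hx
  refine ⟨x + ε / 2, by linarith, fun z hz => h z ?_⟩
  rw [d_eq_abs, abs_sub_lt_iff]
  constructor <;> linarith [hz.1, hz.2]

/-- A one-dimensional instance of the Baire category theorem, applied to each fiber. -/
lemma intFib_iUnion (h : ClosedDiscreteFinite L K) {Y : K → Set (E × K)} (hY : DefFam L K Y)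
    (hc : ∀ r, DComp L K (Y r)) (hm : Monotone Y) :
    intFib K (⋃ r, Y r) = ⋃ r, Prod.fst '' segments K (Y r) r := by
  ext x
  simp only [mem_iUnion]
  constructor
  · intro hx
    obtain ⟨r, hr⟩ : ∃ r, (interior {y | (x, y) ∈ Y r}).Nonempty := by
      by_contra! hcon
      have hfin : (⋃ r, {y | (x, y) ∈ Y r}).Finite := by
        refine finite_iUnion_of_monotone h (by refine hY.mem ?_ ?_ <;> fun_prop)
          (fun r s hrs y hy => hm hrs hy) fun r => ?_
        exact h.finite_of_interior_eq_empty ((hc r).isDef.fiber x)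
          ((hc r).isClosed.preimage (by fun_prop)) (hcon r)
      have h1 := interior_eq_empty_of_finite hfin
      have h2 : {y | (x, y) ∈ ⋃ r, Y r} = ⋃ r, {y | (x, y) ∈ Y r} := by ext; simp
      unfold intFib at hx
      rw [mem_ofPred_eq, h2, h1] at hx
      exact not_nonempty_empty hx
    obtain ⟨y, hy⟩ := hr
    obtain ⟨z, hyz, hI⟩ := exists_Icc_subset hy
    have hpos : 0 < z - y := sub_pos.2 hyz
    refine ⟨max r (z - y)⁻¹, (x, y, z), mem_segments hyz.le ?_ fun w hw =>
      hm (le_max_left _ _) (hI hw), rfl⟩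
    calc (1 : K) = (z - y)⁻¹ * (z - y) := (inv_mul_cancel₀ hpos.ne').symm
      _ ≤ _ := mul_le_mul_of_nonneg_right (le_max_right _ _) hpos.le
  · rintro ⟨r, ⟨x, y, z⟩, hp, rfl⟩
    obtain ⟨hr, hyz⟩ := segments_lt hp
    have hyz : y < z := by linarith [inv_pos.2 hr]
    have : Ioo y z ⊆ interior {w | (x, w) ∈ ⋃ r, Y r} :=
      interior_maximal (fun w hw => mem_iUnion.2 ⟨r, segments_mem hp (Ioo_subset_Icc_self hw)⟩)
        isOpen_Ioo
    exact (nonempty_Ioo.2 hyz).mono this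

/-- The base points over which a `D_Σ` set has a fiber with interior form a `D_Σ` set. -/
lemma IsDSigma.intFib (h : ClosedDiscreteFinite L K) {X : Set (E × K)} (hX : IsDSigma L K X) :
    IsDSigma L K (intFib K X) := by
  obtain ⟨Y, hY, hc, hm, rfl⟩ := hX
  refine ⟨_, ?_, fun r => ((hc r).segments r).image continuous_fst.continuousOn DefMap.fst,
    fun r s hrs => image_mono (segments_mono hm hrs), intFib_iUnion h hY hc hm⟩
  refine IsDef.ex (.and (hY.segments.mem ?_ ?_) (.eq ?_ ?_)) <;> fun_prop

/-- If, over all points of an open set, the fiber of a definably compact set `D` contains an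
interval of length at least `1 / r`, then `D` has an interior point.  The infimum of the left
endpoints of such intervals is a lower semicontinuous function of the base point, so it is almost
constant near a point where it is almost maximal. -/
lemma DComp.interior_nonempty_of_segments {D : Set (E × K)} (hD : DComp L K D) {r : K}
    (h : (interior (Prod.fst '' Tame.segments K D r)).Nonempty) : (interior D).Nonempty := by
  obtain ⟨x0, hx0⟩ := h
  obtain ⟨δ, hδ, hball⟩ := (mem_interior_iff_d (K := K)).1 hx0
  have hr : 0 < r := by
    obtain ⟨⟨x, y, z⟩, hp, -⟩ := hball x0 (by rwa [d_self])
    exact (segments_lt hp).1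
  -- The left endpoints of the intervals of length at least `1 / r` in the fibers of `D`.
  let Q : Set (E × K) := (fun p : E × K × K => (p.1, p.2.1)) '' Tame.segments K D r
  have hQ : DComp L K Q := (hD.segments r).image (by fun_prop) (by fun_prop)
  obtain ⟨R, hR⟩ := (hQ.image continuous_snd.continuousOn DefMap.snd).exists_abs_le
  have hR' : ∀ x y, (x, y) ∈ Q → |y| ≤ R := fun x y hxy => hR y ⟨_, hxy, rfl⟩
  have hJ : ∀ x, d K x0 x < δ → ∃ y, (x, y) ∈ Q := by
    intro x hx
    obtain ⟨⟨x, y, z⟩, hp, rfl⟩ := hball x hx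
    exact ⟨y, ⟨_, hp, rfl⟩⟩
  -- `σ` is the supremum, over the `x` near `x0`, of the infimum of the fiber of `Q` at `x`.
  let S : Set K := {y | ∃ x, d K x0 x < δ ∧ ∀ y', y' < y → (x, y') ∉ Q}
  have hS : IsDef L K S := by
    refine IsDef.ex (.and (.lt ?_ ?_) (.all (.imp (.lt ?_ ?_) (.not (hQ.isDef.mem ?_)))))
      <;> fun_prop
  obtain ⟨σ, hσ⟩ := exists_isLUB hS
    ⟨-R, x0, by rwa [d_self], fun y' hy' hQy => by linarith [(abs_le.1 (hR' _ _ hQy)).1]⟩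
    ⟨R, by
      rintro y ⟨x, hx, hy⟩
      obtain ⟨y0, hy0⟩ := hJ x hx
      by_contra! hlt
      exact hy y0 (((abs_le.1 (hR' _ _ hy0)).2).trans_lt hlt) hy0⟩
  -- On `V` all left endpoints are greater than `σ - 2 * ε`, and some left endpoint is less than
  -- `σ + ε`; the interval that starts there has length at least `4 * ε`.
  let ε := r⁻¹ / 4
  have hε : 0 < ε := div_pos (inv_pos.2 hr) (by norm_num)
  obtain ⟨y0, ⟨x1, hx1, hy0⟩, hσy⟩ := (lt_isLUB_iff hσ).1 (sub_lt_self σ hε)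
  let A : Set (E × K) := Q ∩ {p | p.2 ≤ y0 - ε}
  have hA : DComp L K A := hQ.subset (hQ.isClosed.inter (isClosed_le (by fun_prop) (by fun_prop)))
    (hQ.isDef.inter (by refine .le ?_ ?_ <;> fun_prop)) inter_subset_left
  let V : Set E := {x | d K x0 x < δ} ∩ (Prod.fst '' A)ᶜ
  have hV : IsOpen V := (isOpen_ball x0 δ).inter
    (hA.image continuous_fst.continuousOn DefMap.fst).isClosed.isOpen_compl
  have hx1V : x1 ∈ V := by
    refine ⟨hx1, ?_⟩
    rintro ⟨⟨x, y⟩, ⟨hxy, hy⟩, rfl⟩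
    exact hy0 y (by simp only [mem_ofPred_eq] at hy; linarith) hxy
  have hsub : V ×ˢ Ioo (σ + ε) (σ + 2 * ε) ⊆ D := by
    rintro ⟨x, w⟩ ⟨⟨hx, hxA⟩, hw⟩
    obtain ⟨y', hy', hyQ⟩ : ∃ y', y' < σ + ε ∧ (x, y') ∈ Q := by
      by_contra! hcon
      have : σ + ε ∈ S := ⟨x, hx, hcon⟩
      linarith [hσ.1 this]
    have h1 : y0 - ε < y' := by
      by_contra! hle
      exact hxA ⟨(x, y'), ⟨hyQ, hle⟩, rfl⟩
    obtain ⟨⟨x, y', z⟩, hp, heq⟩ := hyQ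
    simp only [Prod.mk.injEq] at heq
    obtain ⟨rfl, rfl⟩ := heq
    have h2 := (segments_lt hp).2
    have h3 : r⁻¹ = 4 * ε := by simp only [ε]; ring
    refine segments_mem hp ⟨?_, ?_⟩
    · linarith [hw.1]
    · linarith [hw.2]
  have hne : (V ×ˢ Ioo (σ + ε) (σ + 2 * ε)).Nonempty :=
    Set.Nonempty.prod ⟨x1, hx1V⟩ (nonempty_Ioo.2 (by linarith))
  exact hne.mono (interior_maximal hsub (hV.prod isOpen_Ioo))

variable (L K) in
/-- The Baire property of `E` for increasing definable families of definably compact sets. -/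
def SigmaBaire (E : Type*) [TopologicalSpace E] [DSpace K E] : Prop :=
  ∀ Y : K → Set E, DefFam L K Y → (∀ r, DComp L K (Y r)) → Monotone Y →
    (interior (⋃ r, Y r)).Nonempty → ∃ r, (interior (Y r)).Nonempty

variable (L K) in
/-- Every `D_Σ` subset of `E` without interior points is nowhere dense. -/
def SigmaNowhereDense (E : Type*) [TopologicalSpace E] [DSpace K E] : Prop :=
  ∀ X : Set E, IsDSigma L K X → interior X = ∅ → interior (closure X) = ∅

/-- The Kuratowski–Ulam property: if the fibers of the union have interior over an open set of base
points, then some member of the family has interior. -/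
lemma SigmaBaire.interior_nonempty (h : ClosedDiscreteFinite L K) (hB : SigmaBaire L K E)
    {Y : K → Set (E × K)} (hY : DefFam L K Y) (hc : ∀ r, DComp L K (Y r)) (hm : Monotone Y)
    (hi : (interior (intFib K (⋃ r, Y r))).Nonempty) : ∃ r, (interior (Y r)).Nonempty := by
  rw [intFib_iUnion h hY hc hm] at hi
  obtain ⟨r, hr⟩ := hB _
    (by refine IsDef.ex (.and (hY.segments.mem ?_ ?_) (.eq ?_ ?_)) <;> fun_prop)
    (fun r => ((hc r).segments r).image continuous_fst.continuousOn DefMap.fst)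
    (fun r s hrs => image_mono (segments_mono hm hrs)) hi
  exact ⟨r, (hc r).interior_nonempty_of_segments hr⟩

omit hE hC in
lemma exists_ball_prod {O : Set (E × F)} {p : E × F} (hp : p ∈ interior O) :
    ∃ ε : K, 0 < ε ∧ ∀ x y, d K p.1 x < ε → d K p.2 y < ε → (x, y) ∈ O := by
  obtain ⟨ε, hε, h⟩ := (mem_interior_iff_d (K := K)).1 hp
  refine ⟨ε / 2, by positivity, fun x y hx hy => h _ ?_⟩
  rw [d_prod]
  simp only
  linarith

omit hE hC in
lemma interior_intFib_nonempty {X : Set (E × K)} (h : (interior X).Nonempty) :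
    (interior (intFib K X)).Nonempty := by
  obtain ⟨p, hp⟩ := h
  obtain ⟨ε, hε, h⟩ := exists_ball_prod (K := K) hp
  refine ⟨p.1, (mem_interior_iff_d (K := K)).2 ⟨ε, hε, fun x hx => ⟨p.2, ?_⟩⟩⟩
  exact (mem_interior_iff_d (K := K)).2 ⟨ε, hε, fun y hy => h x y hx hy⟩

lemma SigmaBaire.prod (h : ClosedDiscreteFinite L K) (hB : SigmaBaire L K E) :
    SigmaBaire L K (E × K) := fun _ hY hc hm hi =>
  hB.interior_nonempty h hY hc hm (interior_intFib_nonempty hi)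

/-- The contrapositive of the Kuratowski–Ulam property: the fibers of a `D_Σ` set without interior
have interior points only over a set without interior. -/
lemma IsDSigma.interior_intFib (h : ClosedDiscreteFinite L K) (hB : SigmaBaire L K E)
    {X : Set (E × K)} (hX : IsDSigma L K X) (hi : interior X = ∅) :
    interior (Tame.intFib K X) = ∅ := by
  obtain ⟨Y, hY, hc, hm, rfl⟩ := hX
  by_contra hne
  obtain ⟨r, hr⟩ := hB.interior_nonempty h hY hc hm (nonempty_iff_ne_empty.2 hne)
  have := hr.mono (interior_mono (subset_iUnion Y r))
  rw [hi] at this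
  exact not_nonempty_empty this

/-- The Baire property extends to arbitrary increasing definable families, with closures in place of
the sets themselves. -/
lemma SigmaBaire.closure (hB : SigmaBaire L K E) {Z : K → Set E} (hZ : DefFam L K Z)
    (hm : Monotone Z) (hi : (interior (⋃ r, Z r)).Nonempty) :
    ∃ r, (interior (_root_.closure (Z r))).Nonempty := by
  have hd : DefFam L K fun r => _root_.closure (Z r) := by
    have : IsDef L K {p : K × E | ∀ ε : K, 0 < ε → ∃ y, y ∈ Z p.1 ∧ d K p.2 y < ε} := by
      refine .all (.imp (.lt ?_ ?_) (.ex (.and (hZ.mem ?_ ?_) (.lt ?_ ?_)))) <;> fun_prop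
    unfold DefFam
    convert! this using 1
    ext p
    exact mem_closure_iff_d (K := K)
  obtain ⟨r, hr⟩ := hB (fun r => _root_.closure (Z r) ∩ cball K E r)
    (IsDef.inter hd defFam_cball)
    (fun r => (DComp.cball r).subset (isClosed_closure.inter (DComp.cball (L := L) r).isClosed)
      ((hd.apply r).inter (defFam_cball.apply r)) inter_subset_right)
    (fun r s hrs => inter_subset_inter (_root_.closure_mono (hm hrs)) (cball_mono hrs))
    (hi.mono (interior_mono (iUnion_subset fun r x hx => mem_iUnion.2
      ⟨max r (d K ((DSpace.chart (K := K)).symm 0) x),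
        subset_closure (hm (le_max_left _ _) hx), le_max_right _ _⟩)))
  exact ⟨r, hr.mono (interior_mono inter_subset_left)⟩

/-- If an open set is covered by an increasing definable family of sets with `D_Σ` complement,
then one of them contains a nonempty open subset of it. -/
lemma SigmaNowhereDense.exists_open_subset (hN : SigmaNowhereDense L K E)
    (hB : SigmaBaire L K E) {B : Set E} (hBd : IsDef L K B) (hBo : IsOpen B) (hBne : B.Nonempty)
    {Z : K → Set E} (hZ : DefFam L K Z) (hm : Monotone Z) (hcov : B ⊆ ⋃ r, Z r)
    (hσ : ∀ r, IsDSigma L K (B \ Z r)) :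
    ∃ r, ∃ B' ⊆ B, IsDef L K B' ∧ IsOpen B' ∧ B'.Nonempty ∧ B' ⊆ Z r := by
  obtain ⟨r, hr⟩ := hB.closure (Z := fun r => B ∩ Z r)
    (by refine IsDef.and (hBd.mem ?_) (hZ.mem ?_ ?_) <;> fun_prop)
    (fun r s hrs => inter_subset_inter_right _ (hm hrs))
    (hBne.mono (interior_maximal (by rw [← inter_iUnion]; exact subset_inter subset_rfl hcov) hBo))
  have hZd := (hBd.inter (hZ.apply r)).closure.interior
  set U := interior (_root_.closure (B ∩ Z r))
  have hUo : IsOpen U := isOpen_interior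
  have hWne : (U ∩ B).Nonempty := by
    obtain ⟨x, hx⟩ := hr
    obtain ⟨y, hyU, hyB⟩ := mem_closure_iff.1 (interior_subset hx) U hUo hx
    exact ⟨y, hyU, hyB.1⟩
  -- `V` is a `D_Σ` set without interior points because `Z r` is dense in `U`.
  let V := U ∩ (B \ Z r)
  have hVσ : IsDSigma L K V := (IsDSigma.of_isOpen hZd hUo).inter (hσ r)
  have hVi : interior V = ∅ := by
    by_contra hne
    obtain ⟨x, hx⟩ := nonempty_iff_ne_empty.2 hne
    obtain ⟨y, hy, hyB⟩ := mem_closure_iff.1 (interior_subset (interior_subset hx).1) _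
      isOpen_interior hx
    exact (interior_subset hy).2.2 hyB.2
  have hVc := hN V hVσ hVi
  refine ⟨r, (U ∩ B) \ _root_.closure V, fun x hx => hx.1.2,
    (hZd.inter hBd).diff hVσ.isDef.closure, (hUo.inter hBo).sdiff isClosed_closure, ?_, ?_⟩
  · by_contra hne
    rw [not_nonempty_iff_eq_empty, sdiff_eq_empty] at hne
    have := hWne.mono (interior_maximal hne (hUo.inter hBo))
    rw [hVc] at this
    exact not_nonempty_empty this
  · rintro x ⟨⟨hxU, hxB⟩, hxV⟩
    by_contra hxZ
    exact hxV (subset_closure ⟨hxU, hxB, hxZ⟩)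

/-- Over a small open set, a `D_Σ` set with finite fibers coincides with one of the definably
compact sets that exhaust it; in particular it is closed there. -/
lemma SigmaNowhereDense.exists_open_fiber_subset (hN : SigmaNowhereDense L K E)
    (hB : SigmaBaire L K E) {B : Set E} (hBd : IsDef L K B) (hBo : IsOpen B) (hBne : B.Nonempty)
    {Y : K → Set (E × F)} (hY : DefFam L K Y) (hc : ∀ r, DComp L K (Y r)) (hm : Monotone Y)
    (hfin : ∀ x ∈ B, {y | (x, y) ∈ ⋃ r, Y r}.Finite) :
    ∃ r, ∃ B' ⊆ B, IsDef L K B' ∧ IsOpen B' ∧ B'.Nonempty ∧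
      ∀ x ∈ B', ∀ y, (x, y) ∈ ⋃ r, Y r → (x, y) ∈ Y r := by
  have hX : IsDSigma L K (⋃ r, Y r) := ⟨Y, hY, hc, hm, rfl⟩
  refine hN.exists_open_subset hB hBd hBo hBne
    (Z := fun r => {x | ∀ y, (x, y) ∈ ⋃ r, Y r → (x, y) ∈ Y r}) ?_ ?_ ?_ ?_
  · refine IsDef.all (.imp (hX.isDef.mem ?_) (hY.mem ?_ ?_)) <;> fun_prop
  · exact fun r s hrs x hx y hy => hm hrs (hx y hy)
  · intro x hx
    have : ∀ y : {y | (x, y) ∈ ⋃ r, Y r}, ∃ r, (x, y.1) ∈ Y r := fun y => mem_iUnion.1 y.2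
    choose g hg using this
    have := (hfin x hx).to_subtype
    obtain ⟨b, hb⟩ := (Set.finite_range g).bddAbove
    exact mem_iUnion.2 ⟨b, fun y hy => hm (hb ⟨⟨y, hy⟩, rfl⟩) (hg ⟨y, hy⟩)⟩
  · intro r
    have : IsDSigma L K {x : E | x ∈ B ∧ ∃ y, (x, y) ∈ (⋃ r, Y r) ∩ (Y r)ᶜ} := by
      refine .and (.of_isOpen hBd hBo) (.ex (hX.inter (.of_isOpen (hc r).isDef.compl
        (hc r).isClosed.isOpen_compl)))
    convert! this using 1
    ext x
    simp

/-- If a `D_Σ` set is dense in a box, its fibers are finite over some open set of base points; after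
shrinking this set, the part of the `D_Σ` set over it is closed, and then contains a box. -/
lemma SigmaNowhereDense.prod (h : ClosedDiscreteFinite L K) (hN : SigmaNowhereDense L K E)
    (hB : SigmaBaire L K E) : SigmaNowhereDense L K (E × K) := by
  intro X hX hi
  by_contra hne
  obtain ⟨p, hp⟩ := nonempty_iff_ne_empty.2 hne
  obtain ⟨ε, hε, hball⟩ := exists_ball_prod (K := K) hp
  have hDσ := hX.intFib h
  have hD := hN _ hDσ (hX.interior_intFib h hB hi)
  let B0 : Set E := {x | d K p.1 x < ε}
  let I : Set K := {y | d K p.2 y < ε}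
  have hB0 : IsOpen B0 := isOpen_ball _ _
  have hI : IsOpen I := isOpen_ball _ _
  have hB0d : IsDef L K B0 := by refine .lt ?_ ?_ <;> fun_prop
  obtain ⟨Y, hY, hc, hm, rfl⟩ := id hX
  obtain ⟨r, B', hB', -, hB'o, hB'ne, hr⟩ := hN.exists_open_fiber_subset hB
    (B := B0 \ closure (intFib K (⋃ r, Y r))) (hB0d.diff hDσ.isDef.closure)
    (hB0.sdiff isClosed_closure)
    (by
      by_contra hne
      rw [not_nonempty_iff_eq_empty, sdiff_eq_empty] at hne
      have : p.1 ∈ interior (closure (intFib K (⋃ r, Y r))) :=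
        interior_maximal hne hB0 (by simpa [B0, d_self])
      rw [hD] at this
      exact this) hY hc hm
    (fun x hx => hX.finite_fiber h fun h => hx.2 (subset_closure h))
  -- Over `B'` the set coincides with the closed set `Y r`, and it is dense in `B' × I`.
  have hsub : B' ×ˢ I ⊆ Y r := by
    intro q hq
    have h1 : q ∈ closure (⋃ r, Y r) := hball q.1 q.2 (hB' hq.1).1 hq.2
    rw [← (hc r).isClosed.closure_eq, mem_closure_iff_nhds]
    intro t ht
    obtain ⟨z, ⟨hzt, hzB⟩, hz⟩ := mem_closure_iff_nhds.1 h1 (t ∩ B' ×ˢ I)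
      (inter_mem ht ((hB'o.prod hI).mem_nhds hq))
    exact ⟨z, hzt, hr z.1 hzB.1 z.2 hz⟩
  have : (interior (⋃ r, Y r)).Nonempty := by
    refine (hB'ne.prod (t := I) ⟨p.2, by simpa [I, d_self]⟩).mono (interior_maximal ?_
      (hB'o.prod hI))
    exact hsub.trans (subset_iUnion Y r)
  rw [hi] at this
  exact not_nonempty_empty this

end Baire

/-! ### Passing to higher powers, and sets without interior -/

section Powers

variable {L : FirstOrder.Language.{u, v}} {K : Type w} [L.Structure K]
  [Field K] [LinearOrder K] [TopologicalSpace K] [IsStrictOrderedRing K] [OrderTopology K]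
  [hE : Fact (ExpandsOrderedField L K)] [hC : Fact (IsDefinablyComplete L K)]
variable {E F G : Type*} [TopologicalSpace E] [TopologicalSpace F] [TopologicalSpace G]
  [DSpace K E] [DSpace K F] [DSpace K G]

section

omit [Field K] [LinearOrder K] [IsStrictOrderedRing K] [OrderTopology K] hE hC

variable (K) in
/-- The homeomorphism `K ^ n × K ≃ K ^ (n + 1)` inserting the last factor as `i`-th coordinate. -/
def insertHomeo {n : ℕ} (i : Fin (n + 1)) : (Fin n → K) × K ≃ₜ (Fin (n + 1) → K) where
  toFun p := i.insertNth p.2 p.1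
  invFun x := (fun j => x (i.succAbove j), x i)
  left_inv p := by simp
  right_inv x := by
    ext j
    refine i.succAboveCases ?_ (fun j => ?_) j <;> simp
  continuous_toFun := by
    refine continuous_pi fun j => ?_
    refine i.succAboveCases ?_ (fun j => ?_) j
    · simpa using continuous_snd
    · simp only [Fin.insertNth_apply_succAbove]; fun_prop
  continuous_invFun := by fun_prop

lemma insertHomeo_apply {n : ℕ} (i : Fin (n + 1)) (p : (Fin n → K) × K) :
    insertHomeo K i p = i.insertNth p.2 p.1 := rfl

@[fun_prop]
lemma defMap_insertHomeo {n : ℕ} (i : Fin (n + 1)) : DefMap L K (insertHomeo K i) := by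
  refine .pi fun j => ?_
  refine i.succAboveCases ?_ (fun j => ?_) j
  · simp only [insertHomeo_apply, Fin.insertNth_apply_same]
    fun_prop
  · simp only [insertHomeo_apply, Fin.insertNth_apply_succAbove]
    fun_prop

@[fun_prop]
lemma defMap_insertHomeo_symm {n : ℕ} (i : Fin (n + 1)) :
    DefMap L K (insertHomeo K i).symm := by
  have : DefMap L K fun x : Fin (n + 1) → K => ((fun j => x (i.succAbove j), x i) : _ × K) := by
    fun_prop
  exact this

end

lemma SigmaBaire.congr (h : SigmaBaire L K E) (e : E ≃ₜ F) (he : DefMap L K e)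
    (he' : DefMap L K e.symm) : SigmaBaire L K F := by
  intro Y hY hc hm hi
  obtain ⟨r, hr⟩ := h (fun r => e ⁻¹' Y r) (by refine hY.mem ?_ ?_ <;> fun_prop)
    (fun r => by
      have := (hc r).image e.symm.continuous.continuousOn he'
      rwa [e.image_symm] at this)
    (fun r s hrs => preimage_mono (hm hrs))
    (by
      rw [← preimage_iUnion, ← e.preimage_interior]
      exact hi.preimage e.surjective)
  rw [← e.preimage_interior] at hr
  obtain ⟨x, hx⟩ := hr
  exact ⟨r, e x, hx⟩

lemma SigmaNowhereDense.congr (h : SigmaNowhereDense L K E) (e : E ≃ₜ F) (he : DefMap L K e) :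
    SigmaNowhereDense L K F := by
  intro X hX hi
  have := h (e ⁻¹' X) (hX.preimage e.continuous he) (by rw [← e.preimage_interior, hi]; rfl)
  rw [← e.preimage_closure, ← e.preimage_interior] at this
  exact (preimage_eq_empty_iff.1 this).eq_bot_of_le (by simp [e.surjective.range_eq])

lemma sigmaBaire_pi (h : ClosedDiscreteFinite L K) (n : ℕ) : SigmaBaire L K (Fin n → K) := by
  induction n with
  | zero =>
    intro Y _ _ _ hi
    obtain ⟨x, hx⟩ := hi
    obtain ⟨r, hr⟩ := mem_iUnion.1 (interior_subset hx)
    refine ⟨r, ?_⟩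
    rw [Subsingleton.eq_univ_of_nonempty ⟨x, hr⟩, interior_univ]
    exact ⟨x, trivial⟩
  | succ n ih =>
    exact (ih.prod h).congr (insertHomeo K (Fin.last n)) (by fun_prop) (by fun_prop)

lemma sigmaNowhereDense_pi (h : ClosedDiscreteFinite L K) (n : ℕ) :
    SigmaNowhereDense L K (Fin n → K) := by
  induction n with
  | zero =>
    intro X _ hi
    rcases X.eq_empty_or_nonempty with rfl | hne
    · simp
    · rw [Subsingleton.eq_univ_of_nonempty hne, interior_univ] at hi
      rw [Subsingleton.eq_univ_of_nonempty hne, closure_univ, interior_univ]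
      exact hi
  | succ n ih =>
    exact (ih.prod h (sigmaBaire_pi h n)).congr (insertHomeo K (Fin.last n)) (by fun_prop)

variable (L K) in
/-- Complements of `D_Σ` subsets of `E` are `D_Σ`. -/
def SigmaCompl (E : Type*) [TopologicalSpace E] [DSpace K E] : Prop :=
  ∀ X : Set E, IsDSigma L K X → IsDSigma L K Xᶜ

variable (L K) in
/-- Every `D_Σ` family of finite subsets of `K` over `E` is uniformly finite. -/
def UniformFiniteness (E : Type*) [TopologicalSpace E] [DSpace K E] : Prop :=
  ∀ C : Set (E × K), IsDSigma L K C → (∀ x, {y | (x, y) ∈ C}.Finite) →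
    ∃ N : ℕ, ∀ x, {y | (x, y) ∈ C}.ncard ≤ N

/-- A `D_Σ` subset of `K ^ m` without interior is a finite union of `D_Σ` sets, each of which is
finite-to-one over the projection that drops one suitable coordinate. -/
lemma IsDSigma.exists_finite_to_one (h : ClosedDiscreteFinite L K) (m : ℕ)
    (hcomp : ∀ k < m, SigmaCompl L K (Fin k → K)) {X : Set (Fin m → K)} (hX : IsDSigma L K X)
    (hi : interior X = ∅) :
    ∃ Z : Fin m → Set (Fin m → K), (∀ i, IsDSigma L K (Z i)) ∧ X = ⋃ i, Z i ∧
      ∀ i (u : Fin m → K), {x | x ∈ Z i ∧ ∀ j, j ≠ i → x j = u j}.Finite := by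
  induction m with
  | zero =>
    refine ⟨fun _ => ∅, fun i => i.elim0, ?_, fun i => i.elim0⟩
    rcases X.eq_empty_or_nonempty with rfl | hne
    · simp
    · rw [Subsingleton.eq_univ_of_nonempty hne, interior_univ] at hi
      rw [Subsingleton.eq_univ_of_nonempty hne, hi]
      simp
  | succ m ih =>
    let e := insertHomeo K (Fin.last m)
    have hX' : IsDSigma L K (e ⁻¹' X) := hX.preimage e.continuous (defMap_insertHomeo _)
    have hi' : interior (e ⁻¹' X) = ∅ := by rw [← e.preimage_interior, hi]; rfl
    obtain ⟨Z, hZ, hZu, hZf⟩ := ih (fun k hk => hcomp k (hk.trans (Nat.lt_succ_self m)))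
      (hX'.intFib h) (hX'.interior_intFib h (sigmaBaire_pi h m) hi')
    have hinit : Continuous fun x : Fin (m + 1) → K => fun j : Fin m => x j.castSucc := by fun_prop
    have hinit' : DefMap L K fun x : Fin (m + 1) → K => fun j : Fin m => x j.castSucc := by
      fun_prop
    have hD := hcomp m (Nat.lt_succ_self m) _ (hX'.intFib h)
    -- Over the complement of `intFib` the last coordinate is dropped; over `intFib` itself, which
    -- has no interior, the decomposition is the one given by induction.
    refine ⟨Fin.lastCases (X ∩ (fun x j => x (Fin.castSucc j)) ⁻¹' (Tame.intFib K (e ⁻¹' X))ᶜ)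
      fun i => X ∩ (fun x j => x (Fin.castSucc j)) ⁻¹' Z i, fun i => ?_, ?_, fun i u => ?_⟩
    · refine Fin.lastCases ?_ (fun i => ?_) i
      · simpa using hX.inter (hD.preimage hinit hinit')
      · simpa using hX.inter ((hZ i).preimage hinit hinit')
    · ext x
      rw [mem_iUnion]
      constructor
      · intro hx
        by_cases hxD : (fun j : Fin m => x j.castSucc) ∈ Tame.intFib K (e ⁻¹' X)
        · rw [hZu, mem_iUnion] at hxD
          obtain ⟨i, hxi⟩ := hxD
          exact ⟨i.castSucc, by simpa using ⟨hx, hxi⟩⟩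
        · exact ⟨Fin.last m, by simpa using ⟨hx, hxD⟩⟩
      · rintro ⟨i, hi⟩
        revert hi
        refine Fin.lastCases ?_ (fun i => ?_) i
        · simp +contextual
        · simp +contextual
    · refine Fin.lastCases ?_ (fun i => ?_) i
      · by_cases hu : (fun j : Fin m => u j.castSucc) ∈ Tame.intFib K (e ⁻¹' X)
        · convert Set.finite_empty
          refine eq_empty_of_forall_notMem fun x hx => ?_
          simp only [Fin.lastCases_last, mem_inter_iff, mem_ofPred_eq] at hx
          refine hx.1.2 ?_
          convert! hu using 1
          ext j
          exact hx.2 _ (Fin.castSucc_lt_last j).ne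
        · refine Set.Finite.of_injOn (f := fun x => x (Fin.last m)) ?_ ?_ (hX'.finite_fiber h hu)
          · intro x hx
            simp only [Fin.lastCases_last, mem_inter_iff, mem_ofPred_eq] at hx
            have : e ((fun j : Fin m => u j.castSucc), x (Fin.last m)) = x := by
              ext j
              refine Fin.lastCases ?_ (fun j => ?_) j
              · simp [e, insertHomeo]
              · simpa [e, insertHomeo] using (hx.2 _ (Fin.castSucc_lt_last j).ne).symm
            show e ((fun j : Fin m => u j.castSucc), x (Fin.last m)) ∈ X
            rw [this]
            exact hx.1.1
          · intro x hx x' hx' heq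
            ext j
            refine Fin.lastCases heq (fun j => ?_) j
            rw [hx.2 _ (Fin.castSucc_lt_last j).ne, hx'.2 _ (Fin.castSucc_lt_last j).ne]
      · refine Set.Finite.of_injOn (f := fun x j => x (Fin.castSucc j)) ?_ ?_
          (hZf i (fun j => u j.castSucc))
        · intro x hx
          simp only [Fin.lastCases_castSucc, mem_inter_iff, mem_ofPred_eq] at hx
          refine ⟨hx.1.2, fun j hj => hx.2 _ ?_⟩
          simpa using hj
        · intro x hx x' hx' heq
          ext j
          refine Fin.lastCases ?_ (fun j => congrFun heq j) j
          rw [hx.2 _ (Fin.castSucc_lt_last i).ne', hx'.2 _ (Fin.castSucc_lt_last i).ne']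

omit hE hC [Field K] [LinearOrder K] [TopologicalSpace K] [IsStrictOrderedRing K]
  [OrderTopology K] [L.Structure K] in
lemma le_ncard_iff {α : Type*} {S : Set α} (hS : S.Finite) (k : ℕ) :
    k ≤ S.ncard ↔ ∃ z : Fin k → α, (∀ i j, i ≠ j → z i ≠ z j) ∧ ∀ i, z i ∈ S := by
  constructor
  · intro hk
    obtain ⟨T, hTS, hT⟩ := Set.exists_subset_card_eq hk
    have hTf := hS.subset hTS
    have hc : Nat.card T = k := hT
    have := hTf.to_subtype
    let e := (Finite.equivFinOfCardEq hc).symm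
    exact ⟨fun i => e i, fun i j hij heq => hij (e.injective (Subtype.ext heq)),
      fun i => hTS (e i).2⟩
  · rintro ⟨z, hz, hzS⟩
    have hinj : Function.Injective z := fun i j hij => by
      by_contra hne
      exact hz i j hne hij
    have h1 : (Set.range z).ncard = k := by
      rw [← image_univ, ncard_image_of_injective _ hinj, ncard_univ, Nat.card_fin]
    rw [← h1]
    exact ncard_le_ncard (range_subset_iff.2 hzS) hS

/-- The tuples of `k` different elements of a common fiber form a `D_Σ` set. -/
lemma IsDSigma.le_ncard {C : Set (E × K)} (hX : IsDSigma L K C) (k : ℕ) :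
    IsDSigma L K {p : E × (Fin k → K) | (∀ i j, i ≠ j → p.2 i ≠ p.2 j) ∧
      ∀ i, (p.1, p.2 i) ∈ C} := by
  refine .and (.of_isOpen ?_ ?_) (.all_finite fun i => hX.mem ?_ ?_)
  · refine .all_finite fun i => .all_finite fun j => .imp (.const _) (.not (.eq ?_ ?_))
      <;> fun_prop
  · simp only [ofPred_forall]
    refine isOpen_iInter_of_finite fun i => isOpen_iInter_of_finite fun j =>
      isOpen_iInter_of_finite fun _ => isOpen_ne_fun (by fun_prop) (by fun_prop)
  · fun_prop
  · fun_prop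

/-- The complement of a uniformly finite `D_Σ` family is `D_Σ`: a point is outside of a fiber of
size `k` if it differs from `k` different elements of the fiber. -/
lemma SigmaCompl.compl_of_finite_fibers (hcomp : SigmaCompl L K E) (hU : UniformFiniteness L K E)
    {C : Set (E × K)} (hX : IsDSigma L K C) (hf : ∀ x, {y | (x, y) ∈ C}.Finite) :
    IsDSigma L K Cᶜ := by
  obtain ⟨N, hN⟩ := hU C hX hf
  have key : ∀ k : ℕ, IsDSigma L K {p : E × K | ¬ (k + 1 ≤ {y | (p.1, y) ∈ C}.ncard) ∧
      ∃ z : Fin k → K, ((∀ i j, i ≠ j → z i ≠ z j) ∧ ∀ i, (p.1, z i) ∈ C) ∧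
        ∀ i, p.2 ≠ z i} := by
    intro k
    refine .and ?_ (.ex (.and ?_ (.of_isOpen ?_ ?_)))
    · have h1 := hcomp _ (IsDSigma.ex (p := fun x (z : Fin (k + 1) → K) =>
        (∀ i j, i ≠ j → z i ≠ z j) ∧ ∀ i, (x, z i) ∈ C) (hX.le_ncard (k + 1)))
      have h2 := h1.preimage (f := (Prod.fst : E × K → E)) continuous_fst DefMap.fst
      convert! h2 using 1
      ext p
      rw [mem_ofPred_eq, le_ncard_iff (hf p.1)]
      rfl
    · exact (hX.le_ncard k).mem (f := fun q : (E × K) × (Fin k → K) => (q.1.1, q.2))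
        (by fun_prop) (by fun_prop)
    · refine .all_finite fun i => .not (.eq ?_ ?_) <;> fun_prop
    · simp only [ofPred_forall]
      exact isOpen_iInter_of_finite fun i => isOpen_ne_fun (by fun_prop) (by fun_prop)
  convert! IsDSigma.iUnion_finite fun k : Fin (N + 1) => key k using 1
  ext ⟨x, y⟩
  simp only [mem_compl_iff, mem_iUnion, mem_ofPred_eq]
  constructor
  · intro hy
    refine ⟨⟨_, Nat.lt_succ_of_le (hN x)⟩, by simp, ?_⟩
    obtain ⟨z, hz, hzC⟩ := (le_ncard_iff (hf x) _).1 le_rfl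
    exact ⟨z, ⟨hz, hzC⟩, fun i hi => hy (hi ▸ hzC i)⟩
  · rintro ⟨k, hk, z, ⟨hz, hzC⟩, hyz⟩ hy
    refine hk ((le_ncard_iff (hf x) _).2 ⟨Fin.cons y z, fun i j => ?_, fun i => ?_⟩)
    · refine Fin.cases ?_ (fun i => ?_) i <;> refine Fin.cases ?_ (fun j => ?_) j
      · simp
      · simpa using fun _ => hyz j
      · simpa using (hyz i).symm
      · simpa using hz i j
    · refine Fin.cases ?_ (fun i => ?_) i
      · simpa using hy
      · simpa using hzC i

/-- The set `X \ interior X` has no interior, so it is a finite union of sets that are finite-to-one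
over `K ^ n`; the complements of these are `D_Σ` by uniform finiteness. -/
lemma SigmaCompl.succ (h : ClosedDiscreteFinite L K) {n : ℕ}
    (hcomp : ∀ k ≤ n, SigmaCompl L K (Fin k → K)) (hU : UniformFiniteness L K (Fin n → K)) :
    SigmaCompl L K (Fin (n + 1) → K) := by
  intro X hX
  let T := X \ interior X
  have hT : IsDSigma L K T := hX.inter
    (.of_isClosed hX.isDef.interior.compl isOpen_interior.isClosed_compl)
  have hTi : interior T = ∅ := subset_empty_iff.1 fun x hx =>
    (interior_subset hx).2 (interior_mono sdiff_subset hx)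
  have hTc : IsDSigma L K Tᶜ := by
    obtain ⟨Z, hZ, hZu, hZf⟩ := hT.exists_finite_to_one h (n + 1)
      (fun k hk => hcomp k (Nat.le_of_lt_succ hk)) hTi
    rw [hZu, compl_iUnion]
    refine .iInter_finite fun i => ?_
    let e := insertHomeo K i
    have h1 : IsDSigma L K (e ⁻¹' Z i)ᶜ := by
      refine (hcomp n le_rfl).compl_of_finite_fibers hU
        ((hZ i).preimage e.continuous (defMap_insertHomeo i)) fun u => ?_
      refine Set.Finite.of_injOn (f := fun s => e (u, s)) ?_ ?_ (hZf i (e (u, 0)))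
      · intro s hs
        refine ⟨hs, fun j hj => ?_⟩
        obtain ⟨j, rfl⟩ := Fin.exists_succAbove_eq hj
        simp [e, insertHomeo]
      · intro s _ s' _ heq
        exact (Prod.ext_iff.1 (e.injective heq)).2
    have h2 := h1.preimage e.symm.continuous (defMap_insertHomeo_symm i)
    convert! h2 using 1
    ext x
    simp
  have : Xᶜ = (closure X)ᶜ ∪ ((closure X \ interior X) ∩ Tᶜ) := by
    ext x
    have h1 := @subset_closure _ _ X x
    have h2 := @interior_subset _ _ X x
    simp only [mem_compl_iff, mem_union, mem_inter_iff, Set.mem_sdiff, T]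
    tauto
  rw [this]
  exact (IsDSigma.of_isOpen hX.isDef.closure.compl isClosed_closure.isOpen_compl).union
    ((IsDSigma.of_isClosed (hX.isDef.closure.diff hX.isDef.interior)
      (isClosed_closure.sdiff isOpen_interior)).inter hTc)

end Powers

/-! ### Uniform finiteness and the theorem of the complement -/

section Uniform

variable {L : FirstOrder.Language.{u, v}} {K : Type w} [L.Structure K]
  [Field K] [LinearOrder K] [TopologicalSpace K] [IsStrictOrderedRing K] [OrderTopology K]
  [hE : Fact (ExpandsOrderedField L K)] [hC : Fact (IsDefinablyComplete L K)]
variable {E F G : Type*} [TopologicalSpace E] [TopologicalSpace F] [TopologicalSpace G]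
  [DSpace K E] [DSpace K F] [DSpace K G]

/-- The cardinality of the fibers of a definable family of finite sets is a definable function of
the parameter. -/
lemma isDef_le_ncard {C : Set (E × K)} (hX : IsDef L K C) (hf : ∀ x, {y | (x, y) ∈ C}.Finite)
    (k : ℕ) : IsDef L K {x : E | k ≤ {y | (x, y) ∈ C}.ncard} := by
  have : IsDef L K {x : E | ∃ z : Fin k → K, (∀ i j, i ≠ j → z i ≠ z j) ∧
      ∀ i, (x, z i) ∈ C} := by
    refine .ex (.and (.all_finite fun i => .all_finite fun j =>
      .imp (.const _) (.not (.eq ?_ ?_))) (.all_finite fun i => hX.mem ?_)) <;> fun_prop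
  convert! this using 1
  ext x
  exact le_ncard_iff (hf x) k

/-- Being closer than `η` defines a bijection between `A` and `B`. -/
def Matched (η : K) (A B : Set K) : Prop :=
  (∀ a, a ∈ A → ∃ b, b ∈ B ∧ |a - b| < η) ∧ (∀ b, b ∈ B → ∃ a, a ∈ A ∧ |a - b| < η) ∧
    (∀ a, a ∈ A → ∀ a', a' ∈ A → ∀ b, b ∈ B → |a - b| < η → |a' - b| < η → a = a') ∧
    (∀ a, a ∈ A → ∀ b, b ∈ B → ∀ b', b' ∈ B → |a - b| < η → |a - b'| < η → b = b')

omit hE hC [TopologicalSpace K] [OrderTopology K] [IsStrictOrderedRing K] in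
lemma Matched.ncard_eq {η : K} {A B : Set K} (h : Matched η A B) (hA : A.Finite)
    (hB : B.Finite) : A.ncard = B.ncard := by
  obtain ⟨h1, h2, h3, h4⟩ := h
  choose! f hf hf' using h1
  choose! g hg hg' using h2
  refine le_antisymm (ncard_le_ncard_of_injOn f hf (fun a ha a' ha' heq => ?_) hB)
    (ncard_le_ncard_of_injOn g hg (fun b hb b' hb' heq => ?_) hA)
  · exact h3 a ha a' ha' (f a) (hf a ha) (hf' a ha) (heq ▸ hf' a' ha')
  · exact h4 (g b) (hg b hb) b hb b' hb' (hg' b hb) (heq ▸ hg' b' hb')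

variable (K) in
/-- The points `x` of the base for which there is `η` such that the fiber of `C` at `x` is matched,
at distance `η`, with the fibers at all points near `x`. -/
def matchedSet (C : Set (E × K)) : Set E :=
  {x | ∃ δ : K, 0 < δ ∧ ∃ η : K, ∀ x', d K x x' < δ →
    Matched η {y | (x, y) ∈ C} {y | (x', y) ∈ C}}

lemma isDef_matchedSet {C : Set (E × K)} (hX : IsDef L K C) : IsDef L K (matchedSet K C) := by
  unfold matchedSet Matched
  refine .ex (.and (.lt ?_ ?_) (.ex (.all (.imp (.lt ?_ ?_) (.and ?_ (.and ?_ (.and ?_ ?_)))))))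
  · fun_prop
  · fun_prop
  · fun_prop
  · fun_prop
  · refine .all (.imp (hX.mem ?_) (.ex (.and (hX.mem ?_) (.lt ?_ ?_)))) <;> fun_prop
  · refine .all (.imp (hX.mem ?_) (.ex (.and (hX.mem ?_) (.lt ?_ ?_)))) <;> fun_prop
  · refine .all (.imp (hX.mem ?_) (.all (.imp (hX.mem ?_) (.all (.imp (hX.mem ?_)
      (.imp (.lt ?_ ?_) (.imp (.lt ?_ ?_) (.eq ?_ ?_)))))))) <;> fun_prop
  · refine .all (.imp (hX.mem ?_) (.all (.imp (hX.mem ?_) (.all (.imp (hX.mem ?_)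
      (.imp (.lt ?_ ?_) (.imp (.lt ?_ ?_) (.eq ?_ ?_)))))))) <;> fun_prop

lemma eventually_ncard_eq {C : Set (E × K)} (hf : ∀ x, {y | (x, y) ∈ C}.Finite) {x : E}
    (hx : x ∈ matchedSet K C) :
    ∀ᶠ x' in 𝓝 x, {y | (x', y) ∈ C}.ncard = {y | (x, y) ∈ C}.ncard := by
  obtain ⟨δ, hδ, η, h⟩ := hx
  exact (mem_nhds_iff_d (K := K)).2 ⟨δ, hδ, fun x' hx' => ((h x' hx').ncard_eq (hf _) (hf _)).symm⟩

/-- The fibers of a `D_Σ` family of finite sets are locally matched at all points of a dense open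
set: over a small open set the family is closed and its fibers are uniformly separated, so the
size of the fibers is upper semicontinuous, and it is locally constant where it is minimal. -/
lemma SigmaNowhereDense.interior_compl_matchedSet (hN : SigmaNowhereDense L K E)
    (hB : SigmaBaire L K E) {C : Set (E × K)} (hX : IsDSigma L K C)
    (hf : ∀ x, {y | (x, y) ∈ C}.Finite) : interior (interior (matchedSet K C))ᶜ = ∅ := by
  by_contra hne
  obtain ⟨Y, hY, hc, hm, hCY⟩ := id hX
  obtain ⟨s, B1, hB1, hB1d, hB1o, hB1ne, hs⟩ := hN.exists_open_fiber_subset hB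
    (isDef_matchedSet hX.isDef).interior.compl.interior isOpen_interior
    (nonempty_iff_ne_empty.2 hne) hY hc hm (fun x _ => hCY ▸ hf x)
  rw [← hCY] at hs
  -- The base points at which different elements of the fiber are at distance at least `1 / r`.
  let Z : K → Set E := fun r => {x | ∀ y, (x, y) ∈ C → ∀ y', (x, y') ∈ C → y ≠ y' →
    1 ≤ r * |y - y'|}
  have hZ : DefFam L K Z := by
    refine IsDef.all (.imp (hX.isDef.mem ?_) (.all (.imp (hX.isDef.mem ?_)
      (.imp (.not (.eq ?_ ?_)) (.le ?_ ?_))))) <;> fun_prop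
  have hZm : Monotone Z := fun r s hrs x hx y hy y' hy' hne =>
    (hx y hy y' hy' hne).trans (mul_le_mul_of_nonneg_right hrs (abs_nonneg _))
  obtain ⟨r, B2, hB21, hB2d, hB2o, hB2ne, hr⟩ := hN.exists_open_subset hB hB1d hB1o hB1ne hZ hZm
    (by
      intro x _
      obtain ⟨b, hb⟩ := (((hf x).prod (hf x)).image fun p => |p.1 - p.2|⁻¹).bddAbove
      refine mem_iUnion.2 ⟨b, fun y hy y' hy' hne => ?_⟩
      have h1 : 0 < |y - y'| := abs_pos.2 (sub_ne_zero.2 hne)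
      have h2 : |y - y'|⁻¹ ≤ b := hb ⟨(y, y'), ⟨hy, hy'⟩, rfl⟩
      calc (1 : K) = |y - y'|⁻¹ * |y - y'| := (inv_mul_cancel₀ h1.ne').symm
        _ ≤ _ := mul_le_mul_of_nonneg_right h2 h1.le)
    (by
      intro r
      have : IsDSigma L K {x : E | x ∈ B1 ∧ ∃ p : K × K, (x, p.1) ∈ C ∧ (x, p.2) ∈ C ∧
          p.1 ≠ p.2 ∧ r * |p.1 - p.2| < 1} := by
        refine .and (.of_isOpen hB1d hB1o) (.ex (.and (hX.mem ?_ ?_) (.and (hX.mem ?_ ?_)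
          (.and (.of_isOpen ?_ ?_) (.of_isOpen ?_ ?_)))))
        · fun_prop
        · fun_prop
        · fun_prop
        · fun_prop
        · refine .not (.eq ?_ ?_) <;> fun_prop
        · exact isOpen_ne_fun (by fun_prop) (by fun_prop)
        · refine .lt ?_ ?_ <;> fun_prop
        · exact isOpen_lt (by fun_prop) (by fun_prop)
      convert! this using 1
      ext x
      simp only [Z, Set.mem_sdiff, mem_ofPred_eq, not_forall, not_le, exists_prop, Prod.exists]
      constructor
      · rintro ⟨hx, y, hy, y', hy', hne, h⟩
        exact ⟨hx, y, y', hy, hy', hne, h⟩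
      · rintro ⟨hx, y, y', hy, hy', hne, h⟩
        exact ⟨hx, y, hy, y', hy', hne, h⟩)
  have hgap : ∃ η : K, 0 < η ∧ ∀ x ∈ B2, ∀ y, (x, y) ∈ C → ∀ y', (x, y') ∈ C →
      |y - y'| < 2 * η → y = y' := by
    have hpos : (0 : K) < max r 1 := lt_max_of_lt_right one_pos
    refine ⟨(max r 1)⁻¹ / 2, by positivity, fun x hx y hy y' hy' h => ?_⟩
    by_contra hne
    have h1 := hZm (le_max_left r 1) (hr hx) y hy y' hy' hne
    have h2 := (inv_le_iff_one_le_mul₀' hpos).2 h1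
    linarith
  obtain ⟨η, hη, hgap⟩ := hgap
  -- Near `x` every element of a fiber is close to exactly one element of the fiber over `x`; where
  -- the size is minimal this injection is a bijection.
  obtain ⟨k, ⟨x0, hx0, hk⟩, hmin⟩ := WellFounded.has_min Nat.lt_wfRel.wf
    ((fun x => {y | (x, y) ∈ C}.ncard) '' B2) (hB2ne.image _)
  have hmin' : ∀ x ∈ B2, k ≤ {y | (x, y) ∈ C}.ncard := fun x hx =>
    not_lt.1 (hmin _ ⟨x, hx, rfl⟩)
  have key : ∀ x ∈ B2, {y | (x, y) ∈ C}.ncard = k → ∃ δ : K, 0 < δ ∧ ∀ x', d K x x' < δ →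
      x' ∈ B2 ∧ Matched η {y | (x, y) ∈ C} {y | (x', y) ∈ C} := by
    intro x hx hxk
    -- The part of the closed set `Y s` which is far from all elements of the fiber over `x`: its
    -- projection is closed and does not contain `x`.
    let bad : Set (E × K) := Y s ∩ {p | ∀ y, (x, y) ∈ C → η ≤ |y - p.2|}
    have hbad : DComp L K bad := by
      refine (hc s).subset ((hc s).isClosed.inter ?_) ((hc s).isDef.inter ?_) inter_subset_left
      · simp only [ofPred_forall]
        exact isClosed_iInter fun y => isClosed_iInter fun _ =>
          isClosed_le (by fun_prop) (by fun_prop)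
      · refine .all (.imp (hX.isDef.mem ?_) (.le ?_ ?_)) <;> fun_prop
    have hV : IsOpen (B2 ∩ (Prod.fst '' bad)ᶜ) :=
      hB2o.inter (hbad.image continuous_fst.continuousOn DefMap.fst).isClosed.isOpen_compl
    have hxV : x ∈ B2 ∩ (Prod.fst '' bad)ᶜ := by
      refine ⟨hx, ?_⟩
      rintro ⟨⟨x, y⟩, ⟨hxy, hy⟩, rfl⟩
      have h1 : (x, y) ∈ C := hCY ▸ mem_iUnion.2 ⟨s, hxy⟩
      have h2 := hy y h1
      simp only [sub_self, abs_zero] at h2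
      linarith
    obtain ⟨δ, hδ, hsub⟩ := (isOpen_iff_d (K := K)).1 hV x hxV
    refine ⟨δ, hδ, fun x' hx' => ⟨(hsub x' hx').1, ?_⟩⟩
    obtain ⟨hx'B, hx'b⟩ := hsub x' hx'
    have hnear : ∀ b, b ∈ {y | (x', y) ∈ C} → ∃ a, a ∈ {y | (x, y) ∈ C} ∧ |a - b| < η := by
      intro b hb
      by_contra! hcon
      exact hx'b ⟨(x', b), ⟨hs x' (hB21 hx'B) b hb, hcon⟩, rfl⟩
    have huniq : ∀ b b' : K, (x', b) ∈ C → (x', b') ∈ C → ∀ a : K, |a - b| < η → |a - b'| < η →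
        b = b' := by
      intro b b' hb hb' a h1 h2
      refine hgap x' hx'B b hb b' hb' ?_
      have := abs_sub_le b a b'
      rw [abs_sub_comm b a] at this
      linarith
    refine ⟨?_, hnear, ?_, fun a _ b hb b' hb' h1 h2 => huniq b b' hb hb' a h1 h2⟩
    · choose! f hfm hfd using hnear
      have hinj : InjOn f {y | (x', y) ∈ C} := fun b hb b' hb' heq =>
        huniq b b' hb hb' (f b) (hfd b hb) (heq ▸ hfd b' hb')
      have himg : f '' {y | (x', y) ∈ C} = {y | (x, y) ∈ C} := by
        refine Set.eq_of_subset_of_ncard_le (image_subset_iff.2 hfm) ?_ (hf x)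
        rw [hinj.ncard_image, hxk]
        exact hmin' x' hx'B
      intro a ha
      rw [← himg] at ha
      obtain ⟨b, hb, rfl⟩ := ha
      exact ⟨b, hb, hfd b hb⟩
    · intro a ha a' ha' b _ h1 h2
      refine hgap x hx a ha a' ha' ?_
      have := abs_sub_le a b a'
      rw [abs_sub_comm b a'] at this
      linarith
  obtain ⟨δ, hδ, h0⟩ := key x0 hx0 hk
  have hx0G : x0 ∈ interior (matchedSet K C) := by
    refine (mem_interior_iff_d (K := K)).2 ⟨δ, hδ, fun x hx => ?_⟩
    obtain ⟨hxB, hmx⟩ := h0 x hx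
    obtain ⟨δ', hδ', h1⟩ := key x hxB ((hmx.ncard_eq (hf _) (hf _)).symm.trans hk)
    exact ⟨δ', hδ', η, fun x' hx' => (h1 x' hx').2⟩
  exact interior_subset (hB1 (hB21 hx0)) hx0G

/-- A bound for the sizes of the fibers of `C` over a subset of the base without interior: such a
set is covered by finitely many sets that are finite-to-one over `K ^ n`, and the fibers of `C` over
the points of one of them with the same projection combine to a finite set. -/
lemma UniformFiniteness.exists_bound_of_interior_eq_empty (h : ClosedDiscreteFinite L K) {n : ℕ}
    (hcomp : ∀ k ≤ n, SigmaCompl L K (Fin k → K)) (hU : UniformFiniteness L K (Fin n → K))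
    {C : Set ((Fin (n + 1) → K) × K)} (hX : IsDSigma L K C)
    (hf : ∀ x, {y | (x, y) ∈ C}.Finite) {S : Set (Fin (n + 1) → K)} (hS : IsDSigma L K S)
    (hSi : interior S = ∅) : ∃ N : ℕ, ∀ x ∈ S, {y | (x, y) ∈ C}.ncard ≤ N := by
  obtain ⟨Z, hZ, hZu, hZf⟩ := hS.exists_finite_to_one h (n + 1)
    (fun k hk => hcomp k (Nat.le_of_lt_succ hk)) hSi
  have key : ∀ i, ∃ N : ℕ, ∀ x ∈ Z i, {y | (x, y) ∈ C}.ncard ≤ N := by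
    intro i
    let e := insertHomeo K i
    have he := defMap_insertHomeo (L := L) (K := K) i
    have hec := e.continuous
    let C' : Set ((Fin n → K) × K) := {p | ∃ s, e (p.1, s) ∈ Z i ∧ (e (p.1, s), p.2) ∈ C}
    have hC' : IsDSigma L K C' := by
      refine IsDSigma.ex (.and ((hZ i).mem ?_ ?_) (hX.mem ?_ ?_)) <;> fun_prop
    have hfib : ∀ u, {s | e (u, s) ∈ Z i}.Finite := by
      intro u
      refine Set.Finite.of_injOn (f := fun s => e (u, s)) ?_ ?_ (hZf i (e (u, 0)))
      · intro s hs
        refine ⟨hs, fun j hj => ?_⟩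
        obtain ⟨j, rfl⟩ := Fin.exists_succAbove_eq hj
        simp [e, insertHomeo_apply]
      · intro s _ s' _ heq
        exact (Prod.ext_iff.1 (e.injective heq)).2
    have hC'f : ∀ u, {y | (u, y) ∈ C'}.Finite := by
      intro u
      refine ((hfib u).biUnion fun s _ => hf (e (u, s))).subset ?_
      rintro y ⟨s, hs, hy⟩
      exact mem_biUnion hs hy
    obtain ⟨N, hN⟩ := hU C' hC' hC'f
    refine ⟨N, fun x hx => (ncard_le_ncard ?_ (hC'f (e.symm x).1)).trans (hN _)⟩
    intro y hy
    refine ⟨(e.symm x).2, ?_, ?_⟩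
    · simpa using hx
    · simpa using hy
  choose N hN using key
  refine ⟨∑ i, N i, fun x hx => ?_⟩
  rw [hZu, mem_iUnion] at hx
  obtain ⟨i, hi⟩ := hx
  exact (hN i x hi).trans (Finset.single_le_sum (fun _ _ => Nat.zero_le _) (Finset.mem_univ i))

variable (K) in
/-- For `σ = 1`, the set of those `(x, c)` for which `G` contains, for some `ρ > 0`, the segment
`{x} × [c, c + ρ]`, but not the segment `{x} × [c - ρ, c]`; for `σ = -1` the roles of the two
segments are exchanged. -/
def unbalanced (σ : K) (G : Set (E × K)) : Set (E × K) :=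
  {p | ∃ ρ, 0 < ρ ∧ (∀ t ∈ Icc (0 : K) 1, (p.1, p.2 + σ * (t * ρ)) ∈ G) ∧
    ∃ t ∈ Icc (0 : K) 1, (p.1, p.2 - σ * (t * ρ)) ∉ G}

lemma IsDSigma.unbalanced {G : Set (E × K)} (hGd : IsDef L K G) (hG : IsOpen G) (σ : K) :
    IsDSigma L K (unbalanced K σ G) := by
  have h1 : IsDef L K {q : ((E × K) × K) × K | (q.1.1.1, q.1.1.2 + σ * (q.2 * q.1.2)) ∈ G} :=
    hGd.mem (by fun_prop)
  have h2 : IsDef L K {q : ((E × K) × K) × K | (q.1.1.1, q.1.1.2 - σ * (q.2 * q.1.2)) ∈ Gᶜ} :=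
    hGd.compl.mem (by fun_prop)
  have hI : IsDef L K {q : ((E × K) × K) × K | q.2 ∈ Icc (0 : K) 1} :=
    (DComp.Icc 0 1).isDef.mem (by fun_prop)
  refine .ex (.and (.of_isOpen ?_ ?_) (.and (.of_isOpen ?_ ?_) (.of_isClosed ?_ ?_)))
  · refine .lt ?_ ?_ <;> fun_prop
  · exact isOpen_lt (by fun_prop) (by fun_prop)
  · exact .all (.imp hI h1)
  · exact (DComp.Icc 0 1).isOpen_forall (hG.preimage (by fun_prop)) h1
  · exact .ex (.and hI h2)
  · exact (DComp.Icc 0 1).isClosed_proj (hG.isClosed_compl.preimage (by fun_prop)) h2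

/-- A point `c` of the fiber of `G` over `x` is balanced if the fiber extends equally far to both
sides of `c`. For open `G` with bounded fibers, the balanced points are the midpoints of the
components of the fibers. -/
lemma mem_balanced_iff {G : Set (E × K)} {x : E} {c : K} :
    (x, c) ∉ unbalanced K 1 G ∪ unbalanced K (-1) G ↔
      ∀ ρ, 0 < ρ → ((∀ z ∈ Icc c (c + ρ), (x, z) ∈ G) ↔ ∀ z ∈ Icc (c - ρ) c, (x, z) ∈ G) := by
  have h1 : ∀ ρ : K, 0 < ρ → ((∀ t ∈ Icc (0 : K) 1, (x, c + t * ρ) ∈ G) ↔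
      ∀ z ∈ Icc c (c + ρ), (x, z) ∈ G) := by
    intro ρ hρ
    constructor
    · intro h z hz
      have := h ((z - c) / ρ) ⟨div_nonneg (by linarith [hz.1]) hρ.le,
        (div_le_one hρ).2 (by linarith [hz.2])⟩
      rwa [div_mul_cancel₀ _ hρ.ne', add_sub_cancel] at this
    · intro h t ht
      refine h _ ⟨?_, ?_⟩
      · linarith [mul_nonneg ht.1 hρ.le]
      · linarith [mul_le_mul_of_nonneg_right ht.2 hρ.le]
  have h2 : ∀ ρ : K, 0 < ρ → ((∀ t ∈ Icc (0 : K) 1, (x, c - t * ρ) ∈ G) ↔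
      ∀ z ∈ Icc (c - ρ) c, (x, z) ∈ G) := by
    intro ρ hρ
    constructor
    · intro h z hz
      have := h ((c - z) / ρ) ⟨div_nonneg (by linarith [hz.2]) hρ.le,
        (div_le_one hρ).2 (by linarith [hz.1])⟩
      rwa [div_mul_cancel₀ _ hρ.ne', sub_sub_cancel] at this
    · intro h t ht
      refine h _ ⟨?_, ?_⟩
      · linarith [mul_le_mul_of_nonneg_right ht.2 hρ.le]
      · linarith [mul_nonneg ht.1 hρ.le]
  simp only [unbalanced, mem_union, mem_ofPred_eq, not_or, not_exists, not_and, one_mul, neg_mul,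
    sub_neg_eq_add, ← sub_eq_add_neg, not_not]
  constructor
  · rintro ⟨h3, h4⟩ ρ hρ
    rw [← h1 ρ hρ, ← h2 ρ hρ]
    exact ⟨h3 ρ hρ, h4 ρ hρ⟩
  · intro h3
    refine ⟨fun ρ hρ h4 => ?_, fun ρ hρ h4 => ?_⟩
    · exact (h2 ρ hρ).2 ((h3 ρ hρ).1 ((h1 ρ hρ).1 h4))
    · exact (h1 ρ hρ).2 ((h3 ρ hρ).2 ((h2 ρ hρ).1 h4))

/-- A bound for the sizes of the fibers of `C` over an open set `G` on which these sizes are locally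
constant: by `exists_mem_frontier` the size is constant on the components of the one-dimensional
fibers of `G`, so it suffices to bound it at their midpoints, of which there are finitely many over
each `x`. -/
lemma UniformFiniteness.exists_bound_of_isOpen (h : ClosedDiscreteFinite L K)
    (hU : UniformFiniteness L K E) (hcomp : SigmaCompl L K (E × K)) {G : Set (E × K)}
    (hGd : IsDef L K G) (hGo : IsOpen G) (hGb : ∀ p ∈ G, |p.2| < 1) {C : Set ((E × K) × K)}
    (hX : IsDSigma L K C) (hf : ∀ x, {y | (x, y) ∈ C}.Finite)
    (hloc : ∀ p ∈ G, ∀ᶠ q in 𝓝 p, {y | (q, y) ∈ C}.ncard = {y | (p, y) ∈ C}.ncard) :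
    ∃ N : ℕ, ∀ p ∈ G, {y | (p, y) ∈ C}.ncard ≤ N := by
  let M : Set (E × K) := G ∩ (unbalanced K 1 G ∪ unbalanced K (-1) G)ᶜ
  have hM : IsDSigma L K M := (IsDSigma.of_isOpen hGd hGo).inter
    (hcomp _ ((IsDSigma.unbalanced hGd hGo 1).union (IsDSigma.unbalanced hGd hGo (-1))))
  have hGx : ∀ x, IsOpen {t | (x, t) ∈ G} := fun x => hGo.preimage (by fun_prop)
  have hsep : ∀ x c c', (x, c) ∈ M → (x, c') ∈ M → c < c' → (∀ z ∈ Icc c c', (x, z) ∈ G) →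
      False := by
    intro x c c' hc hc' hlt hI
    have hcM := mem_balanced_iff.1 hc.2
    have hc'M := mem_balanced_iff.1 hc'.2
    -- Let `σ` be the supremum of the lengths by which the fiber extends beyond `c'`.  Reflecting at
    -- the balanced points `c` and `c'` extends it by another `2 * (c' - c)`, up to a small error.
    let T : Set K := {ρ | 0 < ρ ∧ ∀ z, c' ≤ z ∧ z ≤ c' + ρ → (x, z) ∈ G}
    have hT : IsDef L K T := by
      refine IsDef.and (.lt ?_ ?_) (.all (.imp (.and (.le ?_ ?_) (.le ?_ ?_)) (hGd.mem ?_)))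
        <;> fun_prop
    have hTne : T.Nonempty := by
      obtain ⟨z, hz, hzG⟩ := exists_Icc_subset ((hGx x).interior_eq.symm ▸ hc'.1 :
        c' ∈ interior {t | (x, t) ∈ G})
      refine ⟨z - c', sub_pos.2 hz, fun w hw => hzG ⟨hw.1, by linarith [hw.2]⟩⟩
    have hTb : BddAbove T := by
      refine ⟨2, fun ρ hρ => ?_⟩
      have h1 := (abs_lt.1 (hGb _ (hρ.2 (c' + ρ) ⟨by linarith [hρ.1], le_rfl⟩))).2
      have h2 := (abs_lt.1 (hGb _ hc'.1)).1
      simp only at h1 h2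
      linarith
    obtain ⟨σ, hσ⟩ := exists_isLUB hT hTne hTb
    obtain ⟨ρ, hρ, hσρ⟩ := (lt_isLUB_iff hσ).1 (sub_lt_self σ (sub_pos.2 hlt))
    have h1 : ∀ z ∈ Icc c (c + (ρ + (c' - c))), (x, z) ∈ G := by
      intro z hz
      rcases le_total z c' with hzc | hzc
      · exact hI z ⟨hz.1, hzc⟩
      · exact hρ.2 z ⟨hzc, by linarith [hz.2]⟩
    have h2 := (hcM _ (by linarith [hρ.1])).1 h1
    have h3 : ∀ z ∈ Icc (c' - (ρ + 2 * (c' - c))) c', (x, z) ∈ G := by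
      intro z hz
      rcases le_total z c with hzc | hzc
      · exact h2 z ⟨by linarith [hz.1], hzc⟩
      · exact hI z ⟨hzc, hz.2⟩
    have h4 := (hc'M _ (by linarith [hρ.1])).2 h3
    have h5 : ρ + 2 * (c' - c) ∈ T := ⟨by linarith [hρ.1], h4⟩
    linarith [hσ.1 h5]
  have hMfin : ∀ x, {c | (x, c) ∈ M}.Finite := by
    intro x
    refine h.finite (hM.isDef.fiber x) ((isDiscrete_iff_d (K := K)).2 fun c hc => ?_)
    obtain ⟨ε, hε, hball⟩ := (isOpen_iff_d (K := K)).1 (hGx x) c hc.1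
    refine ⟨ε, hε, fun c' hc' hd => ?_⟩
    have hd' := hd
    rw [d_eq_abs, abs_sub_lt_iff] at hd'
    have hG' : ∀ z, (c ≤ z ∧ z ≤ c') ∨ (c' ≤ z ∧ z ≤ c) → (x, z) ∈ G := by
      intro z hz
      refine hball z ?_
      rw [d_eq_abs, abs_sub_lt_iff]
      rcases hz with hz | hz <;> constructor <;> linarith [hz.1, hz.2]
    rcases lt_trichotomy c' c with hlt | heq | hlt
    · exact (hsep x c' c hc' hc hlt fun z hz => hG' z (Or.inr hz)).elim
    · exact heq
    · exact (hsep x c c' hc hc' hlt fun z hz => hG' z (Or.inl hz)).elim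
  have hmeet : ∀ x c0, (x, c0) ∈ G → ∃ c, (x, c) ∈ M ∧ ∀ z ∈ uIcc c0 c, (x, z) ∈ G := by
    intro x c0 hc0
    have hcl : IsClosed {t | (x, t) ∉ G} := (hGx x).isClosed_compl
    have hd : IsDef L K {t | (x, t) ∉ G} := hGd.compl.fiber x
    have hb := abs_lt.1 (hGb _ hc0)
    simp only at hb
    have hout : ∀ t : K, 1 ≤ |t| → (x, t) ∉ G := fun t ht hG => not_lt.2 ht (hGb _ hG)
    -- `(a, b)` is the component of `c0` in the fiber.
    obtain ⟨a, ha⟩ := exists_isLUB (hd.inter (show IsDef L K (Iic c0) by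
      refine .le ?_ ?_ <;> fun_prop)) ⟨-1, hout _ (by simp), hb.1.le⟩ ⟨c0, fun z hz => hz.2⟩
    obtain ⟨b, hb'⟩ := exists_isGLB (hd.inter (show IsDef L K (Ici c0) by
      refine .le ?_ ?_ <;> fun_prop)) ⟨1, hout _ (by simp), hb.2.le⟩ ⟨c0, fun z hz => hz.2⟩
    have haG := (hcl.inter isClosed_Iic).closure_subset
      (ha.mem_closure ⟨-1, hout _ (by simp), hb.1.le⟩)
    have hbG := (hcl.inter isClosed_Ici).closure_subset
      (hb'.mem_closure ⟨1, hout _ (by simp), hb.2.le⟩)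
    have hac : a < c0 := lt_of_le_of_ne haG.2 (by rintro rfl; exact haG.1 hc0)
    have hcb : c0 < b := lt_of_le_of_ne hbG.2 (by rintro rfl; exact hbG.1 hc0)
    have hIn : ∀ z, a < z → z < b → (x, z) ∈ G := by
      intro z hz1 hz2
      by_contra hz
      rcases le_total z c0 with hzc | hzc
      · linarith [ha.1 ⟨hz, hzc⟩]
      · linarith [hb'.1 ⟨hz, hzc⟩]
    refine ⟨(a + b) / 2, ⟨hIn _ (by linarith) (by linarith), mem_balanced_iff.2 fun ρ hρ => ?_⟩,
      fun z hz => ?_⟩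
    · constructor
      · intro hR
        have : (a + b) / 2 + ρ < b := by
          by_contra! hle
          exact hbG.1 (hR b ⟨by linarith, hle⟩)
        exact fun z hz => hIn z (by linarith [hz.1]) (by linarith [hz.2])
      · intro hR
        have : a < (a + b) / 2 - ρ := by
          by_contra! hle
          exact haG.1 (hR a ⟨hle, by linarith⟩)
        exact fun z hz => hIn z (by linarith [hz.1]) (by linarith [hz.2])
    · rcases mem_uIcc.1 hz with hz | hz <;>
        exact hIn z (by linarith [hz.1]) (by linarith [hz.2])
  let C' : Set (E × K) := {p | ∃ c, (p.1, c) ∈ M ∧ ((p.1, c), p.2) ∈ C}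
  have hC' : IsDSigma L K C' := by
    refine IsDSigma.ex (.and (hM.mem ?_ ?_) (hX.mem ?_ ?_)) <;> fun_prop
  have hC'f : ∀ x, {y | (x, y) ∈ C'}.Finite := by
    intro x
    refine ((hMfin x).biUnion fun c _ => hf (x, c)).subset ?_
    rintro y ⟨c, hc, hy⟩
    exact mem_biUnion hc hy
  obtain ⟨N, hN⟩ := hU C' hC' hC'f
  refine ⟨N, ?_⟩
  rintro ⟨x, c0⟩ hc0
  obtain ⟨c, hcM, hcG⟩ := hmeet x c0 hc0
  have hle : {y | ((x, c0), y) ∈ C}.ncard ≤ {y | ((x, c), y) ∈ C}.ncard := by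
    by_contra hlt
    have hd : IsDef L K {t | {y | ((x, c0), y) ∈ C}.ncard ≤ {y | ((x, t), y) ∈ C}.ncard} :=
      (isDef_le_ncard hX.isDef hf _).mem (f := fun t => (x, t)) (by fun_prop)
    have h00 : c0 ∈ {t | {y | ((x, c0), y) ∈ C}.ncard ≤ {y | ((x, t), y) ∈ C}.ncard} := by
      rw [mem_ofPred_eq]
    obtain ⟨z, hz, hzf⟩ := exists_mem_frontier hd h00 hlt
    have h1 : ∀ᶠ t in 𝓝 z, {y | ((x, t), y) ∈ C}.ncard = {y | ((x, z), y) ∈ C}.ncard :=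
      (show Continuous fun t => (x, t) by fun_prop).continuousAt.eventually (hloc _ (hcG z hz))
    rw [frontier_eq_closure_inter_closure, mem_inter_iff, mem_closure_iff_frequently,
      mem_closure_iff_frequently] at hzf
    obtain ⟨t, ht1, ht2⟩ := (hzf.1.and_eventually h1).exists
    obtain ⟨t', ht1', ht2'⟩ := (hzf.2.and_eventually h1).exists
    simp only [mem_compl_iff, mem_ofPred_eq] at ht1 ht1'
    exact ht1' (by rwa [ht2', ← ht2])
  refine hle.trans ((ncard_le_ncard ?_ (hC'f x)).trans (hN x))
  exact fun y hy => ⟨c, hcM, hy⟩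

variable (K) in
/-- An injective definable continuous map from `K` into the interval `(-1, 1)`. -/
def squeeze (t : K) : K := t / (1 + |t|)

omit hE hC [TopologicalSpace K] [OrderTopology K] [L.Structure K] in
lemma one_add_abs_pos (t : K) : 0 < 1 + |t| := by positivity

lemma continuous_squeeze : Continuous (squeeze K) :=
  continuous_id.div (by fun_prop) fun t => (one_add_abs_pos t).ne'

lemma defMap_squeeze : DefMap L K (squeeze K) := by
  unfold squeeze; fun_prop

omit hE hC [TopologicalSpace K] [OrderTopology K] [L.Structure K] in
lemma abs_squeeze_lt_one (t : K) : |squeeze K t| < 1 := by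
  rw [squeeze, abs_div, abs_of_pos (one_add_abs_pos t), div_lt_one (one_add_abs_pos t)]
  linarith

omit hE hC [TopologicalSpace K] [OrderTopology K] [L.Structure K] in
lemma squeeze_injective : Function.Injective (squeeze K) := by
  have key : ∀ t : K, squeeze K t / (1 - |squeeze K t|) = t := by
    intro t
    have h := one_add_abs_pos t
    have h1 : 1 - |squeeze K t| = (1 + |t|)⁻¹ := by
      rw [squeeze, abs_div, abs_of_pos h]
      field_simp
      ring
    rw [h1, squeeze]
    field_simp
  intro s t hst
  rw [← key s, ← key t, hst]

/-- The base splits into the open set near which the fibers are matched and a closed set without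
interior; on both, the bound comes from a family over `K ^ n`. -/
lemma UniformFiniteness.succ (h : ClosedDiscreteFinite L K) {n : ℕ}
    (hcomp : ∀ k ≤ n + 1, SigmaCompl L K (Fin k → K))
    (hU : UniformFiniteness L K (Fin n → K)) : UniformFiniteness L K (Fin (n + 1) → K) := by
  intro C0 hC0 hf0
  -- Replace the base by a bounded one, so that the components of its fibers have midpoints.
  let φ : (Fin (n + 1) → K) → Fin (n + 1) → K := fun x i => squeeze K (x i)
  have hφc : Continuous φ :=
    continuous_pi fun i => continuous_squeeze.comp (continuous_apply i)
  have hφd : DefMap L K φ := .pi fun i => defMap_squeeze.comp (.apply i)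
  have hφi : Function.Injective φ := fun x y hxy => funext fun i =>
    squeeze_injective (congrFun hxy i)
  let C : Set ((Fin (n + 1) → K) × K) := (fun p => (φ p.1, p.2)) '' C0
  have hC : IsDSigma L K C := hC0.image (by fun_prop) (by fun_prop)
  have hCφ : ∀ x, {y | (φ x, y) ∈ C} = {y | (x, y) ∈ C0} := by
    intro x
    ext y
    constructor
    · rintro ⟨⟨x', y'⟩, hp, heq⟩
      simp only [Prod.mk.injEq] at heq
      obtain ⟨h1, rfl⟩ := heq
      rw [← hφi h1]
      exact hp
    · exact fun hy => ⟨(x, y), hy, rfl⟩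
  have hf : ∀ x, {y | (x, y) ∈ C}.Finite := by
    intro x
    by_cases hx : ∃ x', φ x' = x
    · obtain ⟨x', rfl⟩ := hx
      rw [hCφ]
      exact hf0 x'
    · convert Set.finite_empty
      refine eq_empty_of_forall_notMem fun y hy => ?_
      obtain ⟨⟨x', y'⟩, hp, heq⟩ := hy
      exact hx ⟨x', (Prod.ext_iff.1 heq).1⟩
  have hMd := (isDef_matchedSet hC.isDef).interior
  obtain ⟨N1, hN1⟩ := hU.exists_bound_of_interior_eq_empty h
    (fun k hk => hcomp k (hk.trans (Nat.le_succ n))) hC hf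
    (IsDSigma.of_isClosed hMd.compl isOpen_interior.isClosed_compl)
    ((sigmaNowhereDense_pi h _).interior_compl_matchedSet (sigmaBaire_pi h _) hC hf)
  let e := insertHomeo K (Fin.last n)
  have he := defMap_insertHomeo (L := L) (K := K) (Fin.last n)
  have he' := defMap_insertHomeo_symm (L := L) (K := K) (Fin.last n)
  have hec := e.continuous
  have hec' := e.symm.continuous
  have hcomp' : SigmaCompl L K ((Fin n → K) × K) := by
    intro X hX
    have h1 := (hcomp _ le_rfl _ (hX.preimage hec' he')).preimage hec he
    convert! h1 using 1
    ext p
    simp [e]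
  obtain ⟨N2, hN2⟩ := hU.exists_bound_of_isOpen h hcomp'
    (G := {p | e p ∈ interior (matchedSet K C) ∧ |p.2| < 1})
    (by refine .and (hMd.mem ?_) (.lt ?_ ?_) <;> fun_prop)
    ((isOpen_interior.preimage hec).inter (isOpen_lt (by fun_prop) (by fun_prop)))
    (fun p hp => hp.2) (C := {q | (e q.1, q.2) ∈ C}) (hC.mem (by fun_prop) (by fun_prop))
    (fun p => hf (e p))
    (fun p hp => hec.continuousAt.eventually (eventually_ncard_eq hf (interior_subset hp.1)))
  refine ⟨max N1 N2, fun x => ?_⟩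
  rw [← hCφ x]
  by_cases hx : φ x ∈ interior (matchedSet K C)
  · refine le_trans ?_ (le_max_right _ _)
    have := hN2 (e.symm (φ x)) ⟨by simpa using hx, abs_squeeze_lt_one _⟩
    simpa using this
  · exact (hN1 _ hx).trans (le_max_left _ _)

/-- The simultaneous induction: uniform finiteness over `K ^ n` gives complements in `K ^ (n + 1)`,
and these give uniform finiteness over `K ^ (n + 1)`. -/
lemma sigmaCompl_and_uniformFiniteness (h : ClosedDiscreteFinite L K) (n : ℕ) :
    (∀ k ≤ n, SigmaCompl L K (Fin k → K)) ∧ UniformFiniteness L K (Fin n → K) := by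
  induction n with
  | zero =>
    refine ⟨fun k hk => ?_, fun C hC hf => ?_⟩
    · obtain rfl := Nat.le_zero.1 hk
      exact fun X hX => .of_isClosed hX.isDef.compl (isClosed_discrete _)
    · refine ⟨{y | (default, y) ∈ C}.ncard, fun x => ?_⟩
      rw [Subsingleton.elim x default]
  | succ n ih =>
    have h1 : ∀ k ≤ n + 1, SigmaCompl L K (Fin k → K) := by
      intro k hk
      rcases Nat.lt_or_eq_of_le hk with hk | rfl
      · exact ih.1 k (Nat.le_of_lt_succ hk)
      · exact SigmaCompl.succ h ih.1 ih.2
    exact ⟨h1, ih.2.succ h h1⟩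

/-- The theorem of the complement for `D_Σ` sets. -/
lemma IsDSigma.compl (h : ClosedDiscreteFinite L K) {n : ℕ} {X : Set (Fin n → K)}
    (hX : IsDSigma L K X) : IsDSigma L K Xᶜ :=
  (sigmaCompl_and_uniformFiniteness h n).1 n le_rfl X hX

end Uniform

/-! ### The open core consists of `D_Σ` sets -/

section OpenCoreTameness

variable {L : FirstOrder.Language.{u, v}} {K : Type w} [L.Structure K] [TopologicalSpace K]

/-- The relation symbol that names a definable open set defines it. -/
lemma def_openCore_of_isOpen {n : ℕ} {U : Set (Fin n → K)} (hd : Def L U) (ho : IsOpen U) :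
    Def (openCore L K) U := by
  refine Set.Definable.mono (A := ∅) ?_ (empty_subset _)
  rw [Set.empty_definable_iff]
  let R : (openCore L K).Relations n := ⟨U, hd, ho⟩
  refine ⟨R.formula fun i => FirstOrder.Language.Term.var i, ?_⟩
  ext v
  rw [Set.mem_ofPred_eq, FirstOrder.Language.Formula.realize_rel]
  rfl

lemma def_openCore_of_isClosed {n : ℕ} {X : Set (Fin n → K)} (hd : Def L X) (hc : IsClosed X) :
    Def (openCore L K) X := by
  have := (def_openCore_of_isOpen (Set.Definable.compl hd) hc.isOpen_compl).compl
  rwa [compl_compl] at this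

lemma def₁_openCore_of_isClosed {X : Set K} (hd : Def₁ L X) (hc : IsClosed X) :
    Def₁ (openCore L K) X :=
  def_openCore_of_isClosed (X := {x : Fin 1 → K | x 0 ∈ X}) hd (hc.preimage (continuous_apply 0))

variable [Field K] [LinearOrder K] [IsStrictOrderedRing K] [OrderTopology K]

lemma expandsOrderedField_openCore (h : ExpandsOrderedField L K) :
    ExpandsOrderedField (openCore L K) K where
  lt_def := def_openCore_of_isOpen h.lt_def (isOpen_lt (by fun_prop) (by fun_prop))
  add_def := def_openCore_of_isClosed h.add_def (isClosed_eq (by fun_prop) (by fun_prop))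
  mul_def := def_openCore_of_isClosed h.mul_def (isClosed_eq (by fun_prop) (by fun_prop))

omit [Field K] [LinearOrder K] [IsStrictOrderedRing K] [OrderTopology K] in
/-- The language of the open core has no function symbols, so its terms are variables and
constants. -/
lemma realize_term_openCore {α : Type*}
    (t : ((openCore L K).withConstants (Set.univ : Set K)).Term α) :
    (∃ i, ∀ v : α → K, t.realize v = v i) ∨ ∃ c, ∀ v : α → K, t.realize v = c := by
  cases t with
  | var i => exact Or.inl ⟨i, fun v => rfl⟩
  | @func n f ts =>
    rcases f with f | f
    · exact Empty.elim f
    · match n, f, ts with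
      | 0, f, ts =>
        refine Or.inr ⟨FirstOrder.Language.Structure.funMap
          (L := ((openCore L K).withConstants (Set.univ : Set K))) (M := K) (Sum.inr f) default,
          fun v => ?_⟩
        simp only [FirstOrder.Language.Term.realize]
        congr 1
        exact Subsingleton.elim _ _
      | n + 1, f, ts => exact PEmpty.elim f

variable [hE : Fact (ExpandsOrderedField L K)] [hC : Fact (IsDefinablyComplete L K)]

/-- If closed discrete definable subsets of `K` are finite, then all sets definable in the open core
are `D_Σ`, by induction on formulas: negations and universal quantifiers are covered by the theorem
of the complement. The free and the bound variables together form one tuple in `K ^ (m + n)`. -/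
lemma IsDSigma.of_boundedFormula (h : ClosedDiscreteFinite L K) {m n : ℕ}
    (φ : ((openCore L K).withConstants (Set.univ : Set K)).BoundedFormula (Fin m) n) :
    IsDSigma L K {v : Fin (m + n) → K |
      φ.Realize (fun i => v (Fin.castAdd n i)) fun j => v (Fin.natAdd m j)} := by
  have hterm : ∀ {n : ℕ}
      (t : ((openCore L K).withConstants (Set.univ : Set K)).Term (Fin m ⊕ Fin n)),
      Continuous (fun v : Fin (m + n) → K =>
        t.realize (Sum.elim (fun i => v (Fin.castAdd n i)) fun j => v (Fin.natAdd m j))) ∧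
      DefMap L K (fun v : Fin (m + n) → K =>
        t.realize (Sum.elim (fun i => v (Fin.castAdd n i)) fun j => v (Fin.natAdd m j))) := by
    intro n t
    rcases realize_term_openCore t with ⟨i, hi⟩ | ⟨c, hc⟩
    · simp only [hi]
      cases i <;> simp only [Sum.elim_inl, Sum.elim_inr] <;> constructor <;> fun_prop
    · simp only [hc]
      constructor <;> fun_prop
  induction φ with
  | falsum => exact IsDSigma.empty
  | equal t₁ t₂ =>
    simp only [FirstOrder.Language.BoundedFormula.Realize]
    have := DSpace.t2 K K
    exact .of_isClosed (.eq (hterm t₁).2 (hterm t₂).2) (isClosed_eq (hterm t₁).1 (hterm t₂).1)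
  | rel R ts =>
    rcases R with R | R
    · simp only [FirstOrder.Language.BoundedFormula.Realize]
      exact (IsDSigma.of_isOpen (show IsDef L K R.1 from R.2.1) R.2.2).mem
        (f := fun v i => (ts i).realize _)
        (continuous_pi fun i => (hterm (ts i)).1) (.pi fun i => (hterm (ts i)).2)
    · exact isEmptyElim R
  | imp φ ψ ih₁ ih₂ =>
    simp only [FirstOrder.Language.BoundedFormula.Realize, imp_iff_not_or]
    exact (ih₁.compl h).union ih₂
  | @all k φ ih =>
    -- `∀ a, φ` is treated as `¬ ∃ a, ¬ φ`.
    have h1 : IsDSigma L K {v : Fin (m + k) → K | ∃ a : K,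
        insertHomeo K (Fin.last (m + k)) (v, a) ∈ ({v : Fin (m + (k + 1)) → K |
          φ.Realize (fun i => v (Fin.castAdd (k + 1) i)) fun j => v (Fin.natAdd m j)})ᶜ} := by
      have hc := (insertHomeo K (Fin.last (m + k))).continuous
      refine .ex ((ih.compl h).mem ?_ ?_) <;> fun_prop
    convert! h1.compl h using 1
    ext v
    simp only [FirstOrder.Language.BoundedFormula.Realize, mem_ofPred_eq, mem_compl_iff,
      not_exists, not_not]
    refine forall_congr' fun a => ?_
    have e1 : (fun i => insertHomeo K (Fin.last (m + k)) (v, a) (Fin.castAdd (k + 1) i)) =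
        fun i => v (Fin.castAdd k i) := by
      ext i
      rw [insertHomeo_apply, Fin.insertNth_last']
      exact Fin.snoc_castSucc (α := fun _ => K) a v (Fin.castAdd k i)
    have e2 : (fun j => insertHomeo K (Fin.last (m + k)) (v, a) (Fin.natAdd m j)) =
        (Fin.snoc (fun j => v (Fin.natAdd m j)) a : Fin (k + 1) → K) := by
      ext j
      rw [insertHomeo_apply, Fin.insertNth_last']
      refine Fin.lastCases ?_ (fun j => ?_) j
      · rw [Fin.snoc_last]
        exact Fin.snoc_last (α := fun _ => K) a v
      · rw [Fin.snoc_castSucc]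
        exact Fin.snoc_castSucc (α := fun _ => K) a v (Fin.natAdd m j)
    rw [← e1, ← e2]
    rfl

lemma IsDSigma.of_def₁_openCore (h : ClosedDiscreteFinite L K) {X : Set K}
    (hX : Def₁ (openCore L K) X) : IsDSigma L K X := by
  obtain ⟨φ, hφ⟩ := hX
  have h1 := (IsDSigma.of_boundedFormula (m := 1) (n := 0) h φ).mem
    (f := fun (t : K) (_ : Fin 1) => t) (by fun_prop) (by fun_prop)
  convert! h1 using 1
  ext t
  have h2 : (fun _ : Fin 1 => t) ∈ {x : Fin 1 → K | x 0 ∈ X} ↔ φ.Realize fun _ => t := by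
    rw [hφ]; rfl
  rw [show t ∈ X ↔ φ.Realize fun _ => t from h2]
  simp only [mem_ofPred_eq, FirstOrder.Language.Formula.Realize]
  rw [show (fun j : Fin 0 => t) = default from Subsingleton.elim _ _]

/-- Sets definable in the open core are `D_Σ`, hence have finite boundary. -/
lemma ClosedDiscreteFinite.hasOMinimalOpenCore (h : ClosedDiscreteFinite L K) :
    HasOMinimalOpenCore L K := fun _ hX =>
  have hσ := IsDSigma.of_def₁_openCore h hX
  exists_intervals_of_finite_frontier hσ.isDef (hσ.finite_frontier h)

end OpenCoreTameness

/-! ### O-minimality, local o-minimality and pseudo-finite sets -/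

section OMinimal

variable {L : FirstOrder.Language.{u, v}} {K : Type w} [L.Structure K]
  [Field K] [LinearOrder K] [TopologicalSpace K] [IsStrictOrderedRing K] [OrderTopology K]

omit [L.Structure K] [TopologicalSpace K] [OrderTopology K] in
lemma IsPointOrInterval.exists_Ioo {S : Set K} (hS : IsPointOrInterval S) (x : K) :
    ∃ y, x < y ∧ (Ioo x y ⊆ S ∨ Ioo x y ⊆ Sᶜ) := by
  have hx1 : x < x + 1 := by linarith
  rcases hS with ⟨a, rfl⟩ | ⟨a, b, rfl⟩ | ⟨a, rfl⟩ | ⟨b, rfl⟩ | rfl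
  · by_cases hax : x < a
    · exact ⟨a, hax, Or.inr fun z hz hza => hz.2.ne hza⟩
    · refine ⟨x + 1, hx1, Or.inr fun z hz hza => hax ?_⟩
      rw [mem_singleton_iff] at hza
      exact hza ▸ hz.1
  · by_cases hxa : x < a
    · exact ⟨a, hxa, Or.inr fun z hz hz' => lt_asymm hz.2 hz'.1⟩
    · by_cases hxb : x < b
      · exact ⟨b, hxb, Or.inl fun z hz => ⟨(not_lt.1 hxa).trans_lt hz.1, hz.2⟩⟩
      · exact ⟨x + 1, hx1, Or.inr fun z hz hz' => hxb (hz.1.trans hz'.2)⟩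
  · by_cases hxa : x < a
    · exact ⟨a, hxa, Or.inr fun z hz hz' => lt_asymm hz.2 hz'⟩
    · exact ⟨x + 1, hx1, Or.inl fun z hz => (not_lt.1 hxa).trans_lt hz.1⟩
  · by_cases hxb : x < b
    · exact ⟨b, hxb, Or.inl fun z hz => hz.2⟩
    · exact ⟨x + 1, hx1, Or.inr fun z hz hz' => hxb (hz.1.trans hz')⟩
  · exact ⟨x + 1, hx1, Or.inl (subset_univ _)⟩

omit [L.Structure K] [TopologicalSpace K] [OrderTopology K] in
lemma exists_Ioo_of_sUnion {F : Set (Set K)} (hF : F.Finite)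
    (hS : ∀ S ∈ F, IsPointOrInterval S) (x : K) :
    ∃ y, x < y ∧ (Ioo x y ⊆ ⋃₀ F ∨ Ioo x y ⊆ (⋃₀ F)ᶜ) := by
  induction F, hF using Set.Finite.induction_on with
  | empty => exact ⟨x + 1, by linarith, Or.inr (by simp)⟩
  | @insert S F _ _ ih =>
    obtain ⟨y1, hy1, h1⟩ := ih fun S hSF => hS S (mem_insert_of_mem _ hSF)
    obtain ⟨y2, hy2, h2⟩ := (hS S (mem_insert _ _)).exists_Ioo x
    rw [sUnion_insert]
    rcases h1 with h1 | h1
    · exact ⟨y1, hy1, Or.inl (h1.trans subset_union_right)⟩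
    rcases h2 with h2 | h2
    · exact ⟨y2, hy2, Or.inl (h2.trans subset_union_left)⟩
    refine ⟨min y1 y2, lt_min hy1 hy2, Or.inr fun z hz hzU => ?_⟩
    have hz' := lt_min_iff.1 hz.2
    rcases hzU with hzU | hzU
    · exact h2 ⟨hz.1, hz'.2⟩ hzU
    · exact h1 ⟨hz.1, hz'.1⟩ hzU

lemma DefFun.defMap {f : K → K} (hf : DefFun L f) : DefMap L K f := by
  have h1 : IsDef L K {x : Fin 2 → K | (x 0, x 1) ∈ {p : K × K | p.2 = f p.1}} := hf
  have h2 := h1.mem (E := K × K) (f := fun p => ![p.1, p.2])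
    (.pi fun i => by fin_cases i <;> simp <;> fun_prop)
  simpa [DefMap, eq_comm] using h2

lemma DefMap.defFun {f : K → K} (hf : DefMap L K f) : DefFun L f := by
  have h2 := IsDef.mem (E := Fin 2 → K) hf (f := fun x => (x 0, x 1)) (by fun_prop)
  show IsDef L K {x : Fin 2 → K | (x 0, x 1) ∈ {p : K × K | p.2 = f p.1}}
  simpa [eq_comm] using h2

lemma IsOMinimal.isLocallyOMinimal [hE : Fact (ExpandsOrderedField L K)]
    (h : IsOMinimal L K) : IsLocallyOMinimal L K := by
  intro f hf x
  have hf' := hf.defMap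
  obtain ⟨F1, hF1, hS1, he1⟩ := h {z | 0 < f z} (isDef_iff_def₁.1 (.lt (.const 0) hf'))
  obtain ⟨F2, hF2, hS2, he2⟩ := h {z | f z = 0} (isDef_iff_def₁.1 (.eq hf' (.const 0)))
  obtain ⟨y1, hy1, h1⟩ := exists_Ioo_of_sUnion hF1 hS1 x
  obtain ⟨y2, hy2, h2⟩ := exists_Ioo_of_sUnion hF2 hS2 x
  rw [← he1] at h1
  rw [← he2] at h2
  rcases h1 with h1 | h1
  · exact ⟨y1, hy1, Or.inl h1⟩
  rcases h2 with h2 | h2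
  · exact ⟨y2, hy2, Or.inr (Or.inl h2)⟩
  refine ⟨min y1 y2, lt_min hy1 hy2, Or.inr (Or.inr fun z hz => ?_)⟩
  have hz' := lt_min_iff.1 hz.2
  exact lt_of_le_of_ne (not_lt.1 (h1 ⟨hz.1, hz'.1⟩)) (h2 ⟨hz.1, hz'.2⟩)

lemma interior_eq_empty_of_isDiscrete {X : Set K} (h : IsDiscrete X) : interior X = ∅ := by
  refine eq_empty_of_forall_notMem fun x hx => ?_
  obtain ⟨ε, hε, h1⟩ := (isDiscrete_iff_d (K := K)).1 h x (interior_subset hx)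
  obtain ⟨ε', hε', h2⟩ := (mem_interior_iff_d (K := K)).1 hx
  have hpos : 0 < min ε ε' := lt_min hε hε'
  have hd : d K x (x + min ε ε' / 2) = min ε ε' / 2 := by
    rw [d_eq_abs, sub_add_cancel_left, abs_neg, abs_of_pos (by linarith)]
  have := h1 _ (h2 (x + min ε ε' / 2) (by rw [hd]; linarith [min_le_right ε ε']))
    (by rw [hd]; linarith [min_le_left ε ε'])
  linarith

lemma HasOMinimalOpenCore.finite_of_isPseudoFinite (h : HasOMinimalOpenCore L K) {X : Set K}
    (hX : IsPseudoFinite₁ L X) : X.Finite := by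
  have hi := interior_eq_empty_of_isDiscrete hX.discrete
  obtain ⟨F, hF, hS, rfl⟩ := h _ (def₁_openCore_of_isClosed hX.definable hX.closed)
  refine hF.sUnion fun S hSF => ?_
  have hsub : S ⊆ ⋃₀ F := subset_sUnion_of_mem hSF
  have hopen : IsOpen S → S.Finite := fun ho => by
    have hS0 := interior_maximal hsub ho
    rw [hi] at hS0
    exact finite_empty.subset hS0
  rcases hS S hSF with ⟨a, rfl⟩ | ⟨a, b, rfl⟩ | ⟨a, rfl⟩ | ⟨b, rfl⟩ | rfl
  · exact finite_singleton a
  · exact hopen isOpen_Ioo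
  · exact hopen isOpen_Ioi
  · exact hopen isOpen_Iio
  · exact hopen isOpen_univ

variable [hE : Fact (ExpandsOrderedField L K)]

/-- In an a-minimal structure a closed definable set without interior is bounded: consider the sign
of the characteristic function of `{x | x⁻¹ ∈ X}` to the right of `0`. -/
lemma IsAMinimal.exists_upper_bound (h : IsAMinimal L K) {X : Set K} (hd : IsDef L K X)
    (hc : IsClosed X) (hi : interior X = ∅) : ∃ b, ∀ x ∈ X, x ≤ b := by
  classical
  have : Fact (ExpandsOrderedField (openCore L K) K) := ⟨expandsOrderedField_openCore hE.out⟩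
  have hd' : IsDef (openCore L K) K X := def₁_openCore_of_isClosed (isDef_iff_def₁.1 hd) hc
  let f : K → K := fun x => if x⁻¹ ∈ X then 1 else 0
  have hf : DefMap (openCore L K) K f := by
    have : IsDef (openCore L K) K {p : K × K | (p.1⁻¹ ∈ X ∧ p.2 = 1) ∨ (p.1⁻¹ ∉ X ∧ p.2 = 0)} := by
      refine .or (.and (hd'.mem ?_) (.eq ?_ ?_)) (.and (.not (hd'.mem ?_)) (.eq ?_ ?_))
        <;> fun_prop
    unfold DefMap
    convert! this using 1
    ext p
    by_cases hp : p.1⁻¹ ∈ X <;> simp [f, hp, eq_comm]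
  obtain ⟨y, hy, h1⟩ := h f hf.defFun 0
  have hmem : ∀ z, y⁻¹ < z → z⁻¹ ∈ Ioo 0 y := fun z hz =>
    ⟨inv_pos.2 ((inv_pos.2 hy).trans hz), inv_lt_of_inv_lt₀ hy hz⟩
  rcases h1 with h1 | h1 | h1
  · have hsub : Ioi y⁻¹ ⊆ X := by
      intro z hz
      by_contra hzX
      have := h1 _ (hmem z hz)
      simp [f, hzX] at this
    have := interior_maximal hsub isOpen_Ioi (show y⁻¹ + 1 ∈ Ioi y⁻¹ by simp)
    rw [hi] at this
    exact this.elim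
  · refine ⟨y⁻¹, fun x hx => ?_⟩
    by_contra! hlt
    have := h1 _ (hmem x hlt)
    simp [f, hx] at this
  · have hz := h1 _ (hmem (y⁻¹ + 1) (by simp))
    by_cases hX : (y⁻¹ + 1) ∈ X
    · simp only [f, inv_inv, hX, if_true] at hz
      exact absurd hz (not_lt.2 zero_le_one)
    · simp [f, hX] at hz

/-- In an a-minimal structure closed discrete definable sets are bounded, that is, pseudo-finite. -/
lemma IsAMinimal.closedDiscreteFinite (h : IsAMinimal L K)
    (hpf : ∀ X : Set K, IsPseudoFinite₁ L X → X.Finite) : ClosedDiscreteFinite L K := by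
  intro X hd hc hdisc
  have hi := interior_eq_empty_of_isDiscrete hdisc
  obtain ⟨b, hb⟩ := h.exists_upper_bound hd hc hi
  have hneg : interior (-X) = ∅ := by
    have := (Homeomorph.neg K).preimage_interior X
    rw [hi] at this
    exact this.symm
  obtain ⟨b', hb'⟩ := h.exists_upper_bound (X := -X)
    (hd.mem (f := fun x => -x) (by fun_prop)) hc.neg hneg
  refine hpf X ⟨isDef_iff_def₁.1 hd, hc, ⟨max b b', fun x hx => abs_le.2 ⟨?_, ?_⟩⟩, hdisc⟩
  · have := hb' (-x) (by simpa using hx)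
    linarith [le_max_right b b']
  · exact (hb x hx).trans (le_max_left _ _)

omit hE in
lemma isDiscrete_preimage_eval {X : Set K} (h : IsDiscrete X) :
    IsDiscrete {x : Fin 1 → K | x 0 ∈ X} := by
  rw [isDiscrete_iff_d (K := K)] at h ⊢
  intro x hx
  obtain ⟨ε, hε, h1⟩ := h (x 0) hx
  refine ⟨ε, hε, fun y hy hd => ?_⟩
  rw [d_pi, Fin.sum_univ_one] at hd
  have := h1 (y 0) hy (by rwa [d_eq_abs])
  ext i
  rw [Subsingleton.elim i 0, this]

omit hE [L.Structure K] [TopologicalSpace K] [OrderTopology K] [Field K] [LinearOrder K]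
  [IsStrictOrderedRing K] in
lemma finite_of_preimage_eval {X : Set K} (h : {x : Fin 1 → K | x 0 ∈ X}.Finite) : X.Finite := by
  refine (h.image fun x => x 0).subset fun t ht => ⟨fun _ => t, ht, rfl⟩

lemma defMap_append {m n : ℕ} :
    DefMap L K fun p : (Fin m → K) × (Fin n → K) => Fin.append p.1 p.2 := by
  refine .pi fun i => ?_
  refine Fin.addCases (fun i => ?_) (fun i => ?_) i
  · simp only [Fin.append_left]; fun_prop
  · simp only [Fin.append_right]; fun_prop

variable [hC : Fact (IsDefinablyComplete L K)]

/-- If definable discrete sets are finite, then finiteness of definable sets amounts to the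
definable condition of being discrete. -/
lemma ClosedDiscreteFinite.isDefinableProperty_finite (h : ClosedDiscreteFinite L K) :
    IsDefinableProperty L (fun (n : ℕ) (X : Set (Fin n → K)) => X.Finite) := by
  intro m n A X hA hX
  have hA' : IsDef L K A := hA
  have hX' : IsDef L K X := hX
  have hap := defMap_append (L := L) (K := K) (m := m) (n := n)
  have h1 : IsDef L K {y : Fin m → K | y ∈ A ∧ ∀ z : Fin n → K, Fin.append y z ∈ X →
      ∃ ε : K, 0 < ε ∧ ∀ z' : Fin n → K, Fin.append y z' ∈ X → d K z z' < ε → z' = z} := by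
    refine .and (hA'.mem .id) (.all (.imp (hX'.mem hap) (.ex (.and (.lt ?_ ?_)
      (.all (.imp (hX'.mem ?_) (.imp (.lt ?_ ?_) (.eq ?_ ?_))))))))
    · fun_prop
    · fun_prop
    · exact hap.comp (f := fun q : (((Fin m → K) × (Fin n → K)) × K) × (Fin n → K) =>
        (q.1.1.1, q.2)) (by fun_prop)
    all_goals fun_prop
  show IsDef L K {y : Fin m → K | y ∈ A ∧ (fiber X y).Finite}
  convert! h1 using 1
  ext y
  refine and_congr_right fun _ => ?_
  have h2 : (fiber X y).Finite ↔ IsDiscrete (fiber X y) := by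
    refine ⟨fun hf => hf.isDiscrete, fun hd => h.finite ?_ hd⟩
    exact hX'.mem (f := fun z => Fin.append y z)
      (hap.comp (f := fun z : Fin n → K => (y, z)) (by fun_prop))
  rw [h2, isDiscrete_iff_d (K := K)]
  rfl

/-- Definable induction along a pseudo-finite set `X`: the points of `X` below which `X` is finite
form a definable subset, which contains its supremum `m`; if `X` had points above `m`, the least of
them would be in the subset as well. -/
lemma IsPseudoFinite₁.finite_of_isDef {X : Set K} (hX : IsPseudoFinite₁ L X)
    (h : IsDef L K {a | (X ∩ Iic a).Finite}) : X.Finite := by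
  obtain ⟨r, hr⟩ := hX.bounded
  have hd : IsDef L K X := hX.definable
  have hcl : ∀ B ⊆ X, IsClosed B := fun B hB =>
    isClosed_of_subset_discrete_closed hB hX.discrete hX.closed
  have hinf : ∀ B ⊆ X, IsDef L K B → B.Nonempty → ∃ m ∈ B, ∀ x ∈ B, m ≤ x := by
    intro B hB hBd hne
    obtain ⟨m, hm⟩ := exists_isGLB hBd hne ⟨-r, fun x hx => (abs_le.1 (hr x (hB hx))).1⟩
    exact ⟨m, (hcl B hB).closure_subset (hm.mem_closure hne), fun x hx => hm.1 hx⟩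
  rcases X.eq_empty_or_nonempty with rfl | hne
  · exact finite_empty
  obtain ⟨m0, hm0, hm0'⟩ := hinf X subset_rfl hd hne
  have hF : IsDef L K (X ∩ {a | (X ∩ Iic a).Finite}) := hd.inter h
  have hFne : (X ∩ {a | (X ∩ Iic a).Finite}).Nonempty := by
    refine ⟨m0, hm0, (finite_singleton m0).subset fun x hx => ?_⟩
    exact le_antisymm hx.2 (hm0' x hx.1)
  obtain ⟨m, hm⟩ := exists_isLUB hF hFne ⟨r, fun x hx => (abs_le.1 (hr x hx.1)).2⟩
  have hmF := (hcl _ inter_subset_left).closure_subset (hm.mem_closure hFne)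
  by_contra hinfX
  have hne' : (X ∩ Ioi m).Nonempty := by
    by_contra hempty
    refine hinfX (hmF.2.subset fun x hx => ⟨hx, ?_⟩)
    by_contra hlt
    exact hempty ⟨x, hx, not_le.1 hlt⟩
  obtain ⟨p, hp, hp'⟩ := hinf (X ∩ Ioi m) inter_subset_left
    (hd.inter (by refine .lt ?_ ?_ <;> fun_prop)) hne'
  have hpF : p ∈ X ∩ {a | (X ∩ Iic a).Finite} := by
    refine ⟨hp.1, (hmF.2.union (finite_singleton p)).subset fun x hx => ?_⟩
    by_cases hxm : x ≤ m
    · exact Or.inl ⟨hx.1, hxm⟩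
    · exact Or.inr (le_antisymm hx.2 (hp' x ⟨hx.1, not_le.1 hxm⟩))
  exact absurd (hm.1 hpF) (not_le.2 hp.2)

/-- The initial segments `X ∩ (-∞, a]` are the fibers of a definable set, so the set of those `a`
for which this segment is finite is definable. -/
lemma IsPseudoFinite₁.finite_of_def_finSet {X : Set K} (hX : IsPseudoFinite₁ L X)
    (h : ∀ X : Set (Fin (1 + 1) → K), Def L X → Def L (finSet 1 X)) : X.Finite := by
  have hd : IsDef L K X := hX.definable
  let Y : Set (Fin (1 + 1) → K) := {v | v 1 ∈ X ∧ v 1 ≤ v 0}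
  have hY : IsDef L K Y := by
    refine .and (hd.mem ?_) (.le ?_ ?_) <;> fun_prop
  have h1 : IsDef L K (finSet 1 Y) := h Y hY
  refine hX.finite_of_isDef ?_
  convert! h1.mem (f := fun (a : K) (_ : Fin 1) => a) (by fun_prop) using 1
  ext a
  have h2 : fiber Y (fun _ : Fin 1 => a) = {z : Fin 1 → K | z 0 ∈ X ∩ Iic a} := by
    ext z
    rfl
  simp only [finSet, mem_ofPred_eq, h2]
  refine ⟨fun hf => ?_, finite_of_preimage_eval⟩
  refine hf.of_injOn (f := fun z : Fin 1 → K => z 0) (fun z hz => hz) fun z _ z' _ heq => ?_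
  ext i
  rw [Subsingleton.elim i 0]
  exact heq

end OMinimal

end Tame

theorem mainTheorem2 (L : FirstOrder.Language.{u, v}) (K : Type w)
    [Field K] [LinearOrder K] [IsStrictOrderedRing K] [TopologicalSpace K] [OrderTopology K]
    [L.Structure K]
    (hexp : Tame.ExpandsOrderedField L K) (hdc : Tame.IsDefinablyComplete L K) :
    List.TFAE [
      Tame.IsAMinimal L K ∧ ∀ X : Set K, Tame.IsPseudoFinite₁ L X → X.Finite,
      Tame.IsAMinimal L K ∧
        ∀ (n : ℕ) (X : Set (Fin n → K)), Tame.IsPseudoFinite L X → X.Finite,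
      Tame.IsAMinimal L K ∧
        ∀ X : Set (Fin (1 + 1) → K), Tame.Def L X → Tame.Def L (Tame.finSet 1 X),
      Tame.IsAMinimal L K ∧
        Tame.IsDefinableProperty L (fun (n : ℕ) (X : Set (Fin n → K)) => X.Finite),
      Tame.HasOMinimalOpenCore L K,
      ∀ X : Set K, Tame.Def₁ L X → IsClosed X → IsDiscrete X → X.Finite,
      ∀ (n : ℕ) (X : Set (Fin n → K)), Tame.Def L X → IsClosed X → IsDiscrete X → X.Finite,
      ∀ X : Set K, Tame.Def₁ L X → IsDiscrete X → X.Finite,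
      ∀ (n : ℕ) (X : Set (Fin n → K)), Tame.Def L X → IsDiscrete X → X.Finite] := by
  have : Fact (Tame.ExpandsOrderedField L K) := ⟨hexp⟩
  have : Fact (Tame.IsDefinablyComplete L K) := ⟨hdc⟩
  have : Fact (Tame.ExpandsOrderedField (Tame.openCore L K) K) :=
    ⟨Tame.expandsOrderedField_openCore hexp⟩
  tfae_have 1 → 6 := fun h => h.1.closedDiscreteFinite h.2
  tfae_have 6 → 9 := fun h n X hX hd =>
    Tame.ClosedDiscreteFinite.finite (L := L) (K := K) h hX hd
  tfae_have 9 → 7 := fun h n X hX _ hd => h n X hX hd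
  tfae_have 9 → 8 := fun h X hX hd =>
    Tame.finite_of_preimage_eval (h 1 _ hX (Tame.isDiscrete_preimage_eval hd))
  tfae_have 8 → 6 := fun h X hX _ hd => h X hX hd
  tfae_have 7 → 6 := fun h X hX hc hd =>
    Tame.finite_of_preimage_eval (h 1 _ hX (hc.preimage (continuous_apply 0))
      (Tame.isDiscrete_preimage_eval hd))
  tfae_have 6 → 5 := fun h => Tame.ClosedDiscreteFinite.hasOMinimalOpenCore h
  tfae_have 5 → 1 := fun h =>
    ⟨Tame.IsOMinimal.isLocallyOMinimal h, fun X hX => h.finite_of_isPseudoFinite hX⟩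
  tfae_have 1 → 2 := fun h => ⟨h.1, fun n X hX =>
    (h.1.closedDiscreteFinite h.2).finite hX.definable hX.discrete⟩
  tfae_have 2 → 1 := fun h => ⟨h.1, fun X hX =>
    Tame.finite_of_preimage_eval (h.2 1 _ ⟨hX.definable, hX.closed.preimage (continuous_apply 0),
      hX.bounded.imp fun r hr x hx i => by rw [Subsingleton.elim i 0]; exact hr _ hx,
      Tame.isDiscrete_preimage_eval hX.discrete⟩)⟩
  tfae_have 1 → 4 := fun h =>
    ⟨h.1, (h.1.closedDiscreteFinite h.2).isDefinableProperty_finite⟩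
  tfae_have 4 → 3 := fun h => ⟨h.1, fun X hX => by
    have := h.2 1 1 Set.univ X Set.definable_univ hX
    simpa [Tame.finSet] using this⟩
  tfae_have 3 → 1 := fun h => ⟨h.1, fun X hX => hX.finite_of_def_finSet h.2⟩
  tfae_finish
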